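/- Let $n\ge 1$, $M,\nu>0$. There are constants $c=c(M,\nu,n)>0$ and $C=C(M,\nu,n)>0$ such that the following holds for every Muckenhoupt weight $\omega\in A_2(\mathbb R^n,dx)$ (a measurable $\omega:\mathbb R^n\to(0,\infty)$ with $\sup_Q \big(\frac1{|Q|}\int_Q\omega\big)\big(\frac1{|Q|}\int_Q\omega^{-1}\big)<\infty$ over all cubes $Q$ with sides parallel to the axes) and every measurable $A:\mathbb R\times\mathbb R^n\to M_n(\mathbb C)$ with $$|A(t,x)\xi\cdot\zeta|\le M\omega(x)|\xi||\zeta|,\qquad \nu|\xi|^2\omega(x)\le \mathrm{Re}\,(A(t,x)\xi\cdot\overline\xi)\qquad(\xi,\zeta\in\mathbb C^n,\ (t,x)\in\mathbb R\times\mathbb R^n).$$ Write $d\omega=\omega\,dx$, $\|f\|_{L^2_\omega(K)}=(\int_K|f|^2d\omega)^{1/2}$, $\langle f,g\rangle_{2,\omega}=\int_{\mathbb R^n} f\overline g\,d\omega$, and let $H^1_\omega(\mathbb R^n)$ be the space of $f\in L^2_\omega(\mathbb R^n)$ whose distributional gradient is in $L^2_\omega(\mathbb R^n)^n$. A fundamental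 solution of $\mathcal H=\partial_t-\omega^{-1}\mathrm{div}_x(A(t,\cdot)\nabla_x)$ is a family $(\Gamma(t,s))_{t,s\in\mathbb R}$ of bounded operators on $L^2_\omega(\mathbb R^n)$ such that: (1) $\sup_{t,s}\|\Gamma(t,s)\|<\infty$; (2) $\Gamma(t,s)=0$ if $s>t$; (3) $(t,s)\mapsto\langle\Gamma(t,s)\psi,\tilde\psi\rangle_{2,\omega}$ is Borel measurable for all $\psi,\tilde\psi\in\mathcal D(\mathbb R^n)$; (4) for all $\phi\in\mathcal D(\mathbb R)$, $\psi\in\mathcal D(\mathbb R^n)$, every $u\in L^1_{\rm loc}(\mathbb R;H^1_\omega(\mathbb R^n))$ with $\int_{\mathbb R}\|\nabla_xu(t)\|_{L^2_\omega}^2dt<\infty$ solving $\mathcal Hu=\phi\otimes\psi$, i.e. $$\iint\big(-u\,\partial_t\varphi+\omega^{-1}A\nabla_xu\cdot\nabla_x\varphi\big)\,d\omega\,dt=\iint\phi(t)\psi(x)\varphi(t,x)\,d\omega\,dt\quad\text{for all }\varphi\in\mathcal D(\mathbb R\times\mathbb R^n),$$ satisfies, for every $\tilde\psi\in\mathcal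 D(\mathbb R^n)$, $\langle u(t),\tilde\psi\rangle_{2,\omega}=\int_{-\infty}^t\phi(s)\langle\Gamma(t,s)\psi,\tilde\psi\rangle_{2,\omega}\,ds$ for almost every $t$. A fundamental solution $(\tilde\Gamma(s,t))_{s,t\in\mathbb R}$ of $\mathcal H^\star=-\partial_s-\omega^{-1}\mathrm{div}_x(A^\star(s,\cdot)\nabla_x)$, with $A^\star$ the hermitian adjoint of $A$, is defined in the same way, with $\tilde\Gamma(s,t)=0$ if $s>t$ and $\langle u(s),\tilde\psi\rangle_{2,\omega}=\int_s^{\infty}\phi(t)\langle\tilde\Gamma(s,t)\psi,\tilde\psi\rangle_{2,\omega}\,dt$ for almost every $s$. These properties determine $\Gamma(t,s)$ and $\tilde\Gamma(s,t)$ only for almost every $(t,s)$; call such a family the continuous version if, for all $\psi,\tilde\psi\in\mathcal D(\mathbb R^n)$, $\langle\Gamma(t,s)\psi,\tilde\psi\rangle_{2,\omega}$ (respectively $\langle\tilde\Gamma(s,t)\psi,\tilde\psi\rangle_{2,\omega}$) is separately continuous in $t$ and in $s$ on $\{t>s\}$. Claim. If $\Gamma$ is the continuous version of the fundamental solution of $\mathcal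 H$, then for all $t>s$, all measurable sets $E,F\subset\mathbb R^n$ with Euclidean distance $d=\mathrm{dist}(E,F)$, and all $f\in L^2_\omega(\mathbb R^n)$ supported in $E$, $$\|\Gamma(t,s)f\|_{L^2_\omega(F)}\le C\,e^{-c\,d^2/(t-s)}\,\|f\|_{L^2_\omega(E)}.$$ For an arbitrary fundamental solution $\Gamma$ this holds, for all such $E,F,f$, for almost every $(t,s)$ with $t>s$. The same statements are true for $\tilde\Gamma(s,t)$ in place of $\Gamma(t,s)$. -/

import Mathlib

open MeasureTheory
open scoped ENNReal Matrix

noncomputable section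

namespace DegParabolic

variable {n : ℕ}

/-- `ℝⁿ` with the Euclidean norm. -/
abbrev Rn (n : ℕ) := EuclideanSpace ℝ (Fin n)

/-- `ℂⁿ` with the Hermitian norm. -/
abbrev Cn (n : ℕ) := EuclideanSpace ℂ (Fin n)

/-- The cube with sides parallel to the axes, corner `a` and side length `r`. -/
def cube (a : Rn n) (r : ℝ) : Set (Rn n) := {x | ∀ i, a i ≤ x i ∧ x i ≤ a i + r}

/-- The Muckenhoupt constant `[ω]_{A₂}`. -/
def a2Const (ω : Rn n → ℝ) : ℝ≥0∞ :=
  ⨆ (a : Rn n) (r : ℝ) (_ : 0 < r),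
    ((volume (cube a r))⁻¹ * ∫⁻ x in cube a r, ENNReal.ofReal (ω x)) *
      ((volume (cube a r))⁻¹ * ∫⁻ x in cube a r, ENNReal.ofReal (ω x)⁻¹)

/-- The Muckenhoupt class `A₂(ℝⁿ, dx)`: positive (Lebesgue) measurable functions with finite
`A₂` constant. -/
structure IsA2Weight (ω : Rn n → ℝ) : Prop where
  measurable : AEMeasurable ω volume
  pos : ∀ x, 0 < ω x
  const_lt_top : a2Const ω < ⊤

/-- The measure `dω = ω(x) dx`. -/
def wMeasure (ω : Rn n → ℝ) : Measure (Rn n) :=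
  volume.withDensity fun x => ENNReal.ofReal (ω x)

/-- `L²_ω(ℝⁿ)`. -/
abbrev L2w (ω : Rn n → ℝ) := Lp ℂ 2 (wMeasure ω)

/-- `L²_ω(ℝⁿ)ⁿ`. -/
abbrev L2wVec (ω : Rn n → ℝ) := Lp (Cn n) 2 (wMeasure ω)

/-- Complex-valued smooth compactly supported functions. -/
def IsTest {V : Type*} [NormedAddCommGroup V] [NormedSpace ℝ V] (φ : V → ℂ) : Prop :=
  ContDiff ℝ ((⊤ : ℕ∞) : WithTop ℕ∞) φ ∧ HasCompactSupport φ

/-- The elements of `L²_ω(ℝⁿ)` which are classes of functions in `𝒟(ℝⁿ)`. -/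
def testL2w (ω : Rn n → ℝ) : Set (L2w ω) :=
  {ψ | ∃ ψ₀ : Rn n → ℂ, IsTest ψ₀ ∧ ψ =ᵐ[wMeasure ω] ψ₀}

/-- The gradient of a function on `ℝⁿ` with complex values, as the vector of its partial
derivatives. -/
def grad (φ : Rn n → ℂ) (x : Rn n) : Fin n → ℂ :=
  fun i => fderiv ℝ φ x (EuclideanSpace.single i 1)

/-- `g ∈ L²_ω(ℝⁿ)ⁿ` is the distributional gradient of `f ∈ L²_ω(ℝⁿ)`. In particular
`f ∈ H¹_ω(ℝⁿ)` iff such a `g` exists. -/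
def HasWeakGrad (ω : Rn n → ℝ) (f : L2w ω) (g : L2wVec ω) : Prop :=
  ∀ φ : Rn n → ℂ, IsTest φ → ∀ i, ∫ x, f x * grad φ x i = -∫ x, g x i * φ x

/-- Complex measurable coefficients with degenerate ellipticity dictated by `ω`, with constants
`M` and `ν`. The dot product `⬝ᵥ` is bilinear. -/
structure IsElliptic (ω : Rn n → ℝ) (M ν : ℝ)
    (A : ℝ → Rn n → Matrix (Fin n) (Fin n) ℂ) : Prop where
  measurable : ∀ i j, AEMeasurable (fun p : ℝ × Rn n => A p.1 p.2 i j) volume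
  upper : ∀ t x, ∀ ξ ζ : Cn n, ‖(A t x *ᵥ ξ.ofLp) ⬝ᵥ ζ.ofLp‖ ≤ M * ω x * ‖ξ‖ * ‖ζ‖
  lower : ∀ t x, ∀ ξ : Cn n, ν * ‖ξ‖ ^ 2 * ω x ≤ ((A t x *ᵥ ξ.ofLp) ⬝ᵥ star ξ.ofLp).re

/-- `u ∈ L¹_loc(ℝ; H¹_ω(ℝⁿ))` with `∫_ℝ ‖∇ₓu(t)‖² dt < ∞`, where `G = ∇ₓ u`. -/
structure IsEnergyClass (ω : Rn n → ℝ) (u : ℝ → L2w ω) (G : ℝ → L2wVec ω) : Prop where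
  locInt : LocallyIntegrable u volume
  gradL2 : MemLp G 2 volume
  isGrad : ∀ᵐ t, HasWeakGrad ω (u t) (G t)

/-- `∂ₜ u - ω⁻¹ divₓ(A ∇ₓ u) = φ ⊗ ψ` in `𝒟'(ℝ × ℝⁿ)`, with `G = ∇ₓ u` and with the bracket
defined by integration against `dω dt`. -/
def SolvesForward (ω : Rn n → ℝ) (A : ℝ → Rn n → Matrix (Fin n) (Fin n) ℂ)
    (φ : ℝ → ℂ) (ψ : L2w ω) (u : ℝ → L2w ω) (G : ℝ → L2wVec ω) : Prop :=
  ∀ Φ : ℝ × Rn n → ℂ, IsTest Φ →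
    ∫ t, ∫ x, (-(u t x * deriv (fun τ => Φ (τ, x)) t) +
        ((ω x)⁻¹ : ℂ) * ((A t x *ᵥ (G t x).ofLp) ⬝ᵥ grad (fun y => Φ (t, y)) x)) ∂(wMeasure ω)
      = ∫ t, ∫ x, φ t * ψ x * Φ (t, x) ∂(wMeasure ω)

/-- `-∂ₛ u - ω⁻¹ divₓ(A⋆ ∇ₓ u) = φ ⊗ ψ` in `𝒟'(ℝ × ℝⁿ)`, with `G = ∇ₓ u` and `A⋆` the hermitian
adjoint of `A`. -/
def SolvesBackward (ω : Rn n → ℝ) (A : ℝ → Rn n → Matrix (Fin n) (Fin n) ℂ)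
    (φ : ℝ → ℂ) (ψ : L2w ω) (u : ℝ → L2w ω) (G : ℝ → L2wVec ω) : Prop :=
  ∀ Φ : ℝ × Rn n → ℂ, IsTest Φ →
    ∫ s, ∫ x, (u s x * deriv (fun τ => Φ (τ, x)) s +
        ((ω x)⁻¹ : ℂ) * (((A s x)ᴴ *ᵥ (G s x).ofLp) ⬝ᵥ grad (fun y => Φ (s, y)) x)) ∂(wMeasure ω)
      = ∫ s, ∫ x, φ s * ψ x * Φ (s, x) ∂(wMeasure ω)

/-- `(Γ(t,s))` is a fundamental solution for `ℋ = ∂ₜ - ω⁻¹ divₓ(A ∇ₓ)`. The inner product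
`⟨a, b⟩_{2,ω} = ∫ a b̄ dω` is `inner ℂ b a`. -/
structure IsFundSol (ω : Rn n → ℝ) (A : ℝ → Rn n → Matrix (Fin n) (Fin n) ℂ)
    (Γ : ℝ → ℝ → L2w ω →L[ℂ] L2w ω) : Prop where
  bounded : ∃ K : ℝ, ∀ t s, ‖Γ t s‖ ≤ K
  causal : ∀ t s, t < s → Γ t s = 0
  measurable : ∀ ψ ∈ testL2w ω, ∀ χ ∈ testL2w ω,
    Measurable fun p : ℝ × ℝ => inner ℂ χ (Γ p.1 p.2 ψ)
  represents : ∀ φ : ℝ → ℂ, IsTest φ → ∀ ψ ∈ testL2w ω, ∀ u G, IsEnergyClass ω u G →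
    SolvesForward ω A φ ψ u G → ∀ χ ∈ testL2w ω,
      ∀ᵐ t, inner ℂ χ (u t) = ∫ s in Set.Iic t, φ s * inner ℂ χ (Γ t s ψ)

/-- `(Γ'(s,t))` is a fundamental solution for the backward operator
`ℋ⋆ = -∂ₛ - ω⁻¹ divₓ(A⋆ ∇ₓ)`. -/
structure IsBackwardFundSol (ω : Rn n → ℝ) (A : ℝ → Rn n → Matrix (Fin n) (Fin n) ℂ)
    (Γ' : ℝ → ℝ → L2w ω →L[ℂ] L2w ω) : Prop where
  bounded : ∃ K : ℝ, ∀ s t, ‖Γ' s t‖ ≤ K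
  causal : ∀ s t, t < s → Γ' s t = 0
  measurable : ∀ ψ ∈ testL2w ω, ∀ χ ∈ testL2w ω,
    Measurable fun p : ℝ × ℝ => inner ℂ χ (Γ' p.1 p.2 ψ)
  represents : ∀ φ : ℝ → ℂ, IsTest φ → ∀ ψ ∈ testL2w ω, ∀ u G, IsEnergyClass ω u G →
    SolvesBackward ω A φ ψ u G → ∀ χ ∈ testL2w ω,
      ∀ᵐ s, inner ℂ χ (u s) = ∫ t in Set.Ici s, φ t * inner ℂ χ (Γ' s t ψ)

/-- The properties defining a fundamental solution do not see a modification of `Γ(t,s)` on a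
null set of pairs `(t,s)`. The representative which is separately weakly continuous on `t > s` is
the one that makes `Γ(t,s)` meaningful for every `t > s`. -/
def IsContVersion (ω : Rn n → ℝ) (Γ : ℝ → ℝ → L2w ω →L[ℂ] L2w ω) : Prop :=
  ∀ ψ ∈ testL2w ω, ∀ χ ∈ testL2w ω,
    (∀ s, ContinuousOn (fun t => inner ℂ χ (Γ t s ψ)) (Set.Ioi s)) ∧
    (∀ t, ContinuousOn (fun s => inner ℂ χ (Γ t s ψ)) (Set.Iio t))

/-- The Euclidean distance between two sets; its value for an empty set is irrelevant below. -/
def setDist (E F : Set (Rn n)) : ℝ := sInf {r | ∃ x ∈ E, ∃ y ∈ F, r = dist x y}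

/-- `‖f‖_{L²_ω(K)}`. -/
def normOn (ω : Rn n → ℝ) (K : Set (Rn n)) (f : L2w ω) : ℝ :=
  Real.sqrt (∫ x in K, ‖f x‖ ^ 2 ∂(wMeasure ω))

/-- `‖T f‖_{L²_ω(F)} ≤ C exp(-c dist(E,F)² / τ) ‖f‖_{L²_ω(E)}` for all (Lebesgue) measurable sets
`E`, `F` and all `f ∈ L²_ω(ℝⁿ)` supported in `E`. -/
def OffDiagonalBound (ω : Rn n → ℝ) (c C τ : ℝ) (T : L2w ω →L[ℂ] L2w ω) : Prop :=
  ∀ E F : Set (Rn n), NullMeasurableSet E volume → NullMeasurableSet F volume →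
    ∀ f : L2w ω, (∀ᵐ x ∂(wMeasure ω), x ∉ E → f x = 0) →
      normOn ω F (T f) ≤ C * Real.exp (-c * (setDist E F ^ 2 / τ)) * normOn ω E f

end DegParabolic

end

/-! The argument is Davies' exponential perturbation method. Let `h` be bounded and smooth with
`|∇h| ≤ ρ`. Testing the equation for `u` against `e^{2h}u` produces `Re ⟨ω⁻¹A∇u, e^{2h}(∇u +
2u∇h)⟩`. Pointwise this is at least `e^{2h}(ν|∇u|² - 2Mρ|u||∇u|)`, and completing the square gives
the lower bound `-κρ²|e^h u|²` with `κ = M²/ν` (`re_inner_weighted_ge`, `isWeight_exp`). Hence `‖e^h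
u‖` grows at rate at most `κρ²` in the absence of a source, which suggests `|⟨Γ(t,s)ψ, χ⟩| ≤
e^{κρ²(t-s)} ‖e^hψ‖ ‖e^{-h}χ‖` (`DaviesBound`). If `h` is close to `ρ` times the distance to `E`,
truncated, this is a factor `e^{κρ²(t-s) - ρd}` between `E` and `F`. The choice `ρ = d/(2κ(t-s))`
yields `c = 1/(4κ)` and `C = 1`.

The definition of a fundamental solution says nothing about the existence of energy solutions; it
only represents those that exist. One solution with all weighted bounds is therefore constructed for
each source `φ ⊗ ψ`, and no uniqueness is needed. The construction takes place for an abstract form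
`⟨Dw, B(t)Dv⟩`. An implicit Euler equation with step `τ` and damping `ε = τ` is solved on `L²(ℝ; V)`
by Lax–Milgram (`IsEvolution.exists_discrete`). Its weighted one-step estimate is iterated
(`SolvesDiscrete.bound`), and a weak limit as `τ → 0` is taken (`IsEvolution.exists_solution`).

Letting `φ` tend to the indicator of `(a,b)` bounds the integral of the kernel `⟨Γ(t,s)ψ, χ⟩` over
`s ∈ (a,b)`, and Lebesgue differentiation makes this pointwise for almost every `s`
(`IsFundSol.ae_ae_daviesBound`). Countable families of weights and of test functions give a single
null set for all `E`, `F`, `f`; separate continuity removes it for the continuous version. The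
backward operator reduces to the forward one by `t ↦ -t` and `A ↦ A⋆`. The `A₂` condition serves
only to make `ω` and `ω⁻¹` locally integrable. -/

noncomputable section

set_option linter.unusedSectionVars false

namespace DegParabolic

open Filter Topology

/-! ### Strong measurability from weak measurability. -/

section Pettis

variable {α : Type*} [MeasurableSpace α] {μ : Measure α}
  {F : Type*} [NormedAddCommGroup F] [InnerProductSpace ℂ F]

/-- Pettis' theorem for separable Hilbert spaces. -/
theorem aestronglyMeasurable_of_inner [TopologicalSpace.SeparableSpace F] {f : α → F}
    (h : ∀ v : F, AEStronglyMeasurable (fun a => inner ℂ v (f a)) μ) :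
    AEStronglyMeasurable f μ := by
  -- Projections onto the spans of initial segments of a dense sequence are finite sums of
  -- measurable coordinates and converge pointwise to the identity.
  let d := TopologicalSpace.denseSeq F
  let K : ℕ → Submodule ℂ F := fun n => Submodule.span ℂ (d '' Set.Iio n)
  have hfin : ∀ n, FiniteDimensional ℂ (K n) := fun n =>
    FiniteDimensional.span_of_finite ℂ ((Set.finite_Iio n).image d)
  have hmono : Monotone K := fun m n hmn =>
    Submodule.span_mono (Set.image_mono (Set.Iio_subset_Iio hmn))
  have htop : ⊤ ≤ (⨆ n, K n).topologicalClosure := by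
    intro x _
    have hx : x ∈ closure (Set.range d) := TopologicalSpace.denseRange_denseSeq F x
    refine closure_mono ?_ hx
    rintro _ ⟨n, rfl⟩
    exact Submodule.mem_iSup_of_mem (n + 1)
      (Submodule.subset_span ⟨n, Nat.lt_succ_self n, rfl⟩)
  refine aestronglyMeasurable_of_tendsto_ae atTop
    (f := fun n a => (K n).starProjection (f a)) (fun n => ?_)
    (Eventually.of_forall fun a => Submodule.starProjection_tendsto_self K hmono (f a) htop)
  have : (fun a => (K n).starProjection (f a)) = fun a =>
      ∑ i, inner ℂ ((stdOrthonormalBasis ℂ (K n) i : F)) (f a) •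
        (stdOrthonormalBasis ℂ (K n) i : F) := by
    funext a
    rw [(stdOrthonormalBasis ℂ (K n)).starProjection_eq_sum_rankOne]
    simp
  rw [this]
  refine Finset.aestronglyMeasurable_fun_sum _ fun i _ => ?_
  exact (h _).smul_const _

end Pettis

/-! ### Pointwise application of operator-valued functions on `L²`. -/

section Multiplier

variable {α : Type*} [MeasurableSpace α] {μ : Measure α}
  {F : Type*} [NormedAddCommGroup F] [InnerProductSpace ℂ F]
  {F' : Type*} [NormedAddCommGroup F'] [InnerProductSpace ℂ F']

/-- A bounded operator-valued function which acts on measurable functions. -/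
structure IsMultiplier (μ : Measure α) (T : α → F →L[ℂ] F') (C : ℝ) : Prop where
  meas : ∀ Y : α → F, AEStronglyMeasurable Y μ → AEStronglyMeasurable (fun a => T a (Y a)) μ
  bound : ∀ a, ‖T a‖ ≤ C

theorem IsMultiplier.memLp {T : α → F →L[ℂ] F'} {C : ℝ} (h : IsMultiplier μ T C)
    {Y : α → F} (hY : MemLp Y 2 μ) : MemLp (fun a => T a (Y a)) 2 μ :=
  hY.of_le_mul (h.meas Y hY.1) (Eventually.of_forall fun a => (T a).le_of_opNorm_le (h.bound a) _)

/-- The operator of pointwise application of a multiplier on `L²`. -/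
def opLp {T : α → F →L[ℂ] F'} {C : ℝ} (h : IsMultiplier μ T C) : Lp F 2 μ →L[ℂ] Lp F' 2 μ :=
  LinearMap.mkContinuous
    { toFun := fun Y => (h.memLp (Lp.memLp Y)).toLp _
      map_add' := fun Y Z => by
        rw [← MemLp.toLp_add]
        refine MemLp.toLp_congr _ _ ?_
        filter_upwards [Lp.coeFn_add Y Z] with a ha
        simp only [ha, Pi.add_apply, map_add]
      map_smul' := fun c Y => by
        rw [RingHom.id_apply, ← MemLp.toLp_const_smul]
        refine MemLp.toLp_congr _ _ ?_
        filter_upwards [Lp.coeFn_smul c Y] with a ha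
        simp only [ha, Pi.smul_apply, map_smul] } C (fun Y => by
      refine Lp.norm_le_mul_norm_of_ae_le_mul ?_
      filter_upwards [(h.memLp (Lp.memLp Y)).coeFn_toLp] with a ha
      simp only [LinearMap.coe_mk, AddHom.coe_mk, ha]
      exact (T a).le_of_opNorm_le (h.bound a) _)

theorem coeFn_opLp {T : α → F →L[ℂ] F'} {C : ℝ} (h : IsMultiplier μ T C) (Y : Lp F 2 μ) :
    opLp h Y =ᵐ[μ] fun a => T a (Y a) :=
  (h.memLp (Lp.memLp Y)).coeFn_toLp

theorem norm_opLp_apply_le {T : α → F →L[ℂ] F'} {C : ℝ} (h : IsMultiplier μ T C) (Y : Lp F 2 μ) :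
    ‖opLp h Y‖ ≤ C * ‖Y‖ := by
  refine Lp.norm_le_mul_norm_of_ae_le_mul ?_
  filter_upwards [coeFn_opLp h Y] with a ha
  rw [ha]
  exact (T a).le_of_opNorm_le (h.bound a) _

theorem isMultiplier_smul {m : α → ℝ} (hm : AEStronglyMeasurable m μ) {C : ℝ}
    (hC : ∀ a, |m a| ≤ C) :
    IsMultiplier μ (fun a => ((m a : ℂ) • ContinuousLinearMap.id ℂ F)) C := by
  refine ⟨fun Y hY => ?_, fun a => ?_⟩
  · exact (Complex.continuous_ofReal.comp_aestronglyMeasurable hm).smul hY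
  · calc ‖(m a : ℂ) • ContinuousLinearMap.id ℂ F‖ = ‖(m a : ℂ)‖ * ‖ContinuousLinearMap.id ℂ F‖ :=
          norm_smul _ _
      _ ≤ ‖(m a : ℂ)‖ * 1 := by
          gcongr; exact ContinuousLinearMap.norm_id_le
      _ ≤ C := by simpa using hC a

/-- Weak measurability of an operator-valued function suffices on separable spaces. -/
theorem isMultiplier_of_inner [CompleteSpace F] [CompleteSpace F']
    [TopologicalSpace.SeparableSpace F]
    [TopologicalSpace.SeparableSpace F'] {T : α → F →L[ℂ] F'} {C : ℝ}
    (hT : ∀ v w, AEStronglyMeasurable (fun a => inner ℂ v (T a w)) μ) (hC : ∀ a, ‖T a‖ ≤ C) :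
    IsMultiplier μ T C := by
  refine ⟨fun Y hY => aestronglyMeasurable_of_inner fun v => ?_, hC⟩
  -- Passing to the adjoint separates the two dependences on `a`: the pairing becomes an inner
  -- product of two strongly measurable functions.
  have h1 : AEStronglyMeasurable (fun a => (ContinuousLinearMap.adjoint (T a)) v) μ := by
    refine aestronglyMeasurable_of_inner fun w => ?_
    have := Complex.continuous_conj.comp_aestronglyMeasurable (hT v w)
    refine this.congr (Eventually.of_forall fun a => ?_)
    simp [ContinuousLinearMap.adjoint_inner_right]
  have h2 := h1.inner (𝕜 := ℂ) hY
  refine h2.congr (Eventually.of_forall fun a => ?_)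
  simp [ContinuousLinearMap.adjoint_inner_left]

end Multiplier

/-! ### Weak compactness in Hilbert space. -/

section WeakLimit

/-- Bounded sequences in a Hilbert space have weak limits along ultrafilters. -/
theorem exists_weak_ultralimit {ι : Type*} (𝒰 : Ultrafilter ι) {X : Type*} [NormedAddCommGroup X]
    [InnerProductSpace ℂ X] [CompleteSpace X] (x : ι → X) {C : ℝ} (hx : ∀ i, ‖x i‖ ≤ C) :
    ∃ z : X, ∀ y : X, Tendsto (fun i => inner ℂ y (x i)) 𝒰 (𝓝 (inner ℂ y z)) := by
  have hC : 0 ≤ C := by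
    obtain ⟨i, -⟩ := 𝒰.neBot.nonempty_of_mem univ_mem
    exact (norm_nonneg _).trans (hx i)
  -- The sequence sits in the antilinear slot, so that the limit is linear in `y` and the Riesz
  -- theorem applies.
  have hex : ∀ y : X, ∃ l : ℂ, ‖l‖ ≤ C * ‖y‖ ∧
      Tendsto (fun i => inner ℂ (x i) y) 𝒰 (𝓝 l) := fun y => by
    have hmem : ∀ i, inner ℂ (x i) y ∈ Metric.closedBall (0 : ℂ) (C * ‖y‖) := fun i => by
      rw [mem_closedBall_zero_iff]
      exact (norm_inner_le_norm _ _).trans (by gcongr; exact hx i)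
    obtain ⟨l, hl, hlim⟩ := (isCompact_closedBall (0 : ℂ) (C * ‖y‖)).ultrafilter_le_nhds
      (𝒰.map fun i => inner ℂ (x i) y)
      (by rw [le_principal_iff]; exact mem_map.2 (univ_mem' hmem))
    exact ⟨l, by simpa using hl, hlim⟩
  choose l hl hlim using hex
  let ℓ : X →L[ℂ] ℂ := LinearMap.mkContinuous
    { toFun := l
      map_add' := fun y z => tendsto_nhds_unique (hlim (y + z)) (by
        simpa only [inner_add_right] using (hlim y).add (hlim z))
      map_smul' := fun c y => tendsto_nhds_unique (hlim (c • y)) (by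
        simpa only [inner_smul_right, smul_eq_mul, RingHom.id_apply] using
          (hlim y).const_mul c) } C hl
  refine ⟨(InnerProductSpace.toDual ℂ X).symm ℓ, fun y => ?_⟩
  have h1 := (Complex.continuous_conj.tendsto _).comp (hlim y)
  have h2 : inner ℂ y ((InnerProductSpace.toDual ℂ X).symm ℓ) = (starRingEnd ℂ) (l y) := by
    rw [← inner_conj_symm, InnerProductSpace.toDual_symm_apply]
    rfl
  rw [h2]
  refine h1.congr fun i => ?_
  simp

end WeakLimit

/-! ### Pointwise bounds from bounds on averages. -/

section LebesgueDifferentiation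

/-- A bound on the averages of `p` over intervals `[s, b]` gives a pointwise bound. -/
theorem ae_norm_le_of_norm_integral_le {p : ℝ → ℂ} (hp : LocallyIntegrable p volume)
    {O : Set ℝ} (hO : IsOpen O) {g : ℝ → ℝ → ℝ}
    (hg : ∀ s ∈ O, ContinuousAt (fun b => g s b) s)
    (h : ∀ s b, s < b → Set.Icc s b ⊆ O → ‖∫ τ in s..b, p τ‖ ≤ (b - s) * g s b) :
    ∀ᵐ s, s ∈ O → ‖p s‖ ≤ g s s := by
  filter_upwards [LocallyIntegrable.ae_hasDerivAt_integral hp] with s hs hsO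
  have h1 := (hs s).hasDerivWithinAt (s := Set.Ioi s)
  rw [hasDerivWithinAt_iff_tendsto_slope' (by simp)] at h1
  have h2 : Tendsto (fun b => g s b) (𝓝[>] s) (𝓝 (g s s)) :=
    (hg s hsO).mono_left nhdsWithin_le_nhds
  refine le_of_tendsto_of_tendsto h1.norm h2 ?_
  obtain ⟨ε, hε, hball⟩ := Metric.isOpen_iff.1 hO s hsO
  have h3 : Set.Ioo s (s + ε) ∈ 𝓝[>] s := Ioo_mem_nhdsGT (by linarith)
  filter_upwards [h3] with b hb
  have hsb : 0 < b - s := by linarith [hb.1]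
  have h4 := h s b hb.1 (fun x hx => hball (by
    rw [Metric.mem_ball, Real.dist_eq, abs_of_nonneg (by linarith [hx.1])]
    linarith [hx.2, hb.2]))
  simp only [slope, vsub_eq_sub, intervalIntegral.integral_same, sub_zero]
  rw [norm_smul, norm_inv, Real.norm_of_nonneg hsb.le, inv_mul_le_iff₀ hsb]
  exact h4

end LebesgueDifferentiation

/-! ### Implicit Euler scheme for an abstract parabolic equation, with weighted estimates. -/

section Evolution

variable {V H 𝒢 : Type*}
  [NormedAddCommGroup V] [InnerProductSpace ℂ V] [CompleteSpace V]
  [NormedAddCommGroup H] [InnerProductSpace ℂ H] [CompleteSpace H]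
  [NormedAddCommGroup 𝒢] [InnerProductSpace ℂ 𝒢] [CompleteSpace 𝒢]

/-- A bounded measurable family of elliptic forms `⟨D w, B(t) D v⟩` on `V`, where the norm of `V`
is the graph norm of `D`. -/
structure IsEvolution (J : V →L[ℂ] H) (D : V →L[ℂ] 𝒢) (B : ℝ → 𝒢 →L[ℂ] 𝒢) (C ν : ℝ) : Prop where
  norm_sq : ∀ v, ‖v‖ ^ 2 = ‖J v‖ ^ 2 + ‖D v‖ ^ 2
  mult : IsMultiplier volume B C
  pos : 0 < ν
  lower : ∀ t g, ν * ‖g‖ ^ 2 ≤ (inner ℂ g (B t g)).re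

/-- An exponential weight: `E` is multiplication by `e^h` on `H` and `P` multiplication by
`e^{2h}` on `V`. -/
structure IsWeight (J : V →L[ℂ] H) (D : V →L[ℂ] 𝒢) (B : ℝ → 𝒢 →L[ℂ] 𝒢)
    (E : H →L[ℂ] H) (P : V →L[ℂ] V) (lam : ℝ) : Prop where
  symm : ∀ v x, inner ℂ (J (P v)) x = inner ℂ (E (J v)) (E x)
  nonneg : 0 ≤ lam
  lower : ∀ t v, -(lam * ‖E (J v)‖ ^ 2) ≤ (inner ℂ (D (P v)) (B t (D v))).re

variable {J : V →L[ℂ] H} {D : V →L[ℂ] 𝒢} {B : ℝ → 𝒢 →L[ℂ] 𝒢} {C ν : ℝ}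

/-- The trivial weight has growth rate `0`. With it the weighted estimates specialise to the
contraction bounds used for causality and for the uniform bound. -/
theorem IsEvolution.isWeight_one (h : IsEvolution J D B C ν) :
    IsWeight J D B (ContinuousLinearMap.id ℂ H) (ContinuousLinearMap.id ℂ V) 0 :=
  ⟨fun _ _ => rfl, le_rfl, fun t v => by
    have := h.lower t (D v)
    have h2 := mul_nonneg h.pos.le (sq_nonneg ‖D v‖)
    simpa using h2.trans this⟩

theorem lp_norm_sq {α : Type*} [MeasurableSpace α] {μ : Measure α} (f : Lp H 2 μ) :
    ‖f‖ ^ 2 = ∫ a, ‖f a‖ ^ 2 ∂μ := by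
  have h1 : (inner ℂ f f) = ((‖f‖ ^ 2 : ℝ) : ℂ) := by
    rw [inner_self_eq_norm_sq_to_K]; norm_cast
  rw [L2.inner_def] at h1
  have h2 : (∫ a, inner ℂ (f a) (f a) ∂μ) = ((∫ a, ‖f a‖ ^ 2 ∂μ : ℝ) : ℂ) := by
    rw [← integral_complex_ofReal]
    refine integral_congr_ae (Eventually.of_forall fun a => ?_)
    simp only [inner_self_eq_norm_sq_to_K]; norm_cast
  rw [h2] at h1
  exact_mod_cast h1.symm

theorem integrable_norm_sq {α : Type*} [MeasurableSpace α] {μ : Measure α} (f : Lp H 2 μ) :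
    Integrable (fun a => ‖f a‖ ^ 2) μ :=
  (memLp_two_iff_integrable_sq_norm (Lp.memLp f).1).1 (Lp.memLp f)

/-- Translation by `τ` on `L²(ℝ; H)`. -/
def shiftLp (H : Type*) [NormedAddCommGroup H] [InnerProductSpace ℂ H] (τ : ℝ) :
    Lp H 2 (volume : Measure ℝ) →L[ℂ] Lp H 2 (volume : Measure ℝ) :=
  (Lp.compMeasurePreservingₗᵢ ℂ (fun t : ℝ => t - τ)
    (measurePreserving_sub_right volume τ)).toContinuousLinearMap

theorem coeFn_shiftLp (τ : ℝ) (Y : Lp H 2 (volume : Measure ℝ)) :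
    shiftLp H τ Y =ᵐ[volume] fun t => Y (t - τ) :=
  Lp.coeFn_compMeasurePreserving Y (measurePreserving_sub_right volume τ)

theorem norm_shiftLp (τ : ℝ) (Y : Lp H 2 (volume : Measure ℝ)) : ‖shiftLp H τ Y‖ = ‖Y‖ :=
  LinearIsometry.norm_map _ Y

theorem IsEvolution.lp_norm_sq_eq (h : IsEvolution J D B C ν) (W : Lp V 2 (volume : Measure ℝ)) :
    ‖W‖ ^ 2 = ‖J.compLpL 2 volume W‖ ^ 2 + ‖D.compLpL 2 volume W‖ ^ 2 := by
  rw [lp_norm_sq, lp_norm_sq, lp_norm_sq,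
    ← integral_add (integrable_norm_sq _) (integrable_norm_sq _)]
  refine integral_congr_ae ?_
  filter_upwards [J.coeFn_compLpL W, D.coeFn_compLpL W] with t h1 h2
  rw [h1, h2, h.norm_sq]

theorem IsEvolution.lp_lower (h : IsEvolution J D B C ν) (Y : Lp 𝒢 2 (volume : Measure ℝ)) :
    ν * ‖Y‖ ^ 2 ≤ (inner ℂ Y (opLp h.mult Y)).re := by
  rw [lp_norm_sq, L2.inner_def, ← integral_const_mul]
  have h1 := L2.integrable_inner (𝕜 := ℂ) Y (opLp h.mult Y)
  have h2 : (∫ a, inner ℂ (Y a) (opLp h.mult Y a)).re =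
      ∫ a, (inner ℂ (Y a) (opLp h.mult Y a)).re := (integral_re h1).symm
  rw [h2]
  refine integral_mono_ae ((integrable_norm_sq Y).const_mul ν) h1.re ?_
  filter_upwards [coeFn_opLp h.mult Y] with t ht
  simp only [ht]
  exact h.lower t (Y t)

/-- The time-discretised equation in weak form. -/
def SolvesDiscrete (h : IsEvolution J D B C ν) (τ ε : ℝ) (f : Lp H 2 (volume : Measure ℝ))
    (U : Lp V 2 (volume : Measure ℝ)) : Prop :=
  ∀ W : Lp V 2 (volume : Measure ℝ),
    inner ℂ (J.compLpL 2 volume W) (((τ⁻¹ : ℝ) : ℂ) • (J.compLpL 2 volume U -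
        shiftLp H τ (J.compLpL 2 volume U)) + (ε : ℂ) • J.compLpL 2 volume U - f) +
      inner ℂ (D.compLpL 2 volume W) (opLp h.mult (D.compLpL 2 volume U)) = 0

/-- Translation is an isometry, so Cauchy–Schwarz makes the backward difference accretive. This is
the discrete form of `Re ∫ ⟨u, u'⟩ = 0`. -/
theorem re_inner_sub_shift_nonneg (τ : ℝ) (Y : Lp H 2 (volume : Measure ℝ)) :
    0 ≤ (inner ℂ Y (Y - shiftLp H τ Y)).re := by
  rw [inner_sub_right, Complex.sub_re]
  have h1 : (inner ℂ Y Y).re = ‖Y‖ ^ 2 := inner_self_eq_norm_sq (𝕜 := ℂ) Y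
  have h2 : (inner ℂ Y (shiftLp H τ Y)).re ≤ ‖Y‖ * ‖shiftLp H τ Y‖ :=
    re_inner_le_norm (𝕜 := ℂ) _ _
  rw [norm_shiftLp] at h2
  rw [h1]
  nlinarith

/-- The difference quotient contributes nonnegatively; damping controls the `J` part and ellipticity
the `D` part. Together they control the full norm of `V`. -/
theorem IsEvolution.energy_lower (h : IsEvolution J D B C ν) {τ ε : ℝ} (hτ : 0 < τ)
    (U : Lp V 2 (volume : Measure ℝ)) :
    ε * ‖J.compLpL 2 volume U‖ ^ 2 + ν * ‖D.compLpL 2 volume U‖ ^ 2 ≤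
    (inner ℂ (J.compLpL 2 volume U) (((τ⁻¹ : ℝ) : ℂ) • (J.compLpL 2 volume U -
        shiftLp H τ (J.compLpL 2 volume U)) + (ε : ℂ) • J.compLpL 2 volume U) +
      inner ℂ (D.compLpL 2 volume U) (opLp h.mult (D.compLpL 2 volume U))).re := by
  have h1 := h.lp_lower (D.compLpL 2 volume U)
  have h2 := re_inner_sub_shift_nonneg τ (J.compLpL 2 volume U)
  have h3 : (inner ℂ (J.compLpL 2 volume U) (J.compLpL 2 volume U)).re =
    ‖J.compLpL 2 volume U‖ ^ 2 := inner_self_eq_norm_sq (𝕜 := ℂ) _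
  rw [Complex.add_re, inner_add_right, inner_smul_right, inner_smul_right, Complex.add_re,
    Complex.re_ofReal_mul, Complex.re_ofReal_mul, h3]
  have h4 : 0 ≤ τ⁻¹ * (inner ℂ (J.compLpL 2 volume U) (J.compLpL 2 volume U -
        shiftLp H τ (J.compLpL 2 volume U))).re := by positivity
  linarith

/-- Lax–Milgram on `L²(ℝ; V)`, for all times at once and without an initial condition. The
coercivity constant `min ε ν` is positive only because of the damping. -/
theorem IsEvolution.exists_discrete (h : IsEvolution J D B C ν) {τ ε : ℝ} (hτ : 0 < τ)
    (hε : 0 < ε) (f : Lp H 2 (volume : Measure ℝ)) : ∃ U, SolvesDiscrete h τ ε f U := by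
  let Jt := J.compLpL 2 (volume : Measure ℝ)
  let Dt := D.compLpL 2 (volume : Measure ℝ)
  let R : Lp H 2 (volume : Measure ℝ) →L[ℂ] Lp H 2 (volume : Measure ℝ) :=
    ((τ⁻¹ : ℝ) : ℂ) • (ContinuousLinearMap.id ℂ _ - shiftLp H τ) +
      (ε : ℂ) • ContinuousLinearMap.id ℂ _
  let T : Lp V 2 (volume : Measure ℝ) →L[ℂ] Lp V 2 (volume : Measure ℝ) :=
    (ContinuousLinearMap.adjoint Jt) ∘L R ∘L Jt +
      (ContinuousLinearMap.adjoint Dt) ∘L (opLp h.mult) ∘L Dt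
  have hT : ∀ W U, inner ℂ W (T U) = inner ℂ (Jt W) (R (Jt U)) +
      inner ℂ (Dt W) (opLp h.mult (Dt U)) := fun W U => by
    simp [T, inner_add_right, ContinuousLinearMap.adjoint_inner_right]
  have hunit : IsUnit T := by
    have hc : 0 < min ε ν := lt_min hε h.pos
    refine ContinuousLinearMap.isUnit_of_forall_le_norm_inner_map T
      (c := ⟨min ε ν, hc.le⟩) hc fun U => ?_
    rw [norm_inner_symm]
    refine le_trans ?_ (Complex.re_le_norm _)
    rw [hT]
    refine le_trans ?_ (h.energy_lower (ε := ε) hτ U)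
    rw [h.lp_norm_sq_eq]
    change _ * (min ε ν) ≤ _
    have e1 := mul_le_mul_of_nonneg_right (min_le_left ε ν)
      (sq_nonneg ‖J.compLpL 2 (volume : Measure ℝ) U‖)
    have e2 := mul_le_mul_of_nonneg_right (min_le_right ε ν)
      (sq_nonneg ‖D.compLpL 2 (volume : Measure ℝ) U‖)
    linarith
  obtain ⟨U, hU⟩ := (ContinuousLinearMap.isUnit_iff_bijective.1 hunit).2
    (ContinuousLinearMap.adjoint Jt f)
  refine ⟨U, fun W => ?_⟩
  have h1 := hT W U
  rw [hU, ContinuousLinearMap.adjoint_inner_right] at h1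
  rw [inner_sub_right]
  have h2 : R (Jt U) = ((τ⁻¹ : ℝ) : ℂ) • (J.compLpL 2 volume U -
        shiftLp H τ (J.compLpL 2 volume U)) + (ε : ℂ) • J.compLpL 2 volume U := by
    rfl
  rw [← h2]
  linear_combination -h1

/-- Localisation in time of a weak identity. -/
theorem ae_inner_add_inner_eq_zero {X : Lp H 2 (volume : Measure ℝ)}
    {Y : Lp 𝒢 2 (volume : Measure ℝ)}
    (h : ∀ W : Lp V 2 (volume : Measure ℝ),
      inner ℂ (J.compLpL 2 volume W) X + inner ℂ (D.compLpL 2 volume W) Y = 0)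
    (W : Lp V 2 (volume : Measure ℝ)) :
    ∀ᵐ t, inner ℂ (J (W t)) (X t) + inner ℂ (D (W t)) (Y t) = 0 := by
  have hJ := J.coeFn_compLpL W
  have hD := D.coeFn_compLpL W
  have hint : Integrable (fun t => inner ℂ (J (W t)) (X t) + inner ℂ (D (W t)) (Y t)) volume := by
    refine ((L2.integrable_inner (𝕜 := ℂ) (J.compLpL 2 volume W) X).add
      (L2.integrable_inner (𝕜 := ℂ) (D.compLpL 2 volume W) Y)).congr ?_
    filter_upwards [hJ, hD] with t h1 h2
    simp [h1, h2]
  refine hint.ae_eq_zero_of_forall_setIntegral_eq_zero fun S hS _ => ?_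
  -- `J` and `D` do not involve time, so `W` may be cut off by the indicator of `S`; the integral
  -- over every measurable `S` then vanishes.
  have hm : IsMultiplier (F := V) (volume : Measure ℝ)
      (fun a => (((S.indicator (fun _ => (1 : ℝ)) a : ℝ) : ℂ) • ContinuousLinearMap.id ℂ V)) 1 :=
    isMultiplier_smul (measurable_const.indicator hS).aestronglyMeasurable (fun a => by
      by_cases ha : a ∈ S <;> simp [ha])
  have h1 := h (opLp hm W)
  rw [L2.inner_def, L2.inner_def, ← integral_add (L2.integrable_inner _ _)
    (L2.integrable_inner _ _)] at h1
  rw [← integral_indicator hS, ← h1]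
  refine integral_congr_ae ?_
  filter_upwards [J.coeFn_compLpL (opLp hm W), D.coeFn_compLpL (opLp hm W), coeFn_opLp hm W]
    with t h2 h3 h4
  rw [h2, h3, h4]
  by_cases ha : t ∈ S <;> simp [ha]

variable {h : IsEvolution J D B C ν} {τ ε : ℝ} {f : Lp H 2 (volume : Measure ℝ)}
  {U : Lp V 2 (volume : Measure ℝ)}

/-- The weighted one-step estimate. -/
theorem SolvesDiscrete.step (hU : SolvesDiscrete h τ ε f U) (hτ : 0 < τ)
    {E : H →L[ℂ] H} {P : V →L[ℂ] V} {lam : ℝ} (hE : IsWeight J D B E P lam) :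
    ∀ᵐ t, (1 + τ * (ε - lam)) * ‖E (J (U t))‖ ≤ ‖E (J (U (t - τ)))‖ + τ * ‖E (f t)‖ := by
  have hq := (measurePreserving_sub_right (volume : Measure ℝ) τ).quasiMeasurePreserving
  -- Davies' step: the test function is `PU`, that is `e^{2h}U`. By `hE.symm` the time terms become
  -- inner products of weighted quantities, and `hE.lower` absorbs the form. One factor `‖E (J (U
  -- t))‖` is cancelled at the end.
  filter_upwards [ae_inner_add_inner_eq_zero hU (P.compLpL 2 volume U),
    P.coeFn_compLpL U, J.coeFn_compLpL U, D.coeFn_compLpL U,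
    hq.ae (J.coeFn_compLpL U), coeFn_shiftLp τ (J.compLpL 2 volume U),
    coeFn_opLp h.mult (D.compLpL 2 volume U),
    Lp.coeFn_sub (((τ⁻¹ : ℝ) : ℂ) • (J.compLpL 2 volume U -
        shiftLp H τ (J.compLpL 2 volume U)) + (ε : ℂ) • J.compLpL 2 volume U) f,
    Lp.coeFn_add (((τ⁻¹ : ℝ) : ℂ) • (J.compLpL 2 volume U -
        shiftLp H τ (J.compLpL 2 volume U))) ((ε : ℂ) • J.compLpL 2 volume U),
    Lp.coeFn_smul ((τ⁻¹ : ℝ) : ℂ) (J.compLpL 2 volume U - shiftLp H τ (J.compLpL 2 volume U)),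
    Lp.coeFn_smul (ε : ℂ) (J.compLpL 2 volume U),
    Lp.coeFn_sub (J.compLpL 2 volume U) (shiftLp H τ (J.compLpL 2 volume U))]
    with t h1 h2 h3 h4 h5 h6 h7 h8 h9 h10 h11 h12
  rw [h2, h8, Pi.sub_apply, h9, Pi.add_apply, h10, h11, Pi.smul_apply, Pi.smul_apply, h12,
    Pi.sub_apply, h6, h5, h3, h7, h4, hE.symm] at h1
  have hlow := hE.lower t (U t)
  have hre := congrArg Complex.re h1
  simp only [map_sub, map_add, map_smul, inner_sub_right, inner_add_right, inner_smul_right,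
    Complex.add_re, Complex.sub_re, Complex.re_ofReal_mul, Complex.zero_re] at hre
  have e1 : (inner ℂ (E (J (U t))) (E (J (U t)))).re = ‖E (J (U t))‖ ^ 2 :=
    inner_self_eq_norm_sq (𝕜 := ℂ) _
  have e2 : (inner ℂ (E (J (U t))) (E (J (U (t - τ))))).re ≤ _ :=
    re_inner_le_norm (𝕜 := ℂ) _ _
  have e3 : (inner ℂ (E (J (U t))) (E (f t))).re ≤ _ := re_inner_le_norm (𝕜 := ℂ) _ _
  rw [e1] at hre
  rcases eq_or_lt_of_le (norm_nonneg (E (J (U t)))) with h0 | h0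
  · rw [← h0]; simp; positivity
  · refine le_of_mul_le_mul_right ?_ h0
    have hre2 : ‖E (J (U t))‖ ^ 2 - (inner ℂ (E (J (U t))) (E (J (U (t - τ))))).re +
        τ * (ε * ‖E (J (U t))‖ ^ 2) - τ * (inner ℂ (E (J (U t))) (E (f t))).re +
        τ * (inner ℂ (D (P (U t))) ((B t) (D (U t)))).re = 0 := by
      have := congrArg (fun x => τ * x) hre
      simp only [mul_zero] at this
      rw [← this]
      field_simp
    have e4 := mul_le_mul_of_nonneg_left hlow hτ.le
    have e5 := mul_le_mul_of_nonneg_left e3 hτ.le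
    nlinarith

/-- Without a source, one step gains the factor `1 + τε`. Integrating squares over `(-∞, a)`, the
shifted integral is no larger than the original one, so the strict gain forces both to vanish. -/
theorem SolvesDiscrete.vanish (hU : SolvesDiscrete h τ ε f U) (hτ : 0 < τ) (hε : 0 < ε) {a : ℝ}
    (hf : ∀ᵐ t, t < a → f t = 0) : ∀ᵐ t, t < a → J (U t) = 0 := by
  have h1 := hU.step hτ h.isWeight_one
  have hint : Integrable (fun t => ‖J (U t)‖ ^ 2) volume := by
    refine (integrable_norm_sq (J.compLpL 2 volume U)).congr ?_
    filter_upwards [J.coeFn_compLpL U] with t ht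
    rw [ht]
  have hint2 : Integrable (fun t => ‖J (U (t - τ))‖ ^ 2) volume := hint.comp_sub_right τ
  have h2 : ∫ t in Set.Iio a, (1 + τ * ε) * ‖J (U t)‖ ^ 2 ≤
      ∫ t in Set.Iio a, ‖J (U (t - τ))‖ ^ 2 := by
    refine integral_mono_ae (hint.integrableOn.const_mul _) hint2.integrableOn ?_
    refine (ae_restrict_iff' measurableSet_Iio).2 ?_
    filter_upwards [h1, hf] with t ht hft hta
    have h3 : (1 + τ * ε) * ‖J (U t)‖ ≤ ‖J (U (t - τ))‖ := by simpa [hft hta] using ht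
    have h4 : 0 ≤ τ * ε := by positivity
    have h5 : ‖J (U t)‖ ≤ ‖J (U (t - τ))‖ :=
      le_trans (by nlinarith [norm_nonneg (J (U t))]) h3
    calc (1 + τ * ε) * ‖J (U t)‖ ^ 2 = ((1 + τ * ε) * ‖J (U t)‖) * ‖J (U t)‖ := by ring
      _ ≤ ‖J (U (t - τ))‖ * ‖J (U (t - τ))‖ := by gcongr
      _ = _ := by ring
  have h3 : ∫ t in Set.Iio a, ‖J (U (t - τ))‖ ^ 2 ≤ ∫ t in Set.Iio a, ‖J (U t)‖ ^ 2 := by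
    rw [← integral_indicator measurableSet_Iio, ← integral_indicator measurableSet_Iio,
      ← integral_add_right_eq_self _ τ]
    refine integral_mono ?_ (hint.indicator measurableSet_Iio) fun t => ?_
    · exact (hint2.indicator (measurableSet_Iio (a := a))).comp_add_right τ
    · by_cases hta : t + τ < a
      · have : t < a := by linarith
        simp [hta, this]
      · simp only [Set.indicator, Set.mem_Iio, hta, if_false]
        positivity
  rw [integral_const_mul] at h2
  have h4 : ∫ t in Set.Iio a, ‖J (U t)‖ ^ 2 = 0 := by
    have : 0 ≤ ∫ t in Set.Iio a, ‖J (U t)‖ ^ 2 := integral_nonneg fun t => by positivity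
    have h5 : 0 < τ * ε := by positivity
    nlinarith
  rw [integral_eq_zero_iff_of_nonneg (fun t => by positivity) hint.integrableOn] at h4
  filter_upwards [(ae_restrict_iff' measurableSet_Iio).1 h4] with t ht hta
  simpa using ht hta

/-- The weighted bound obtained by iterating the one-step estimate. -/
theorem SolvesDiscrete.bound (hU : SolvesDiscrete h τ ε f U) (hτ : 0 < τ) (hε : 0 < ε)
    {E : H →L[ℂ] H} {P : V →L[ℂ] V} {lam : ℝ} (hE : IsWeight J D B E P lam)
    (hlam : τ * lam < 1) {φ : ℝ → ℂ} {ψ : H} {a b m : ℝ} (hf : ∀ᵐ t, f t = φ t • ψ)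
    (hφ : ∀ t, ‖φ t‖ ≤ m) (hsupp : ∀ t, t ∉ Set.Icc a b → φ t = 0) :
    ∀ᵐ t, ∀ N : ℕ, t < a + N * τ → ‖E (J (U t))‖ ≤
      ((1 - τ * lam)⁻¹) ^ N * (m * ‖E ψ‖) * max (min t b - a + τ) 0 := by
  have hm : 0 ≤ m := (norm_nonneg _).trans (hφ 0)
  have hq0 : 0 < 1 - τ * lam := by linarith
  have hq : 1 ≤ (1 - τ * lam)⁻¹ := by
    rw [one_le_inv₀ hq0]
    nlinarith [mul_nonneg hτ.le hE.nonneg]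
  have h1 : ∀ᵐ t, (t < a → J (U t) = 0) ∧
      ‖E (J (U t))‖ ≤ (1 - τ * lam)⁻¹ *
        (‖E (J (U (t - τ)))‖ + τ * (‖φ t‖ * ‖E ψ‖)) := by
    filter_upwards [hU.step hτ hE, hf, hU.vanish hτ hε (a := a) (by
      filter_upwards [hf] with t ht hta
      rw [ht, hsupp t (fun hmem => not_lt.2 hmem.1 hta), zero_smul])] with t h1 h2 h3
    refine ⟨h3, ?_⟩
    rw [h2, map_smul, norm_smul] at h1
    rw [← div_eq_inv_mul, le_div_iff₀ hq0, mul_comm]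
    refine le_trans ?_ h1
    refine mul_le_mul_of_nonneg_right ?_ (norm_nonneg _)
    nlinarith [mul_pos hτ hε]
  -- The one-step estimate holds off a null set; translating that set by the countably many `kτ`
  -- makes it available along the whole backward orbit of `t`.
  have h2 : ∀ᵐ t, ∀ k : ℕ, (t - k * τ < a → J (U (t - k * τ)) = 0) ∧
      ‖E (J (U (t - k * τ)))‖ ≤ (1 - τ * lam)⁻¹ *
        (‖E (J (U (t - k * τ - τ)))‖ + τ * (‖φ (t - k * τ)‖ * ‖E ψ‖)) := by
    rw [ae_all_iff]
    intro k
    exact (measurePreserving_sub_right (volume : Measure ℝ) (k * τ)).quasiMeasurePreserving.ae h1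
  filter_upwards [h2] with t ht N
  have key : ∀ N k : ℕ, t - k * τ < a + N * τ → ‖E (J (U (t - k * τ)))‖ ≤
      ((1 - τ * lam)⁻¹) ^ N * (m * ‖E ψ‖) * max (min (t - k * τ) b - a + τ) 0 := by
    intro N
    induction N with
    | zero =>
      intro k hk
      rw [(ht k).1 (by simpa using hk)]
      simp only [map_zero, norm_zero]
      positivity
    | succ N ih =>
      intro k hk
      by_cases hka : t - k * τ < a
      · rw [(ht k).1 hka]
        simp only [map_zero, norm_zero]
        positivity
      push Not at hka
      have h3 := ih (k + 1) (by push_cast at hk ⊢; linarith)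
      have e1 : t - ((k + 1 : ℕ) : ℝ) * τ = t - k * τ - τ := by push_cast; ring
      rw [e1] at h3
      refine (ht k).2.trans ?_
      set s := t - k * τ with hs
      set q := (1 - τ * lam)⁻¹ with hqdef
      have hqN : 1 ≤ q ^ N := one_le_pow₀ hq
      have hK : 0 ≤ m * ‖E ψ‖ := by positivity
      rw [pow_succ, mul_comm (q ^ N) q, mul_assoc, mul_assoc]
      refine mul_le_mul_of_nonneg_left ?_ (by linarith)
      -- The last factor counts the accumulated source: it grows by `τ` per step while `s ≤ b`, and
      -- beyond `b` no growth is needed since `φ` vanishes.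
      by_cases hsb : s ≤ b
      · have e2 : min (s - τ) b - a + τ = s - a := by
          rw [min_eq_left (by linarith)]; ring
        rw [e2, max_eq_left (by linarith)] at h3
        rw [min_eq_left hsb, max_eq_left (by linarith)]
        have e3 : τ * (‖φ s‖ * ‖E ψ‖) ≤ q ^ N * (τ * (m * ‖E ψ‖)) := by
          calc τ * (‖φ s‖ * ‖E ψ‖) ≤ 1 * (τ * (m * ‖E ψ‖)) := by
                rw [one_mul]; gcongr; exact hφ s
            _ ≤ _ := by gcongr
        calc _ ≤ q ^ N * (m * ‖E ψ‖) * (s - a) + q ^ N * (τ * (m * ‖E ψ‖)) := add_le_add h3 e3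
          _ = _ := by ring
      · rw [hsupp s (fun hmem => hsb hmem.2)]
        simp only [norm_zero, zero_mul, mul_zero, add_zero]
        rw [mul_assoc] at h3
        refine h3.trans ?_
        gcongr
        linarith
  have := key N 0
  simpa using this

end Evolution

/-! ### Estimates uniform in the time step, and consistency of the scheme. -/

section EvolutionLimit

variable {V H 𝒢 : Type*}
  [NormedAddCommGroup V] [InnerProductSpace ℂ V] [CompleteSpace V]
  [NormedAddCommGroup H] [InnerProductSpace ℂ H] [CompleteSpace H]
  [NormedAddCommGroup 𝒢] [InnerProductSpace ℂ 𝒢] [CompleteSpace 𝒢]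

/-- Compactly supported test functions in time with values in `V`, with a first order Taylor
estimate in `H`. -/
structure IsTimeTest (J : V →L[ℂ] H) (W : ℝ → V) (w' : ℝ → H) (R K : ℝ) : Prop where
  meas : AEStronglyMeasurable W volume
  meas_deriv : AEStronglyMeasurable w' volume
  bound : ∀ t, ‖W t‖ ≤ K
  bound_deriv : ∀ t, ‖w' t‖ ≤ K
  supp : ∀ t, t ∉ Set.Icc (-R) R → W t = 0
  supp_deriv : ∀ t, t ∉ Set.Icc (-R) R → w' t = 0
  taylor : ∀ t τ, 0 < τ → τ ≤ 1 → ‖J (W (t + τ)) - J (W t) - (τ : ℂ) • w' t‖ ≤ K * τ ^ 2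

theorem memLp_of_bound_of_supp {F : Type*} [NormedAddCommGroup F] {v : ℝ → F}
    (hv : AEStronglyMeasurable v volume) {R K : ℝ} (hK : ∀ t, ‖v t‖ ≤ K)
    (hR : ∀ t, t ∉ Set.Icc (-R) R → v t = 0) : MemLp v 2 volume := by
  have h1 : MemLp ((Set.Icc (-R) R).indicator v) 2 volume := by
    rw [memLp_indicator_iff_restrict measurableSet_Icc]
    exact memLp_of_bounded (a := 0) (b := K)
      (f := fun t => ‖v t‖) (Eventually.of_forall fun t => ⟨norm_nonneg _, hK t⟩)
      hv.norm.restrict 2 |>.of_le hv.restrict (Eventually.of_forall fun t => by simp)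
  rwa [Set.indicator_eq_self.2 (fun t ht => by
    by_contra h; exact ht (hR t h))] at h1

variable {J : V →L[ℂ] H} {D : V →L[ℂ] 𝒢} {B : ℝ → 𝒢 →L[ℂ] 𝒢} {C ν : ℝ}
  {h : IsEvolution J D B C ν} {τ ε : ℝ} {f : Lp H 2 (volume : Measure ℝ)}
  {U : Lp V 2 (volume : Measure ℝ)} {φ : ℝ → ℂ} {ψ : H} {a b m : ℝ}

/-- For the trivial weight the factor raised to the number of steps is `1`, so the bound does not
degenerate as `τ → 0`. -/
theorem SolvesDiscrete.sup_bound (hU : SolvesDiscrete h τ ε f U) (hτ : 0 < τ) (hτ1 : τ ≤ 1)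
    (hε : 0 < ε) (hab : a ≤ b) (hf : ∀ᵐ t, f t = φ t • ψ)
    (hφ : ∀ t, ‖φ t‖ ≤ m) (hsupp : ∀ t, t ∉ Set.Icc a b → φ t = 0) :
    ∀ᵐ t, ‖J (U t)‖ ≤ m * ‖ψ‖ * (b - a + 1) := by
  have hm : 0 ≤ m := (norm_nonneg _).trans (hφ 0)
  filter_upwards [hU.bound hτ hε h.isWeight_one (by simp) hf hφ hsupp] with t ht
  obtain ⟨N, hN⟩ := exists_nat_gt ((t - a) / τ)
  have h1 := ht N (by rw [div_lt_iff₀ hτ] at hN; linarith)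
  simp only [mul_zero, sub_zero, inv_one, one_pow, one_mul, ContinuousLinearMap.id_apply] at h1
  refine h1.trans ?_
  gcongr
  refine max_le ?_ (by linarith)
  linarith [min_le_right t b]

/-- The equation is tested against `U` itself, and the source term is controlled by the uniform
bound on `J (U t)`. The resulting gradient bound depends on neither `τ` nor `ε`. -/
theorem SolvesDiscrete.energy_bound (hU : SolvesDiscrete h τ ε f U) (hτ : 0 < τ) (hε : 0 < ε)
    (hf : ∀ᵐ t, f t = φ t • ψ) (hφi : Integrable φ volume) {K : ℝ}
    (hK : ∀ᵐ t, ‖J (U t)‖ ≤ K) :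
    ν * ‖D.compLpL 2 volume U‖ ^ 2 ≤ ∫ t, K * (‖φ t‖ * ‖ψ‖) := by
  have h1 := h.energy_lower (ε := ε) hτ U
  have h2 := hU U
  rw [inner_sub_right] at h2
  have h3 : inner ℂ (J.compLpL 2 volume U) (((τ⁻¹ : ℝ) : ℂ) • (J.compLpL 2 volume U -
        shiftLp H τ (J.compLpL 2 volume U)) + (ε : ℂ) • J.compLpL 2 volume U) +
      inner ℂ (D.compLpL 2 volume U) (opLp h.mult (D.compLpL 2 volume U)) =
      inner ℂ (J.compLpL 2 volume U) f := by linear_combination h2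
  rw [h3] at h1
  have h4 : ‖inner ℂ (J.compLpL 2 volume U) f‖ ≤ ∫ t, K * (‖φ t‖ * ‖ψ‖) := by
    rw [L2.inner_def]
    refine norm_integral_le_of_norm_le ((hφi.norm.mul_const _).const_mul _) ?_
    filter_upwards [hf, hK, J.coeFn_compLpL U] with t h5 h6 h7
    rw [h5, h7]
    refine (norm_inner_le_norm _ _).trans ?_
    rw [norm_smul]
    gcongr
  have h5 : 0 ≤ ε * ‖J.compLpL 2 volume U‖ ^ 2 := by positivity
  linarith [Complex.re_le_norm (inner ℂ (J.compLpL 2 volume U) f)]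

theorem inner_shiftLp (τ : ℝ) (X Y : Lp H 2 (volume : Measure ℝ)) :
    inner ℂ X (shiftLp H τ Y) = inner ℂ (shiftLp H (-τ) X) Y := by
  rw [L2.inner_def, L2.inner_def]
  have h1 : ∫ t, inner ℂ (X t) (shiftLp H τ Y t) = ∫ t, inner ℂ (X t) (Y (t - τ)) := by
    refine integral_congr_ae ?_
    filter_upwards [coeFn_shiftLp τ Y] with t ht
    rw [ht]
  have h2 : ∫ t, inner ℂ (shiftLp H (-τ) X t) (Y t) = ∫ t, inner ℂ (X (t + τ)) (Y t) := by
    refine integral_congr_ae ?_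
    filter_upwards [coeFn_shiftLp (-τ) X] with t ht
    rw [ht, sub_neg_eq_add]
  rw [h1, h2, ← integral_add_right_eq_self _ τ]
  simp

/-- Consistency of the time discretisation. -/
theorem SolvesDiscrete.consistency (hU : SolvesDiscrete h τ τ f U) (hτ : 0 < τ) (hτ1 : τ ≤ 1)
    {K₁ : ℝ} (hK : ∀ᵐ t, ‖J (U t)‖ ≤ K₁) {W : ℝ → V} {w' : ℝ → H} {R K : ℝ}
    (hW : IsTimeTest J W w' R K) (W₀ : Lp V 2 (volume : Measure ℝ)) (hW₀ : W₀ =ᵐ[volume] W) :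
    ‖-(∫ t, inner ℂ (w' t) (J (U t))) +
        inner ℂ (D.compLpL 2 volume W₀) (opLp h.mult (D.compLpL 2 volume U)) -
        inner ℂ (J.compLpL 2 volume W₀) f‖ ≤
      τ * (K₁ * (K + ‖J‖ * K) * (volume (Set.Icc (-(R + 1)) (R + 1))).toReal) := by
  have hK0 : 0 ≤ K := (norm_nonneg _).trans (hW.bound 0)
  obtain ⟨t₀, ht₀⟩ := hK.exists
  have hK10 : 0 ≤ K₁ := (norm_nonneg _).trans ht₀
  have hw := memLp_of_bound_of_supp hW.meas_deriv hW.bound_deriv hW.supp_deriv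
  set Y := J.compLpL 2 volume U with hY
  set X := J.compLpL 2 volume W₀ with hX
  set w₀ := hw.toLp w' with hw₀
  have e1 : ∫ t, inner ℂ (w' t) (J (U t)) = inner ℂ w₀ Y := by
    rw [L2.inner_def]
    refine integral_congr_ae ?_
    filter_upwards [hw.coeFn_toLp, J.coeFn_compLpL U] with t h1 h2
    rw [h1, h2]
  have e2 := hU W₀
  rw [← hY, ← hX, inner_sub_right, inner_add_right, inner_smul_right, inner_smul_right,
    inner_sub_right, inner_shiftLp] at e2
  -- Moving the translation onto the test function leaves the Taylor remainder divided by `τ`, plus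
  -- the damping term with `ε = τ`. Both are of order `τ`.
  have e3 : -(inner ℂ w₀ Y) + inner ℂ (D.compLpL 2 volume W₀)
        (opLp h.mult (D.compLpL 2 volume U)) - inner ℂ X f =
      ∫ t, inner ℂ (((τ⁻¹ : ℝ) : ℂ) • (J (W (t + τ)) - J (W t) - (τ : ℂ) • w' t) -
        (τ : ℂ) • J (W t)) (J (U t)) := by
    have e4 : ∫ t, inner ℂ (((τ⁻¹ : ℝ) : ℂ) • (J (W (t + τ)) - J (W t) - (τ : ℂ) • w' t) -
        (τ : ℂ) • J (W t)) (J (U t)) = inner ℂ (((τ⁻¹ : ℝ) : ℂ) • (shiftLp H (-τ) X - X -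
          (τ : ℂ) • w₀) - (τ : ℂ) • X) Y := by
      rw [L2.inner_def]
      refine integral_congr_ae ?_
      have hq := (measurePreserving_sub_right (volume : Measure ℝ) (-τ)).quasiMeasurePreserving
      filter_upwards [hw.coeFn_toLp, J.coeFn_compLpL U, J.coeFn_compLpL W₀, hW₀,
        hq.ae (J.coeFn_compLpL W₀), hq.ae hW₀, coeFn_shiftLp (-τ) X,
        Lp.coeFn_sub (((τ⁻¹ : ℝ) : ℂ) • (shiftLp H (-τ) X - X - (τ : ℂ) • w₀)) ((τ : ℂ) • X),
        Lp.coeFn_smul ((τ⁻¹ : ℝ) : ℂ) (shiftLp H (-τ) X - X - (τ : ℂ) • w₀),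
        Lp.coeFn_sub (shiftLp H (-τ) X - X) ((τ : ℂ) • w₀),
        Lp.coeFn_sub (shiftLp H (-τ) X) X, Lp.coeFn_smul (τ : ℂ) w₀,
        Lp.coeFn_smul (τ : ℂ) X] with t h1 h2 h3 h4 h5 h6 h7 h8 h9 h10 h11 h12 h13
      rw [h8, Pi.sub_apply, h9, Pi.smul_apply, h10, Pi.sub_apply, h11, Pi.sub_apply, h12, h13,
        Pi.smul_apply, Pi.smul_apply, h7, h5, h6, hX, h3, h4, hY, h2, hw₀, h1, sub_neg_eq_add]
    rw [e4]
    have hτc : (τ : ℂ) ≠ 0 := by exact_mod_cast hτ.ne'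
    simp only [inner_sub_left, inner_smul_left, Complex.conj_ofReal]
    have e5 : ((τ⁻¹ : ℝ) : ℂ) * (τ : ℂ) = 1 := by
      rw [Complex.ofReal_inv, inv_mul_cancel₀ hτc]
    linear_combination e2 + (inner ℂ w₀ Y) * e5
  rw [e1, e3]
  have e6 : ∀ t, ‖((τ⁻¹ : ℝ) : ℂ) • (J (W (t + τ)) - J (W t) - (τ : ℂ) • w' t) -
        (τ : ℂ) • J (W t)‖ ≤ τ * (K + ‖J‖ * K) := fun t => by
    refine (norm_sub_le _ _).trans ?_
    rw [norm_smul, norm_smul, Complex.norm_real, Complex.norm_real, Real.norm_of_nonneg hτ.le,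
      Real.norm_of_nonneg (inv_nonneg.2 hτ.le), mul_add]
    refine add_le_add ?_ ?_
    · rw [inv_mul_le_iff₀ hτ]
      refine (hW.taylor t τ hτ hτ1).trans (le_of_eq (by ring))
    · gcongr
      exact (J.le_opNorm _).trans (by gcongr; exact hW.bound t)
  -- The interval is enlarged by `1` because `W (t + τ)` occurs, with `τ ≤ 1`.
  have e7 : ∀ t, t ∉ Set.Icc (-(R + 1)) (R + 1) →
      inner ℂ (((τ⁻¹ : ℝ) : ℂ) • (J (W (t + τ)) - J (W t) - (τ : ℂ) • w' t) -
        (τ : ℂ) • J (W t)) (J (U t)) = 0 := fun t ht => by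
    have h1 : t ∉ Set.Icc (-R) R := fun hm => ht ⟨by linarith [hm.1], by linarith [hm.2]⟩
    have h2 : t + τ ∉ Set.Icc (-R) R := fun hm => ht ⟨by linarith [hm.1], by linarith [hm.2]⟩
    simp [hW.supp t h1, hW.supp _ h2, hW.supp_deriv t h1]
  rw [← setIntegral_eq_integral_of_forall_compl_eq_zero e7]
  have e8 := norm_setIntegral_le_of_norm_le_const_ae (μ := volume)
    (s := Set.Icc (-(R + 1)) (R + 1)) (C := τ * (K + ‖J‖ * K) * K₁)
    (f := fun t => inner ℂ (((τ⁻¹ : ℝ) : ℂ) • (J (W (t + τ)) - J (W t) - (τ : ℂ) • w' t) -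
        (τ : ℂ) • J (W t)) (J (U t)))
    isCompact_Icc.measure_lt_top (by
      refine ae_restrict_of_ae ?_
      filter_upwards [hK] with t ht
      refine (norm_inner_le_norm _ _).trans ?_
      gcongr
      exact e6 t)
  refine e8.trans (le_of_eq ?_)
  rw [Measure.real]
  ring

/-- The weighted bound, integrated over a time interval. -/
theorem SolvesDiscrete.integral_bound (hU : SolvesDiscrete h τ ε f U) (hτ : 0 < τ)
    (hε : 0 < ε) {E : H →L[ℂ] H} {P : V →L[ℂ] V} {lam : ℝ} (hE : IsWeight J D B E P lam)
    (hlam : τ * lam < 1) (hab : a ≤ b) (hf : ∀ᵐ t, f t = φ t • ψ)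
    (hφ : ∀ t, ‖φ t‖ ≤ m) (hsupp : ∀ t, t ∉ Set.Icc a b → φ t = 0) (χ : H) {c d : ℝ}
    (hac : a ≤ c) (hcd : c ≤ d) :
    ‖∫ t in c..d, inner ℂ χ (E (J (U t)))‖ ≤
      Real.exp (lam * (d - a + 2 * τ) / (1 - τ * lam)) * (m * ‖E ψ‖) * (b - a + τ) * ‖χ‖ *
        (d - c) := by
  have hm : 0 ≤ m := (norm_nonneg _).trans (hφ 0)
  have hq0 : 0 < 1 - τ * lam := by linarith
  have hlt : 0 ≤ lam := hE.nonneg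
  have h1 := intervalIntegral.norm_integral_le_of_norm_le_const_ae (a := c) (b := d)
    (f := fun t => inner ℂ χ (E (J (U t))))
    (C := Real.exp (lam * (d - a + 2 * τ) / (1 - τ * lam)) * (m * ‖E ψ‖) * (b - a + τ) * ‖χ‖) (by
      filter_upwards [hU.bound hτ hε hE hlam hf hφ hsupp] with t ht htcd
      rw [Set.uIoc_of_le hcd] at htcd
      -- Enough steps to get from any `t ≤ d` back before `a`; the slack of `2` is the source of `2
      -- * τ` in the exponent.
      obtain ⟨N, hN1, hN2⟩ : ∃ N : ℕ, (d - a) / τ < N ∧ (N : ℝ) ≤ (d - a) / τ + 2 := by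
        have h0 : 0 ≤ (d - a) / τ := div_nonneg (by linarith) hτ.le
        refine ⟨⌊(d - a) / τ⌋₊ + 1, by exact_mod_cast Nat.lt_floor_add_one _, ?_⟩
        push_cast
        linarith [Nat.floor_le h0]
      have h2 := ht N (by
        rw [div_lt_iff₀ hτ] at hN1
        linarith [htcd.2])
      refine (norm_inner_le_norm _ _).trans ?_
      rw [mul_comm]
      refine mul_le_mul_of_nonneg_right (h2.trans ?_) (norm_nonneg _)
      have h3 : (1 - τ * lam)⁻¹ ≤ Real.exp (τ * lam / (1 - τ * lam)) := by
        have : (1 - τ * lam)⁻¹ = τ * lam / (1 - τ * lam) + 1 := by field_simp; ring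
        rw [this]
        exact Real.add_one_le_exp _
      have h4 : ((1 - τ * lam)⁻¹) ^ N ≤ Real.exp (lam * (d - a + 2 * τ) / (1 - τ * lam)) := by
        calc ((1 - τ * lam)⁻¹) ^ N ≤ (Real.exp (τ * lam / (1 - τ * lam))) ^ N := by gcongr
          _ = Real.exp (N * (τ * lam / (1 - τ * lam))) := (Real.exp_nat_mul _ _).symm
          _ ≤ _ := by
            refine Real.exp_le_exp.2 ?_
            calc (N : ℝ) * (τ * lam / (1 - τ * lam)) ≤
                ((d - a) / τ + 2) * (τ * lam / (1 - τ * lam)) := by gcongr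
              _ = _ := by field_simp
      gcongr
      refine max_le ?_ (by linarith)
      linarith [min_le_right t b])
  rwa [abs_of_nonneg (by linarith)] at h1

end EvolutionLimit

/-! ### Passage to the limit and existence of weak solutions. -/

section EvolutionExistence

variable {V H 𝒢 : Type*}
  [NormedAddCommGroup V] [InnerProductSpace ℂ V] [CompleteSpace V]
  [NormedAddCommGroup H] [InnerProductSpace ℂ H] [CompleteSpace H]
  [NormedAddCommGroup 𝒢] [InnerProductSpace ℂ 𝒢] [CompleteSpace 𝒢]

/-- A square-integrable weight in time. -/
def timeWeight (t : ℝ) : ℝ := (1 + t ^ 2)⁻¹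

theorem timeWeight_pos (t : ℝ) : 0 < timeWeight t := by unfold timeWeight; positivity

theorem timeWeight_le_one (t : ℝ) : timeWeight t ≤ 1 :=
  inv_le_one_of_one_le₀ (by nlinarith [sq_nonneg t])

theorem continuous_timeWeight : Continuous timeWeight :=
  (by fun_prop : Continuous fun t : ℝ => 1 + t ^ 2).inv₀ fun t => by positivity

theorem isMultiplier_timeWeight (F : Type*) [NormedAddCommGroup F] [InnerProductSpace ℂ F] :
    IsMultiplier (volume : Measure ℝ)
      (fun t => ((timeWeight t : ℂ) • ContinuousLinearMap.id ℂ F)) 1 :=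
  isMultiplier_smul continuous_timeWeight.aestronglyMeasurable fun t => by
    rw [abs_of_pos (timeWeight_pos t)]; exact timeWeight_le_one t

/-- Multiplication by `timeWeight` on `L²(ℝ; F)`. -/
def timeMul (F : Type*) [NormedAddCommGroup F] [InnerProductSpace ℂ F] :
    Lp F 2 (volume : Measure ℝ) →L[ℂ] Lp F 2 (volume : Measure ℝ) :=
  opLp (isMultiplier_timeWeight F)

theorem coeFn_timeMul {F : Type*} [NormedAddCommGroup F] [InnerProductSpace ℂ F]
    (Y : Lp F 2 (volume : Measure ℝ)) :
    timeMul F Y =ᵐ[volume] fun t => (timeWeight t : ℂ) • Y t := by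
  filter_upwards [coeFn_opLp (isMultiplier_timeWeight F) Y] with t ht
  rw [timeMul, ht]; rfl

theorem inner_timeMul (X Y : Lp H 2 (volume : Measure ℝ)) :
    inner ℂ X (timeMul H Y) = inner ℂ (timeMul H X) Y := by
  rw [L2.inner_def, L2.inner_def]
  refine integral_congr_ae ?_
  filter_upwards [coeFn_timeMul X, coeFn_timeMul Y] with t h1 h2
  rw [h1, h2, inner_smul_left, inner_smul_right, Complex.conj_ofReal]

theorem compLpL_timeMul (L : V →L[ℂ] H) (Y : Lp V 2 (volume : Measure ℝ)) :
    L.compLpL 2 volume (timeMul V Y) = timeMul H (L.compLpL 2 volume Y) := by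
  refine Lp.ext ?_
  filter_upwards [L.coeFn_compLpL (timeMul V Y), L.coeFn_compLpL Y, coeFn_timeMul Y,
    coeFn_timeMul (L.compLpL 2 volume Y)] with t h1 h2 h3 h4
  rw [h1, h3, h4, h2, map_smul]

variable {J : V →L[ℂ] H} {D : V →L[ℂ] 𝒢} {B : ℝ → 𝒢 →L[ℂ] 𝒢} {C ν : ℝ}

/-- The functions `J (U t)` are bounded uniformly in time, but no uniform `L²(ℝ; H)` bound is
available as the damping disappears. A scalar weight in time commutes with `J` and `D` and restores
the boundedness that weak compactness requires. -/
theorem IsEvolution.norm_timeMul_sq_le (h : IsEvolution J D B C ν)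
    {U : Lp V 2 (volume : Measure ℝ)} {K : ℝ} (hK : ∀ᵐ t, ‖J (U t)‖ ≤ K) :
    ‖timeMul V U‖ ^ 2 ≤ (∫ t, K ^ 2 * (1 + t ^ 2)⁻¹) + ‖D.compLpL 2 volume U‖ ^ 2 := by
  rw [h.lp_norm_sq_eq, compLpL_timeMul, compLpL_timeMul]
  refine add_le_add ?_ ?_
  · rw [lp_norm_sq]
    refine integral_mono_ae (integrable_norm_sq _) (integrable_inv_one_add_sq.const_mul _) ?_
    filter_upwards [hK, coeFn_timeMul (J.compLpL 2 volume U), J.coeFn_compLpL U] with t h1 h2 h3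
    rw [h2, h3, norm_smul, Complex.norm_real, Real.norm_of_nonneg (timeWeight_pos t).le, mul_pow,
      mul_comm]
    have h4 : timeWeight t ^ 2 ≤ (1 + t ^ 2)⁻¹ := by
      have := timeWeight_le_one t
      change timeWeight t ^ 2 ≤ timeWeight t
      nlinarith [timeWeight_pos t]
    gcongr
  · have : ‖timeMul 𝒢 (D.compLpL 2 volume U)‖ ≤ ‖D.compLpL 2 volume U‖ := by
      refine Lp.norm_le_norm_of_ae_le ?_
      filter_upwards [coeFn_timeMul (D.compLpL 2 volume U)] with t ht
      rw [ht, norm_smul, Complex.norm_real, Real.norm_of_nonneg (timeWeight_pos t).le]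
      exact mul_le_of_le_one_left (norm_nonneg _) (timeWeight_le_one t)
    gcongr

/-- Removing the time weight from a weak limit. -/
def unweight (Z : Lp V 2 (volume : Measure ℝ)) (t : ℝ) : V := (((timeWeight t)⁻¹ : ℝ) : ℂ) • Z t

/-- On the compact time support of `v` the inverse weight is bounded, so it can be absorbed into
`v`. Pairing with `v` is then continuous in the weighted function and passes to the weak limit. -/
theorem inner_unweight_eq {v : ℝ → H} (hv : AEStronglyMeasurable v volume) {R K : ℝ}
    (hK : ∀ t, ‖v t‖ ≤ K) (hR : ∀ t, t ∉ Set.Icc (-R) R → v t = 0) :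
    ∃ v₀ : Lp H 2 (volume : Measure ℝ), (∀ U : Lp V 2 (volume : Measure ℝ),
      ∫ t, inner ℂ (v t) (J (U t)) = inner ℂ v₀ (J.compLpL 2 volume (timeMul V U))) ∧
      ∀ Z : Lp V 2 (volume : Measure ℝ),
      ∫ t, inner ℂ (v t) (J (unweight Z t)) = inner ℂ v₀ (J.compLpL 2 volume Z) := by
  have hcont : Continuous fun t : ℝ => (((timeWeight t)⁻¹ : ℝ) : ℂ) :=
    Complex.continuous_ofReal.comp
      (continuous_timeWeight.inv₀ fun t => (timeWeight_pos t).ne')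
  have hmem : MemLp (fun t => (((timeWeight t)⁻¹ : ℝ) : ℂ) • v t) 2 volume := by
    refine memLp_of_bound_of_supp (R := R) (K := (1 + R ^ 2) * K)
      (hcont.aestronglyMeasurable.smul hv) (fun t => ?_) (fun t ht => by simp [hR t ht])
    have hK0 : 0 ≤ K := (norm_nonneg _).trans (hK 0)
    by_cases ht : t ∈ Set.Icc (-R) R
    · rw [norm_smul, Complex.norm_real,
        Real.norm_of_nonneg (inv_nonneg.2 (timeWeight_pos t).le), timeWeight, inv_inv]
      have : t ^ 2 ≤ R ^ 2 := sq_le_sq' ht.1 ht.2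
      gcongr
      exact hK t
    · rw [hR t ht, smul_zero, norm_zero]
      positivity
  have key : ∀ t, timeWeight t ≠ 0 := fun t => (timeWeight_pos t).ne'
  refine ⟨hmem.toLp _, fun U => ?_, fun Z => ?_⟩
  · rw [L2.inner_def]
    refine integral_congr_ae ?_
    filter_upwards [hmem.coeFn_toLp, J.coeFn_compLpL (timeMul V U), coeFn_timeMul U]
      with t h1 h2 h3
    rw [h1, h2, h3, map_smul, inner_smul_left, inner_smul_right, Complex.conj_ofReal, ← mul_assoc,
      ← Complex.ofReal_mul, inv_mul_cancel₀ (key t), Complex.ofReal_one, one_mul]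
  · rw [L2.inner_def]
    refine integral_congr_ae ?_
    filter_upwards [hmem.coeFn_toLp, J.coeFn_compLpL Z] with t h1 h2
    rw [h1, h2, unweight, map_smul, inner_smul_left, inner_smul_right, Complex.conj_ofReal]

theorem locallyIntegrable_unweight (Z : Lp V 2 (volume : Measure ℝ)) :
    LocallyIntegrable (unweight Z) volume := by
  have h1 : LocallyIntegrable (fun t => Z t) volume :=
    (Lp.memLp Z).locallyIntegrable (by norm_num)
  have hcont : Continuous fun t : ℝ => (((timeWeight t)⁻¹ : ℝ) : ℂ) :=
    Complex.continuous_ofReal.comp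
      (continuous_timeWeight.inv₀ fun t => (timeWeight_pos t).ne')
  exact (locallyIntegrableOn_univ.1
    ((locallyIntegrableOn_univ.2 h1).continuousOn_smul isOpen_univ.isLocallyClosed hcont.continuousOn))

/-- Existence of energy solutions of the abstract evolution equation, with weighted bounds. -/
theorem IsEvolution.exists_solution (h : IsEvolution J D B C ν) {φ : ℝ → ℂ} (hφc : Continuous φ)
    {a b m : ℝ} (hab : a ≤ b) (hφ : ∀ t, ‖φ t‖ ≤ m) (hsupp : ∀ t, t ∉ Set.Icc a b → φ t = 0)
    (ψ : H) :
    ∃ (U : ℝ → V) (G : Lp 𝒢 2 (volume : Measure ℝ)), LocallyIntegrable U volume ∧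
      (∀ᵐ t, D (U t) = G t) ∧
      (∀ W w' R K, IsTimeTest J W w' R K →
        ∫ t, (-(inner ℂ (w' t) (J (U t))) + inner ℂ (D (W t)) (B t (G t))) =
          ∫ t, inner ℂ (J (W t)) (φ t • ψ)) ∧
      ∀ E P lam, IsWeight J D B E P lam → ∀ χ : H, ∀ᵐ t, a < t →
        ‖inner ℂ χ (E (J (U t)))‖ ≤
          Real.exp (lam * (t - a)) * (m * ‖E ψ‖) * (b - a) * ‖χ‖ := by
  have hφs : HasCompactSupport φ := HasCompactSupport.intro (isCompact_Icc (a := a) (b := b)) hsupp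
  have hφi : Integrable φ volume := hφc.integrable_of_hasCompactSupport hφs
  have hfm : MemLp (fun t => φ t • ψ) 2 volume :=
    (hφc.smul continuous_const).memLp_of_hasCompactSupport
      (HasCompactSupport.intro (isCompact_Icc (a := a) (b := b)) fun t ht => by simp [hsupp t ht])
  set f := hfm.toLp _ with hfdef
  have hf : ∀ᵐ t, f t = φ t • ψ := hfm.coeFn_toLp
  let τ : ℕ → ℝ := fun k => 1 / ((k : ℝ) + 1)
  have hτ : ∀ k, 0 < τ k := fun k => Nat.one_div_pos_of_nat
  have hτ1 : ∀ k, τ k ≤ 1 := fun k => by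
    have : (0 : ℝ) ≤ k := k.cast_nonneg
    exact (div_le_one (by positivity)).2 (by linarith)
  have hτlim : Tendsto τ atTop (𝓝 0) := tendsto_one_div_add_atTop_nhds_zero_nat
  -- The damping parameter is the time step, so it disappears in the limit at the rate of the Taylor
  -- error.
  choose U hU using fun k => h.exists_discrete (hτ k) (hτ k) f
  let 𝒰 : Ultrafilter ℕ := hyperfilter ℕ
  have h𝒰 : (𝒰 : Filter ℕ) ≤ atTop := Nat.hyperfilter_le_atTop
  have hτU : Tendsto τ 𝒰 (𝓝 0) := hτlim.mono_left h𝒰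
  set K₁ := m * ‖ψ‖ * (b - a + 1) with hK₁
  have hsup : ∀ k, ∀ᵐ t, ‖J (U k t)‖ ≤ K₁ := fun k =>
    (hU k).sup_bound (hτ k) (hτ1 k) (hτ k) hab hf hφ hsupp
  set K₂ := ν⁻¹ * ∫ t, K₁ * (‖φ t‖ * ‖ψ‖) with hK₂
  have hen : ∀ k, ‖D.compLpL 2 volume (U k)‖ ^ 2 ≤ K₂ := fun k => by
    rw [hK₂, ← div_eq_inv_mul, le_div_iff₀ h.pos, mul_comm]
    exact (hU k).energy_bound (hτ k) (hτ k) hf hφi (hsup k)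
  obtain ⟨Z, hZ⟩ := exists_weak_ultralimit 𝒰 (fun k => timeMul V (U k))
    (C := Real.sqrt ((∫ t, K₁ ^ 2 * (1 + t ^ 2)⁻¹) + K₂)) fun k =>
      Real.le_sqrt_of_sq_le ((h.norm_timeMul_sq_le (hsup k)).trans (by gcongr; exact hen k))
  obtain ⟨G, hG⟩ := exists_weak_ultralimit 𝒰 (fun k => D.compLpL 2 volume (U k))
    (C := Real.sqrt K₂) fun k => Real.le_sqrt_of_sq_le (hen k)
  have hlimJ : ∀ (v : ℝ → H) (R K : ℝ), AEStronglyMeasurable v volume → (∀ t, ‖v t‖ ≤ K) →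
      (∀ t, t ∉ Set.Icc (-R) R → v t = 0) →
      Tendsto (fun k => ∫ t, inner ℂ (v t) (J (U k t))) 𝒰
        (𝓝 (∫ t, inner ℂ (v t) (J (unweight Z t)))) := fun v R K hv hK hR => by
    obtain ⟨v₀, h1, h2⟩ := inner_unweight_eq (J := J) hv hK hR
    simp only [h1, h2]
    have := hZ (ContinuousLinearMap.adjoint (J.compLpL 2 volume) v₀)
    simpa only [ContinuousLinearMap.adjoint_inner_left] using this
  -- The two weak limits are taken separately; since the weight commutes with `D`, the limit `G` is
  -- the gradient of the unweighted limit.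
  have hDZ : D.compLpL 2 volume Z = timeMul 𝒢 G := by
    refine ext_inner_left ℂ fun y => ?_
    have h1 := hZ (ContinuousLinearMap.adjoint (D.compLpL 2 volume) y)
    simp only [ContinuousLinearMap.adjoint_inner_left] at h1
    have h2 := hG (timeMul 𝒢 y)
    rw [inner_timeMul]
    refine tendsto_nhds_unique h1 (h2.congr fun k => ?_)
    rw [compLpL_timeMul, inner_timeMul]
  refine ⟨unweight Z, G, locallyIntegrable_unweight Z, ?_, ?_, ?_⟩
  · filter_upwards [D.coeFn_compLpL Z, coeFn_timeMul G] with t h1 h2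
    rw [unweight, map_smul, ← h1, hDZ, h2, smul_smul, ← Complex.ofReal_mul,
      inv_mul_cancel₀ (timeWeight_pos t).ne', Complex.ofReal_one, one_smul]
  · intro W w' R K hW
    have hWm := memLp_of_bound_of_supp hW.meas hW.bound hW.supp
    set W₀ := hWm.toLp W with hW₀
    have hW₀e : W₀ =ᵐ[volume] W := hWm.coeFn_toLp
    have h1 := hlimJ w' R K hW.meas_deriv hW.bound_deriv hW.supp_deriv
    have h2 := hG (ContinuousLinearMap.adjoint (opLp h.mult) (D.compLpL 2 volume W₀))
    simp only [ContinuousLinearMap.adjoint_inner_left] at h2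
    have h3 : Tendsto (fun k => -(∫ t, inner ℂ (w' t) (J (U k t))) +
        inner ℂ (D.compLpL 2 volume W₀) (opLp h.mult (D.compLpL 2 volume (U k))) -
        inner ℂ (J.compLpL 2 volume W₀) f) 𝒰 (𝓝 0) := by
      refine squeeze_zero_norm (fun k => (hU k).consistency (hτ k) (hτ1 k) (hsup k) hW W₀ hW₀e) ?_
      simpa using hτU.mul_const (K₁ * (K + ‖J‖ * K) *
        (volume (Set.Icc (-(R + 1)) (R + 1))).toReal)
    have h4 := tendsto_nhds_unique ((h1.neg.add h2).sub_const _) h3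
    have h5 : inner ℂ (J.compLpL 2 volume W₀) f = ∫ t, inner ℂ (J (W t)) (φ t • ψ) := by
      rw [L2.inner_def]
      refine integral_congr_ae ?_
      filter_upwards [J.coeFn_compLpL W₀, hW₀e, hf] with t e1 e2 e3
      rw [e1, e2, e3]
    have h6i := L2.integrable_inner (𝕜 := ℂ) (D.compLpL 2 volume W₀) (opLp h.mult G)
    have h6e : (fun t => inner ℂ (D.compLpL 2 volume W₀ t) (opLp h.mult G t)) =ᵐ[volume]
        fun t => inner ℂ (D (W t)) (B t (G t)) := by
      filter_upwards [D.coeFn_compLpL W₀, hW₀e, coeFn_opLp h.mult G] with t e1 e2 e3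
      rw [e1, e2, e3]
    have h6 : inner ℂ (D.compLpL 2 volume W₀) (opLp h.mult G) =
        ∫ t, inner ℂ (D (W t)) (B t (G t)) := by
      rw [L2.inner_def]
      exact integral_congr_ae h6e
    have hJm : AEStronglyMeasurable (fun t => J (unweight Z t)) volume :=
      J.continuous.comp_aestronglyMeasurable (locallyIntegrable_unweight Z).aestronglyMeasurable
    have h7i : Integrable (fun t => inner ℂ (w' t) (J (unweight Z t))) volume := by
      have e1 : IntegrableOn (fun t => J (unweight Z t)) (Set.Icc (-R) R) volume :=
        J.integrable_comp ((locallyIntegrable_unweight Z).integrableOn_isCompact isCompact_Icc)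
      refine IntegrableOn.integrable_of_forall_notMem_eq_zero (s := Set.Icc (-R) R) ?_
        fun t ht => by simp [hW.supp_deriv t ht]
      refine (e1.norm.const_mul K).mono' (hW.meas_deriv.inner hJm).restrict ?_
      refine Eventually.of_forall fun t => (norm_inner_le_norm _ _).trans ?_
      gcongr
      exact hW.bound_deriv t
    have h7n : Integrable (fun t => -inner ℂ (w' t) (J (unweight Z t))) volume := h7i.neg
    rw [integral_add h7n (h6i.congr h6e), integral_neg, ← h5, ← h6]
    exact sub_eq_zero.1 h4
  · intro E P lam hE χ
    have hloc : LocallyIntegrable (fun t => inner ℂ χ (E (J (unweight Z t)))) volume := by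
      intro t
      obtain ⟨s, hs, hsi⟩ := locallyIntegrable_unweight Z t
      exact ⟨s, hs, (((innerSL ℂ χ) ∘L E ∘L J).integrable_comp hsi :)⟩
    have := ae_norm_le_of_norm_integral_le hloc (isOpen_Ioi (a := a))
      (g := fun _ d => Real.exp (lam * (d - a)) * (m * ‖E ψ‖) * (b - a) * ‖χ‖)
      (fun s _ => by fun_prop) (fun c d hcd hO => ?_)
    · exact this
    have hac : a ≤ c := le_of_lt (hO ⟨le_rfl, hcd.le⟩)
    -- Weak convergence sees only averages in time. Pairing with this `v` gives the average over
    -- `(c, d)`, and differentiation recovers the bound at almost every time.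
    let v : ℝ → H := (Set.Ioc c d).indicator fun _ => ContinuousLinearMap.adjoint E χ
    have hv1 : ∀ t, ‖v t‖ ≤ ‖ContinuousLinearMap.adjoint E χ‖ := fun t => by
      by_cases ht : t ∈ Set.Ioc c d <;> simp [v, ht]
    have hv2 : ∀ t, t ∉ Set.Icc (-(|c| + |d|)) (|c| + |d|) → v t = 0 := fun t ht => by
      refine Set.indicator_of_notMem (fun hm => ht ⟨?_, ?_⟩) _
      · linarith [neg_abs_le c, abs_nonneg d, hm.1]
      · linarith [le_abs_self d, abs_nonneg c, hm.2]
    have h1 := hlimJ v _ _ (aestronglyMeasurable_const.indicator measurableSet_Ioc)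
      hv1 hv2
    have hv3 : ∀ Y : ℝ → V, ∫ t, inner ℂ (v t) (J (Y t)) =
        ∫ t in c..d, inner ℂ χ (E (J (Y t))) := fun Y => by
      rw [intervalIntegral.integral_of_le hcd.le, ← integral_indicator measurableSet_Ioc]
      congr 1
      funext t
      by_cases ht : t ∈ Set.Ioc c d
      · simp [v, ht, ContinuousLinearMap.adjoint_inner_left]
      · simp [v, ht]
    simp only [hv3] at h1
    have h2 : Tendsto (fun k => Real.exp (lam * (d - a + 2 * τ k) / (1 - τ k * lam)) *
        (m * ‖E ψ‖) * (b - a + τ k) * ‖χ‖ * (d - c)) 𝒰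
        (𝓝 (Real.exp (lam * (d - a + 2 * 0) / (1 - 0 * lam)) *
        (m * ‖E ψ‖) * (b - a + 0) * ‖χ‖ * (d - c))) := by
      have e1 : Tendsto (fun k => lam * (d - a + 2 * τ k) / (1 - τ k * lam)) 𝒰
          (𝓝 (lam * (d - a + 2 * 0) / (1 - 0 * lam))) :=
        (((hτU.const_mul 2).const_add _).const_mul _).div ((hτU.mul_const _).const_sub _)
          (by simp)
      exact (((((Real.continuous_exp.tendsto _).comp e1).mul_const _).mul
        (hτU.const_add _)).mul_const _).mul_const _
    have h3 : ∀ᶠ k in (𝒰 : Filter ℕ), τ k * lam < 1 := by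
      have := hτU.mul_const lam
      rw [zero_mul] at this
      exact this.eventually (gt_mem_nhds one_pos)
    have h4 := le_of_tendsto_of_tendsto h1.norm h2 (by
      filter_upwards [h3] with k hk
      exact (hU k).integral_bound (hτ k) (hτ k) hE hk hab hf hφ hsupp χ hac hcd.le)
    refine h4.trans (le_of_eq ?_)
    simp only [mul_zero, add_zero, zero_mul, sub_zero, div_one]
    ring

end EvolutionExistence

variable {n : ℕ} {ω : Rn n → ℝ}

/-! ### Local integrability of an `A₂` weight and of its inverse. -/

section Weight

theorem isCompact_cube (a : Rn n) (r : ℝ) : IsCompact (cube a r) := by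
  have h : cube a r = (WithLp.toLp 2) '' (Set.Icc (a.ofLp) (fun i => a i + r)) := by
    ext x
    constructor
    · intro hx
      exact ⟨x.ofLp, ⟨fun i => (hx i).1, fun i => (hx i).2⟩, rfl⟩
    · rintro ⟨y, hy, rfl⟩ i
      exact ⟨hy.1 i, hy.2 i⟩
  rw [h]
  exact isCompact_Icc.image (PiLp.continuous_toLp 2 _)

theorem abs_apply_le_norm (x : Rn n) (i : Fin n) : |x i| ≤ ‖x‖ := by
  simpa using PiLp.norm_apply_le x i

theorem volume_cube_pos (a : Rn n) {r : ℝ} (hr : 0 < r) : 0 < volume (cube a r) := by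
  let c : Rn n := WithLp.toLp 2 fun i => a i + r / 2
  refine lt_of_lt_of_le (Metric.measure_ball_pos volume c (half_pos hr)) (measure_mono ?_)
  intro x hx i
  rw [Metric.mem_ball, dist_eq_norm] at hx
  have h1 := (abs_apply_le_norm (x - c) i).trans_lt hx
  have h2 : (x - c) i = x i - (a i + r / 2) := rfl
  rw [h2, abs_lt] at h1
  constructor <;> linarith [h1.1, h1.2]

theorem exists_cube_superset {K : Set (Rn n)} (hK : IsCompact K) :
    ∃ a r, 0 < r ∧ K ⊆ cube a r := by
  obtain ⟨R, hR, hKR⟩ := hK.isBounded.subset_closedBall_lt 0 0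
  refine ⟨WithLp.toLp 2 fun _ => -R, 2 * R, by linarith, fun x hx i => ?_⟩
  have h1 := (abs_apply_le_norm x i).trans (by simpa using hKR hx)
  rw [abs_le] at h1
  constructor
  · exact h1.1
  · change x i ≤ -R + 2 * R
    linarith [h1.2]

theorem setLIntegral_ofReal_pos {g : Rn n → ℝ} (hg : AEMeasurable g volume) (hpos : ∀ x, 0 < g x)
    (a : Rn n) {r : ℝ} (hr : 0 < r) : ∫⁻ x in cube a r, ENNReal.ofReal (g x) ≠ 0 := by
  intro h
  rw [lintegral_eq_zero_iff' hg.ennreal_ofReal.restrict] at h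
  have h1 : volume.restrict (cube a r) Set.univ = 0 := by
    refine measure_mono_null (fun x _ => ?_) (ae_iff.1 h)
    simp [hpos x]
  rw [Measure.restrict_apply_univ] at h1
  exact (volume_cube_pos a hr).ne' h1

namespace IsA2Weight

/-- The product of the two averages is finite and, by positivity of `ω`, neither is zero; hence each
is finite. The finiteness of the `A₂` constant enters only here. -/
theorem cube_lt_top (hω : IsA2Weight ω) (a : Rn n) {r : ℝ} (hr : 0 < r) :
    ∫⁻ x in cube a r, ENNReal.ofReal (ω x) < ⊤ ∧
      ∫⁻ x in cube a r, ENNReal.ofReal (ω x)⁻¹ < ⊤ := by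
  have h1 : ((volume (cube a r))⁻¹ * ∫⁻ x in cube a r, ENNReal.ofReal (ω x)) *
      ((volume (cube a r))⁻¹ * ∫⁻ x in cube a r, ENNReal.ofReal (ω x)⁻¹) < ⊤ := by
    refine lt_of_le_of_lt ?_ hω.const_lt_top
    exact le_iSup_of_le a (le_iSup_of_le r (le_iSup_of_le hr le_rfl))
  have hv : (volume (cube a r))⁻¹ ≠ 0 :=
    ENNReal.inv_ne_zero.2 (isCompact_cube a r).measure_lt_top.ne
  have p1 := setLIntegral_ofReal_pos hω.measurable hω.pos a hr
  have p2 := setLIntegral_ofReal_pos hω.measurable.inv (fun x => inv_pos.2 (hω.pos x)) a hr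
  simp only [Pi.inv_apply] at p2
  rw [ENNReal.mul_lt_top_iff] at h1
  have h2 : (volume (cube a r))⁻¹ * ∫⁻ x in cube a r, ENNReal.ofReal (ω x) < ⊤ ∧
      (volume (cube a r))⁻¹ * ∫⁻ x in cube a r, ENNReal.ofReal (ω x)⁻¹ < ⊤ := by
    rcases h1 with h | h | h
    · exact h
    · exact absurd h (mul_ne_zero hv p1)
    · exact absurd h (mul_ne_zero hv p2)
  exact ⟨ENNReal.lt_top_of_mul_ne_top_right h2.1.ne hv,
    ENNReal.lt_top_of_mul_ne_top_right h2.2.ne hv⟩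

theorem locallyIntegrable_inv (hω : IsA2Weight ω) :
    LocallyIntegrable (fun x => (ω x)⁻¹) volume := by
  rw [locallyIntegrable_iff]
  intro K hK
  obtain ⟨a, r, hr, hKr⟩ := exists_cube_superset hK
  refine IntegrableOn.mono_set ?_ hKr
  refine ⟨hω.measurable.inv.aestronglyMeasurable.restrict, ?_⟩
  rw [hasFiniteIntegral_iff_ofReal (Eventually.of_forall fun x => (inv_pos.2 (hω.pos x)).le)]
  exact (hω.cube_lt_top a hr).2

end IsA2Weight

instance : SigmaFinite (wMeasure ω) := by unfold wMeasure; infer_instance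

theorem IsA2Weight.isLocallyFiniteMeasure (hω : IsA2Weight ω) :
    IsLocallyFiniteMeasure (wMeasure ω) := by
  have : IsFiniteMeasureOnCompacts (wMeasure ω) := ⟨fun K hK => by
    obtain ⟨a, r, hr, hKr⟩ := exists_cube_superset hK
    refine (measure_mono hKr).trans_lt ?_
    rw [wMeasure, withDensity_apply _ (isCompact_cube a r).measurableSet]
    exact (hω.cube_lt_top a hr).1⟩
  infer_instance

theorem wMeasure_ac : wMeasure ω ≪ volume := withDensity_absolutelyContinuous _ _

theorem IsA2Weight.ac (hω : IsA2Weight ω) : volume ≪ wMeasure ω :=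
  withDensity_absolutelyContinuous' hω.measurable.ennreal_ofReal
    (Eventually.of_forall fun x => by simpa using hω.pos x)

theorem IsA2Weight.integrable_wMeasure (hω : IsA2Weight ω) {F : Type*} [NormedAddCommGroup F]
    [NormedSpace ℝ F] {g : Rn n → F} :
    Integrable g (wMeasure ω) ↔ Integrable (fun x => ω x • g x) volume := by
  rw [wMeasure, integrable_withDensity_iff_integrable_smul₀' hω.measurable.ennreal_ofReal
    (Eventually.of_forall fun x => ENNReal.ofReal_lt_top)]
  simp only [ENNReal.toReal_ofReal (hω.pos _).le]

theorem IsA2Weight.integral_wMeasure (hω : IsA2Weight ω) {F : Type*} [NormedAddCommGroup F]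
    [NormedSpace ℝ F] (g : Rn n → F) :
    ∫ x, g x ∂(wMeasure ω) = ∫ x, ω x • g x := by
  rw [wMeasure, integral_withDensity_eq_integral_toReal_smul₀ hω.measurable.ennreal_ofReal
    (Eventually.of_forall fun x => ENNReal.ofReal_lt_top)]
  simp only [ENNReal.toReal_ofReal (hω.pos _).le]

end Weight

/-! ### The space `H¹_ω` as a closed graph. -/

section DualTest

/-- The squared norm is `∫ |φ|² ω⁻¹ dx`, finite by local integrability of `ω⁻¹`. Integration against
`φ dx` is thereby a continuous functional on `L²_ω`. -/
theorem IsA2Weight.memLp_dual (hω : IsA2Weight ω) {φ : Rn n → ℂ} (hc : Continuous φ)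
    (hs : HasCompactSupport φ) :
    MemLp (fun x => starRingEnd ℂ (φ x) * ((ω x)⁻¹ : ℂ)) 2 (wMeasure ω) := by
  have hm : AEStronglyMeasurable (fun x => starRingEnd ℂ (φ x) * ((ω x)⁻¹ : ℂ)) (wMeasure ω) := by
    refine AEStronglyMeasurable.mono_ac wMeasure_ac ?_
    refine (Complex.continuous_conj.comp hc).aestronglyMeasurable.mul ?_
    have := Complex.continuous_ofReal.comp_aestronglyMeasurable
      hω.measurable.inv.aestronglyMeasurable
    simpa using this
  rw [memLp_two_iff_integrable_sq_norm hm, hω.integrable_wMeasure]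
  have h1 : Integrable (fun x => (‖φ x‖ ^ 2) • (ω x)⁻¹) volume :=
    hω.locallyIntegrable_inv.integrable_smul_left_of_hasCompactSupport (by fun_prop)
      (hs.comp_left (g := fun z : ℂ => ‖z‖ ^ 2) (by simp))
  refine h1.congr (Eventually.of_forall fun x => ?_)
  have := hω.pos x
  simp only [smul_eq_mul, norm_mul, RCLike.norm_conj, norm_inv, Complex.norm_real,
    Real.norm_of_nonneg this.le]
  field_simp

/-- The element of `L²_ω` representing integration against `φ` with respect to `dx`. -/
def dualTest (hω : IsA2Weight ω) {φ : Rn n → ℂ} (hc : Continuous φ) (hs : HasCompactSupport φ) :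
    L2w ω := (hω.memLp_dual hc hs).toLp _

theorem coeFn_dualTest (hω : IsA2Weight ω) {φ : Rn n → ℂ} (hc : Continuous φ)
    (hs : HasCompactSupport φ) :
    ∀ᵐ x ∂(wMeasure ω), dualTest hω hc hs x = starRingEnd ℂ (φ x) * ((ω x)⁻¹ : ℂ) :=
  (hω.memLp_dual hc hs).coeFn_toLp

theorem integrable_mul_test (hω : IsA2Weight ω) {φ : Rn n → ℂ} (hc : Continuous φ)
    (hs : HasCompactSupport φ) (f : L2w ω) : Integrable (fun x => f x * φ x) volume := by
  have h1 := L2.integrable_inner (𝕜 := ℂ) (dualTest hω hc hs) f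
  rw [hω.integrable_wMeasure] at h1
  refine h1.congr ?_
  filter_upwards [hω.ac (coeFn_dualTest hω hc hs)] with x hx
  have hx' : (ω x : ℂ) ≠ 0 := by exact_mod_cast (hω.pos x).ne'
  simp only [hx, RCLike.inner_apply, map_mul, Complex.conj_conj, map_inv₀, Complex.conj_ofReal,
    Complex.real_smul]
  field_simp

theorem integral_mul_test (hω : IsA2Weight ω) {φ : Rn n → ℂ} (hc : Continuous φ)
    (hs : HasCompactSupport φ) (f : L2w ω) :
    ∫ x, f x * φ x = inner ℂ (dualTest hω hc hs) f := by
  rw [L2.inner_def, hω.integral_wMeasure]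
  refine integral_congr_ae ?_
  filter_upwards [hω.ac (coeFn_dualTest hω hc hs)] with x hx
  have hx' : (ω x : ℂ) ≠ 0 := by exact_mod_cast (hω.pos x).ne'
  simp only [hx, RCLike.inner_apply, map_mul, Complex.conj_conj, map_inv₀, Complex.conj_ofReal,
    Complex.real_smul]
  field_simp

theorem IsTest.continuous {X : Type*} [NormedAddCommGroup X] [NormedSpace ℝ X] {φ : X → ℂ}
    (h : IsTest φ) : Continuous φ := h.1.continuous

theorem IsTest.continuous_grad {φ : Rn n → ℂ} (h : IsTest φ) (i : Fin n) :
    Continuous fun x => grad φ x i :=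
  (h.1.continuous_fderiv (by simp)).clm_apply continuous_const

theorem IsTest.hasCompactSupport_grad {φ : Rn n → ℂ} (h : IsTest φ) (i : Fin n) :
    HasCompactSupport fun x => grad φ x i :=
  (h.2.fderiv (𝕜 := ℝ)).comp_left (g := fun L : Rn n →L[ℝ] ℂ => L (EuclideanSpace.single i 1)) rfl

/-- The `i`-th component of an element of `L²_ωⁿ`. -/
def compL2w (i : Fin n) : L2wVec ω →L[ℂ] L2w ω :=
  (EuclideanSpace.proj i : Cn n →L[ℂ] ℂ).compLpL 2 (wMeasure ω)

theorem coeFn_compL2w (i : Fin n) (g : L2wVec ω) :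
    ∀ᵐ x ∂(wMeasure ω), compL2w i g x = g x i :=
  (EuclideanSpace.proj i : Cn n →L[ℂ] ℂ).coeFn_compLpL g

theorem integral_comp_mul_test (hω : IsA2Weight ω) {φ : Rn n → ℂ} (hc : Continuous φ)
    (hs : HasCompactSupport φ) (g : L2wVec ω) (i : Fin n) :
    ∫ x, g x i * φ x = inner ℂ (dualTest hω hc hs) (compL2w i g) := by
  rw [← integral_mul_test]
  refine integral_congr_ae ?_
  filter_upwards [hω.ac (coeFn_compL2w i g)] with x hx
  rw [hx]

/-- Distributional identities become kernels of continuous functionals, from which linearity and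
closedness of the graph, hence completeness of `H¹_ω`, are immediate. -/
theorem hasWeakGrad_iff (hω : IsA2Weight ω) (f : L2w ω) (g : L2wVec ω) :
    HasWeakGrad ω f g ↔ ∀ (φ : Rn n → ℂ) (hφ : IsTest φ) (i : Fin n),
      inner ℂ (dualTest hω (hφ.continuous_grad i) (hφ.hasCompactSupport_grad i)) f +
        inner ℂ (dualTest hω hφ.continuous hφ.2) (compL2w i g) = 0 := by
  refine forall_congr' fun φ => forall_congr' fun hφ => forall_congr' fun i => ?_
  rw [integral_mul_test hω (hφ.continuous_grad i) (hφ.hasCompactSupport_grad i),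
    integral_comp_mul_test hω hφ.continuous hφ.2, eq_neg_iff_add_eq_zero]

/-- The graph of the weak gradient, i.e. `H¹_ω` with its graph norm. -/
def energySpace (hω : IsA2Weight ω) : Submodule ℂ (WithLp 2 (L2w ω × L2wVec ω)) where
  carrier := {p | HasWeakGrad ω p.fst p.snd}
  add_mem' := fun {p q} hp hq => by
    simp only [Set.mem_ofPred_eq, hasWeakGrad_iff hω] at hp hq ⊢
    intro φ hφ i
    have h1 := hp φ hφ i
    have h2 := hq φ hφ i
    simp only [WithLp.add_fst, WithLp.add_snd, map_add, inner_add_right]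
    linear_combination h1 + h2
  zero_mem' := by
    simp only [Set.mem_ofPred_eq, hasWeakGrad_iff hω]
    intro φ hφ i
    simp
  smul_mem' := fun c p hp => by
    simp only [Set.mem_ofPred_eq, hasWeakGrad_iff hω] at hp ⊢
    intro φ hφ i
    have h1 := hp φ hφ i
    simp only [WithLp.smul_fst, WithLp.smul_snd, map_smul, inner_smul_right]
    linear_combination c * h1

theorem isClosed_energySpace (hω : IsA2Weight ω) : IsClosed (energySpace hω : Set (WithLp 2 (L2w ω × L2wVec ω))) := by
  have h : (energySpace hω : Set (WithLp 2 (L2w ω × L2wVec ω))) =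
      ⋂ (φ : Rn n → ℂ) (hφ : IsTest φ) (i : Fin n), {p |
        inner ℂ (dualTest hω (hφ.continuous_grad i) (hφ.hasCompactSupport_grad i)) p.fst +
        inner ℂ (dualTest hω hφ.continuous hφ.2) (compL2w i p.snd) = 0} := by
    ext p
    simp only [Set.mem_iInter, Set.mem_ofPred_eq]
    exact hasWeakGrad_iff hω p.fst p.snd
  rw [h]
  refine isClosed_iInter fun φ => isClosed_iInter fun hφ => isClosed_iInter fun i => ?_
  refine isClosed_eq ?_ continuous_const
  have e1 : Continuous fun p : WithLp 2 (L2w ω × L2wVec ω) => p.fst :=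
    (WithLp.fstL 2 ℂ (L2w ω) (L2wVec ω)).continuous
  have e2 : Continuous fun p : WithLp 2 (L2w ω × L2wVec ω) => compL2w i p.snd :=
    (compL2w i).continuous.comp (WithLp.sndL 2 ℂ (L2w ω) (L2wVec ω)).continuous
  exact (continuous_const.inner e1).add (continuous_const.inner e2)

instance (hω : IsA2Weight ω) : CompleteSpace (energySpace hω) :=
  (isClosed_energySpace hω).completeSpace_coe

/-- The embedding of `H¹_ω` into `L²_ω`. -/
def energyJ (hω : IsA2Weight ω) : energySpace hω →L[ℂ] L2w ω :=
  (WithLp.fstL 2 ℂ (L2w ω) (L2wVec ω)) ∘L (energySpace hω).subtypeL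

/-- The weak gradient on `H¹_ω`. -/
def energyD (hω : IsA2Weight ω) : energySpace hω →L[ℂ] L2wVec ω :=
  (WithLp.sndL 2 ℂ (L2w ω) (L2wVec ω)) ∘L (energySpace hω).subtypeL

theorem energy_norm_sq (hω : IsA2Weight ω) (v : energySpace hω) :
    ‖v‖ ^ 2 = ‖energyJ hω v‖ ^ 2 + ‖energyD hω v‖ ^ 2 :=
  WithLp.prod_norm_sq_eq_of_L2 (v : WithLp 2 (L2w ω × L2wVec ω))

theorem energy_hasWeakGrad (hω : IsA2Weight ω) (v : energySpace hω) :
    HasWeakGrad ω (energyJ hω v) (energyD hω v) := v.2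

/-- The element of `H¹_ω` given by a function and its weak gradient. -/
def energyMk (hω : IsA2Weight ω) {f : L2w ω} {g : L2wVec ω} (h : HasWeakGrad ω f g) :
    energySpace hω := ⟨WithLp.toLp 2 (f, g), h⟩

end DualTest

instance {F : Type*} [NormedAddCommGroup F] [TopologicalSpace.SeparableSpace F] :
    SecondCountableTopology (Lp F 2 (wMeasure ω)) :=
  haveI : Fact ((2 : ℝ≥0∞) ≠ ⊤) := ⟨ENNReal.ofNat_ne_top⟩
  Lp.SecondCountableTopology

/-! ### The coefficients `ω⁻¹A` as a bounded elliptic family of operators. -/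

section Coefficients

/-- The operator `ω(x)⁻¹ A(t,x)` on `ℂⁿ`. -/
def rescaledOp (ω : Rn n → ℝ) (A : ℝ → Rn n → Matrix (Fin n) (Fin n) ℂ) (t : ℝ) (x : Rn n) :
    Cn n →L[ℂ] Cn n :=
  ((ω x)⁻¹ : ℂ) • Matrix.toEuclideanCLM (n := Fin n) (𝕜 := ℂ) (A t x)

theorem inner_rescaledOp (A : ℝ → Rn n → Matrix (Fin n) (Fin n) ℂ) (t : ℝ) (x : Rn n)
    (v w : Cn n) : inner ℂ v (rescaledOp ω A t x w) =
      ((ω x)⁻¹ : ℂ) * ((A t x *ᵥ w.ofLp) ⬝ᵥ star v.ofLp) := by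
  rw [rescaledOp, smul_apply, inner_smul_right,
    EuclideanSpace.inner_eq_star_dotProduct, Matrix.ofLp_toEuclideanCLM]

theorem norm_toLp_star (v : Cn n) : ‖(WithLp.toLp 2 (star v.ofLp) : Cn n)‖ = ‖v‖ := by
  simp [EuclideanSpace.norm_eq]

variable {M ν : ℝ} {A : ℝ → Rn n → Matrix (Fin n) (Fin n) ℂ}

/-- The bilinear bound is applied with `ζ` the complex conjugate of `z = ω⁻¹Aξ`, which has the norm
of `z`. -/
theorem IsElliptic.norm_rescaledOp_le (hA : IsElliptic ω M ν A) (hM : 0 < M) {t : ℝ} {x : Rn n}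
    (hx : 0 < ω x) : ‖rescaledOp ω A t x‖ ≤ M := by
  refine ContinuousLinearMap.opNorm_le_bound _ hM.le fun ξ => ?_
  set z := rescaledOp ω A t x ξ with hz
  have h1 : ‖z‖ ^ 2 = ‖inner ℂ z z‖ := by
    rw [inner_self_eq_norm_sq_to_K]; simp
  have h2 : ‖inner ℂ z z‖ ≤ M * ‖ξ‖ * ‖z‖ := by
    nth_rw 2 [hz]
    rw [inner_rescaledOp, norm_mul, norm_inv, Complex.norm_real, Real.norm_of_nonneg hx.le,
      inv_mul_le_iff₀ hx]
    refine (hA.upper t x ξ (WithLp.toLp 2 (star z.ofLp))).trans (le_of_eq ?_)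
    rw [norm_toLp_star]
    ring
  rcases eq_or_lt_of_le (norm_nonneg z) with h0 | h0
  · rw [← h0]; positivity
  · rw [← h1, sq] at h2
    exact le_of_mul_le_mul_right h2 h0

theorem IsElliptic.re_inner_rescaledOp (hA : IsElliptic ω M ν A) {t : ℝ} {x : Rn n}
    (hx : 0 < ω x) (ξ : Cn n) : ν * ‖ξ‖ ^ 2 ≤ (inner ℂ ξ (rescaledOp ω A t x ξ)).re := by
  rw [inner_rescaledOp, ← Complex.ofReal_inv, Complex.re_ofReal_mul, ← div_eq_inv_mul,
    le_div_iff₀ hx]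
  exact hA.lower t x ξ

/-- A unit vector exists since `n ≥ 1`. The inequality ensures that the substitute `ν • id` in
`coeffOp` respects the bound `M`. -/
theorem IsElliptic.nu_le (hA : IsElliptic ω M ν A) (hM : 0 < M) (hω : IsA2Weight ω) (hn : 1 ≤ n) :
    ν ≤ M := by
  let ξ : Cn n := EuclideanSpace.single ⟨0, hn⟩ 1
  have hξ : ‖ξ‖ = 1 := by simp [ξ]
  have h1 := hA.re_inner_rescaledOp (t := 0) (hω.pos 0) ξ
  have h2 : (inner ℂ ξ (rescaledOp ω A 0 0 ξ)).re ≤ ‖ξ‖ * ‖rescaledOp ω A 0 0 ξ‖ :=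
    re_inner_le_norm (𝕜 := ℂ) _ _
  have h3 := (rescaledOp ω A 0 0).le_of_opNorm_le (hA.norm_rescaledOp_le hM (hω.pos 0)) ξ
  rw [hξ] at h1 h2 h3
  linarith

open Classical in
/-- `ω⁻¹A`, replaced by a multiple of the identity at the null set of times where it is not
measurable in space. -/
def coeffOp (ω : Rn n → ℝ) (ν : ℝ) (A : ℝ → Rn n → Matrix (Fin n) (Fin n) ℂ) (t : ℝ) (x : Rn n) :
    Cn n →L[ℂ] Cn n :=
  if ∀ i j, AEMeasurable (fun x => A t x i j) volume then rescaledOp ω A t x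
  else (ν : ℂ) • ContinuousLinearMap.id ℂ (Cn n)

theorem norm_coeffOp_le (hA : IsElliptic ω M ν A) (hM : 0 < M) (hν : 0 < ν) (hω : IsA2Weight ω)
    (hn : 1 ≤ n) (t : ℝ) (x : Rn n) : ‖coeffOp ω ν A t x‖ ≤ M := by
  unfold coeffOp
  split_ifs
  · exact hA.norm_rescaledOp_le hM (hω.pos x)
  · refine ContinuousLinearMap.opNorm_le_bound _ hM.le fun ξ => ?_
    rw [smul_apply, norm_smul, Complex.norm_real, Real.norm_of_nonneg hν.le]
    exact mul_le_mul_of_nonneg_right (hA.nu_le hM hω hn) (norm_nonneg _)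

theorem re_inner_coeffOp (hA : IsElliptic ω M ν A) (hω : IsA2Weight ω) (t : ℝ) (x : Rn n)
    (ξ : Cn n) : ν * ‖ξ‖ ^ 2 ≤ (inner ℂ ξ (coeffOp ω ν A t x ξ)).re := by
  unfold coeffOp
  split_ifs
  · exact hA.re_inner_rescaledOp (hω.pos x) ξ
  · rw [smul_apply, inner_smul_right, Complex.re_ofReal_mul,
      ContinuousLinearMap.id_apply]
    exact le_of_eq (congrArg _ (inner_self_eq_norm_sq (𝕜 := ℂ) ξ).symm)

theorem IsElliptic.ae_measurable_slice (hA : IsElliptic ω M ν A) :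
    ∀ᵐ t, ∀ i j, AEMeasurable (fun x => A t x i j) volume := by
  rw [ae_all_iff]; intro i
  rw [ae_all_iff]; intro j
  have h1 : AEStronglyMeasurable (fun p : ℝ × Rn n => A p.1 p.2 i j) (volume.prod volume) :=
    (hA.measurable i j).aestronglyMeasurable
  filter_upwards [h1.prodMk_left] with t ht
  exact ht.aemeasurable

theorem isMultiplier_coeffOp (hA : IsElliptic ω M ν A) (hM : 0 < M) (hν : 0 < ν)
    (hω : IsA2Weight ω) (hn : 1 ≤ n) (t : ℝ) :
    IsMultiplier (wMeasure ω) (coeffOp ω ν A t) M := by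
  refine isMultiplier_of_inner (fun v w => ?_) (norm_coeffOp_le hA hM hν hω hn t)
  by_cases ht : ∀ i j, AEMeasurable (fun x => A t x i j) volume
  · simp only [coeffOp, if_pos ht, inner_rescaledOp, dotProduct, Matrix.mulVec]
    refine (AEMeasurable.aestronglyMeasurable ?_).mono_ac wMeasure_ac
    have h0 : AEMeasurable (fun x => ((ω x)⁻¹ : ℂ)) volume :=
      (Complex.measurable_ofReal.comp_aemeasurable hω.measurable).inv
    refine h0.mul (Finset.aemeasurable_fun_sum _ fun i _ => AEMeasurable.mul_const ?_ _)
    exact Finset.aemeasurable_fun_sum _ fun j _ => (ht i j).mul_const _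
  · simp only [coeffOp, if_neg ht]
    exact aestronglyMeasurable_const

theorem isMultiplier_coeffOp_prod (hA : IsElliptic ω M ν A) (hM : 0 < M) (hν : 0 < ν)
    (hω : IsA2Weight ω) (hn : 1 ≤ n) :
    IsMultiplier ((volume : Measure ℝ).prod (wMeasure ω))
      (fun p : ℝ × Rn n => coeffOp ω ν A p.1 p.2) M := by
  refine isMultiplier_of_inner (fun v w => ?_) (fun p => norm_coeffOp_le hA hM hν hω hn p.1 p.2)
  have h1 : AEMeasurable (fun p : ℝ × Rn n => inner ℂ v (rescaledOp ω A p.1 p.2 w))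
      ((volume : Measure ℝ).prod (wMeasure ω)) := by
    refine AEMeasurable.mono_ac ?_ (Measure.AbsolutelyContinuous.rfl.prod wMeasure_ac)
    simp only [inner_rescaledOp, dotProduct, Matrix.mulVec]
    have h0 : AEMeasurable (fun p : ℝ × Rn n => ((ω p.2)⁻¹ : ℂ))
        ((volume : Measure ℝ).prod volume) :=
      (Complex.measurable_ofReal.comp_aemeasurable hω.measurable).inv.comp_snd
    refine h0.mul (Finset.aemeasurable_fun_sum _ fun i _ => AEMeasurable.mul_const ?_ _)
    exact Finset.aemeasurable_fun_sum _ fun j _ => (hA.measurable i j).mul_const _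
  refine h1.aestronglyMeasurable.congr ?_
  have h2 : ∀ᵐ p ∂((volume : Measure ℝ).prod (wMeasure ω)),
      ∀ i j, AEMeasurable (fun x => A p.1 x i j) volume :=
    Measure.quasiMeasurePreserving_fst.ae hA.ae_measurable_slice
  filter_upwards [h2] with p hp
  simp only [coeffOp, if_pos hp]

/-- Multiplication by `ω⁻¹A(t,·)` on `L²_ωⁿ`. -/
def coeffLp (hA : IsElliptic ω M ν A) (hM : 0 < M) (hν : 0 < ν)
    (hω : IsA2Weight ω) (hn : 1 ≤ n) (t : ℝ) : L2wVec ω →L[ℂ] L2wVec ω :=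
  opLp (isMultiplier_coeffOp hA hM hν hω hn t)

theorem isEvolution_energy (hA : IsElliptic ω M ν A) (hM : 0 < M) (hν : 0 < ν)
    (hω : IsA2Weight ω) (hn : 1 ≤ n) :
    IsEvolution (energyJ hω) (energyD hω) (coeffLp hA hM hν hω hn) M ν where
  norm_sq := energy_norm_sq hω
  pos := hν
  mult := by
    refine isMultiplier_of_inner (fun v w => ?_) fun t => ?_
    -- Weak measurability in time comes from joint measurability, the pairing being a partial
    -- integral over space.
    · have h1 := (isMultiplier_coeffOp_prod hA hM hν hω hn).meas (fun p => w p.2)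
        (Lp.memLp w).1.comp_snd
      have h2 := ((Lp.memLp v).1.comp_snd (μ := (volume : Measure ℝ))).inner (𝕜 := ℂ) h1
      refine h2.integral_prod_right'.congr (Eventually.of_forall fun t => ?_)
      simp only [L2.inner_def]
      refine integral_congr_ae ?_
      filter_upwards [coeFn_opLp (isMultiplier_coeffOp hA hM hν hω hn t) w] with x hx
      rw [coeffLp, hx]
    · exact ContinuousLinearMap.opNorm_le_bound _ hM.le (norm_opLp_apply_le _)
  lower := fun t g => by
    rw [lp_norm_sq, L2.inner_def, ← integral_const_mul]
    have h1 := L2.integrable_inner (𝕜 := ℂ) g (coeffLp hA hM hν hω hn t g)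
    have h2 : (∫ a, inner ℂ (g a) (coeffLp hA hM hν hω hn t g a) ∂(wMeasure ω)).re =
        ∫ a, (inner ℂ (g a) (coeffLp hA hM hν hω hn t g a)).re ∂(wMeasure ω) :=
      (integral_re h1).symm
    rw [h2]
    refine integral_mono_ae ((integrable_norm_sq g).const_mul ν) h1.re ?_
    filter_upwards [coeFn_opLp (isMultiplier_coeffOp hA hM hν hω hn t) g] with x hx
    simp only [coeffLp, hx]
    exact re_inner_coeffOp hA hω t x (g x)

end Coefficients

/-! ### Exponential weights and the perturbed ellipticity estimate. -/

section ExpWeight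

/-- The gradient of a real function, as a vector of `ℂⁿ`. -/
def cgrad (m : Rn n → ℝ) (x : Rn n) : Cn n :=
  WithLp.toLp 2 fun i => ((fderiv ℝ m x (EuclideanSpace.single i 1) : ℝ) : ℂ)

/-- The differential applied to the gradient vector itself gives its squared norm. -/
theorem norm_cgrad_le (m : Rn n → ℝ) (x : Rn n) : ‖cgrad m x‖ ≤ ‖fderiv ℝ m x‖ := by
  let g : Rn n := WithLp.toLp 2 fun i => fderiv ℝ m x (EuclideanSpace.single i 1)
  have h1 : ‖cgrad m x‖ = ‖g‖ := by simp [EuclideanSpace.norm_eq, cgrad, g]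
  have h2 : g = ∑ i, (fderiv ℝ m x (EuclideanSpace.single i 1)) •
      (EuclideanSpace.single i (1 : ℝ) : Rn n) := by
    ext j
    simp [g, Pi.single_apply]
  have h3 : fderiv ℝ m x g = ‖g‖ ^ 2 := by
    rw [EuclideanSpace.norm_sq_eq]
    nth_rw 1 [h2]
    simp [g, sq]
  have h4 := (fderiv ℝ m x).le_opNorm g
  rw [h3, Real.norm_of_nonneg (by positivity), sq] at h4
  rw [h1]
  rcases eq_or_lt_of_le (norm_nonneg g) with h0 | h0
  · rw [← h0]; positivity
  · exact le_of_mul_le_mul_right h4 h0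

/-- Bounded smooth functions with gradient bounded by `ρ`. -/
structure IsExpWeight (h : Rn n → ℝ) (ρ K : ℝ) : Prop where
  smooth : ContDiff ℝ ((⊤ : ℕ∞) : WithTop ℕ∞) h
  bdd : ∀ x, |h x| ≤ K
  grad_le : ∀ x, ‖fderiv ℝ h x‖ ≤ ρ

variable {h : Rn n → ℝ} {ρ K : ℝ}

theorem isMultiplier_exp (ω : Rn n → ℝ) (hh : IsExpWeight h ρ K) (F : Type*)
    [NormedAddCommGroup F] [InnerProductSpace ℂ F] (s : ℝ) :
    IsMultiplier (wMeasure ω)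
      (fun x => ((Real.exp (s * h x) : ℝ) : ℂ) • ContinuousLinearMap.id ℂ F)
      (Real.exp (|s| * K)) := by
  refine isMultiplier_smul ?_ fun x => ?_
  · have := hh.smooth.continuous
    exact (by fun_prop : Continuous fun x => Real.exp (s * h x)).aestronglyMeasurable
  · rw [abs_of_pos (Real.exp_pos _)]
    refine Real.exp_le_exp.2 ((le_abs_self _).trans ?_)
    rw [abs_mul]
    exact mul_le_mul_of_nonneg_left (hh.bdd x) (abs_nonneg s)

/-- Multiplication by `e^{sh}` on `L²_ω`. -/
def expMul (hh : IsExpWeight h ρ K) (ω : Rn n → ℝ) (F : Type*)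
    [NormedAddCommGroup F] [InnerProductSpace ℂ F] (s : ℝ) :
    Lp F 2 (wMeasure ω) →L[ℂ] Lp F 2 (wMeasure ω) := opLp (isMultiplier_exp ω hh F s)

theorem coeFn_expMul (hh : IsExpWeight h ρ K) {F : Type*}
    [NormedAddCommGroup F] [InnerProductSpace ℂ F] (s : ℝ) (f : Lp F 2 (wMeasure ω)) :
    ∀ᵐ x ∂(wMeasure ω), expMul hh ω F s f x = ((Real.exp (s * h x) : ℝ) : ℂ) • f x :=
  coeFn_opLp (isMultiplier_exp ω hh F s) f

theorem IsExpWeight.continuous_cgrad (hh : IsExpWeight h ρ K) : Continuous (cgrad h) := by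
  refine (PiLp.continuous_toLp 2 _).comp (continuous_pi fun i => ?_)
  exact Complex.continuous_ofReal.comp
    ((hh.smooth.continuous_fderiv (by simp)).clm_apply continuous_const)

theorem isMultiplier_gradExp (ω : Rn n → ℝ) (hh : IsExpWeight h ρ K) :
    IsMultiplier (wMeasure ω) (fun x => ContinuousLinearMap.toSpanSingleton ℂ
      (((2 * Real.exp (2 * h x) : ℝ) : ℂ) • cgrad h x)) (2 * Real.exp (2 * K) * ρ) := by
  refine ⟨fun Y hY => ?_, fun x => ?_⟩
  · have h1 := hh.continuous_cgrad
    have h2 := hh.smooth.continuous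
    have h3 : Continuous fun x => ((2 * Real.exp (2 * h x) : ℝ) : ℂ) • cgrad h x :=
      (Complex.continuous_ofReal.comp (by fun_prop)).smul h1
    exact hY.smul h3.aestronglyMeasurable
  · rw [ContinuousLinearMap.norm_toSpanSingleton, norm_smul, Complex.norm_real,
      Real.norm_of_nonneg (by positivity)]
    have h1 : Real.exp (2 * h x) ≤ Real.exp (2 * K) :=
      Real.exp_le_exp.2 (by linarith [le_abs_self (h x), hh.bdd x])
    have h2 := (norm_cgrad_le h x).trans (hh.grad_le x)
    gcongr

/-- Multiplication by the gradient of `e^{2h}`. -/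
def gradExpMul (hh : IsExpWeight h ρ K) (ω : Rn n → ℝ) : L2w ω →L[ℂ] L2wVec ω :=
  opLp (isMultiplier_gradExp ω hh)

theorem coeFn_gradExpMul (hh : IsExpWeight h ρ K) (f : L2w ω) :
    ∀ᵐ x ∂(wMeasure ω), gradExpMul hh ω f x =
      f x • (((2 * Real.exp (2 * h x) : ℝ) : ℂ) • cgrad h x) :=
  coeFn_opLp (isMultiplier_gradExp ω hh) f

/-- Leibniz rule by duality: `e^{2h}φ` is again a test function, and the weak gradient identity of
`f` is applied to it. -/
theorem hasWeakGrad_expMul (hω : IsA2Weight ω) (hh : IsExpWeight h ρ K) {f : L2w ω}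
    {g : L2wVec ω} (hfg : HasWeakGrad ω f g) :
    HasWeakGrad ω (expMul hh ω ℂ 2 f) (expMul hh ω (Cn n) 2 g + gradExpMul hh ω f) := by
  intro φ hφ i
  let m : Rn n → ℂ := fun x => ((Real.exp (2 * h x) : ℝ) : ℂ)
  let dh : Rn n → ℂ := fun x => ((fderiv ℝ h x (EuclideanSpace.single i 1) : ℝ) : ℂ)
  have hmR : ContDiff ℝ ((⊤ : ℕ∞) : WithTop ℕ∞) fun x => Real.exp (2 * h x) :=
    Real.contDiff_exp.comp (contDiff_const.mul hh.smooth)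
  have hm : ContDiff ℝ ((⊤ : ℕ∞) : WithTop ℕ∞) m := Complex.ofRealCLM.contDiff.comp hmR
  have hdh : Continuous dh := Complex.continuous_ofReal.comp
    ((hh.smooth.continuous_fderiv (by simp)).clm_apply continuous_const)
  have htest : IsTest (fun x => m x * φ x) := ⟨hm.mul hφ.1, hφ.2.mul_left⟩
  have hgrad : ∀ x, grad (fun x => m x * φ x) x i =
      m x * grad φ x i + (2 * m x * dh x) * φ x := fun x => by
    have e1 : HasFDerivAt h (fderiv ℝ h x) x :=
      (hh.smooth.differentiable (by simp) x).hasFDerivAt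
    have e2 : HasFDerivAt (fun x => Real.exp (2 * h x))
        (Real.exp (2 * h x) • ((2 : ℝ) • fderiv ℝ h x)) x := (e1.const_mul 2).exp
    have e3 : HasFDerivAt m (Complex.ofRealCLM ∘L
        (Real.exp (2 * h x) • ((2 : ℝ) • fderiv ℝ h x))) x :=
      Complex.ofRealCLM.hasFDerivAt.comp x e2
    have e4 : HasFDerivAt (fun x => m x * φ x) _ x := e3.mul (hφ.1.differentiable (by simp) x).hasFDerivAt
    simp only [grad]
    rw [e4.fderiv]
    simp [m, dh]
    ring
  have h1 := hfg _ htest i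
  simp only [hgrad] at h1
  have c1 : Continuous fun x => m x * grad φ x i := hm.continuous.mul (hφ.continuous_grad i)
  have s1 : HasCompactSupport fun x => m x * grad φ x i := (hφ.hasCompactSupport_grad i).mul_left
  have c2 : Continuous fun x => (2 * m x * dh x) * φ x :=
    ((continuous_const.mul hm.continuous).mul hdh).mul hφ.continuous
  have s2 : HasCompactSupport fun x => (2 * m x * dh x) * φ x := hφ.2.mul_left
  have c3 : Continuous fun x => m x * φ x := htest.continuous
  have i1 := integrable_mul_test hω c1 s1 f
  have i2 := integrable_mul_test hω c2 s2 f
  have i3 : Integrable (fun x => g x i * (m x * φ x)) volume := by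
    refine (integrable_mul_test hω c3 htest.2 (compL2w i g)).congr ?_
    filter_upwards [hω.ac (coeFn_compL2w i g)] with x hx
    rw [hx]
  simp only [mul_add] at h1
  rw [integral_add i1 i2] at h1
  have e5 : ∫ x, expMul hh ω ℂ 2 f x * grad φ x i = ∫ x, f x * (m x * grad φ x i) := by
    refine integral_congr_ae ?_
    filter_upwards [hω.ac (coeFn_expMul hh 2 f)] with x hx
    rw [hx, smul_eq_mul]
    ring
  have e6 : ∫ x, (expMul hh ω (Cn n) 2 g + gradExpMul hh ω f : L2wVec ω) x i * φ x =
      ∫ x, (g x i * (m x * φ x) + f x * ((2 * m x * dh x) * φ x)) := by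
    refine integral_congr_ae ?_
    filter_upwards [hω.ac (coeFn_expMul hh 2 g), hω.ac (coeFn_gradExpMul hh f),
      hω.ac (Lp.coeFn_add (expMul hh ω (Cn n) 2 g) (gradExpMul hh ω f))] with x h2 h3 h4
    rw [h4, Pi.add_apply, h2, h3]
    simp [m, dh, cgrad]
    ring
  rw [e5, e6, integral_add i3 i2]
  linear_combination h1

/-- Multiplication by `e^{2h}` on `H¹_ω`. -/
def energyExpMul (hω : IsA2Weight ω) (hh : IsExpWeight h ρ K) :
    energySpace hω →L[ℂ] energySpace hω :=
  ContinuousLinearMap.codRestrict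
    ((WithLp.prodContinuousLinearEquiv 2 ℂ (L2w ω) (L2wVec ω)).symm.toContinuousLinearMap ∘L
      ((expMul hh ω ℂ 2 ∘L energyJ hω).prod
        (expMul hh ω (Cn n) 2 ∘L energyD hω + gradExpMul hh ω ∘L energyJ hω)))
    (energySpace hω) (fun v => hasWeakGrad_expMul hω hh (energy_hasWeakGrad hω v))

theorem energyJ_energyExpMul (hω : IsA2Weight ω) (hh : IsExpWeight h ρ K) (v : energySpace hω) :
    energyJ hω (energyExpMul hω hh v) = expMul hh ω ℂ 2 (energyJ hω v) := rfl

theorem energyD_energyExpMul (hω : IsA2Weight ω) (hh : IsExpWeight h ρ K) (v : energySpace hω) :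
    energyD hω (energyExpMul hω hh v) =
      expMul hh ω (Cn n) 2 (energyD hω v) + gradExpMul hh ω (energyJ hω v) := rfl

/-- The cross term is at most `2Mρ|z||ξ|`, and completing the square against `ν|ξ|²` leaves exactly
`M²ρ²|z|²/ν`. This fixes the constant `κ = M²/ν` of the final estimate. -/
theorem re_inner_weighted_ge {T : Cn n →L[ℂ] Cn n} {M ν : ℝ} (hν : 0 < ν) (hT : ‖T‖ ≤ M)
    {ξ c : Cn n} (hlow : ν * ‖ξ‖ ^ 2 ≤ (inner ℂ ξ (T ξ)).re) (hc : ‖c‖ ≤ ρ) (z : ℂ) :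
    -(M ^ 2 / ν * ρ ^ 2 * ‖z‖ ^ 2) ≤ (inner ℂ (ξ + z • ((2 : ℂ) • c)) (T ξ)).re := by
  have h1 : ‖inner ℂ (z • ((2 : ℂ) • c)) (T ξ)‖ ≤ 2 * (M * ρ) * ‖z‖ * ‖ξ‖ := by
    refine (norm_inner_le_norm _ _).trans ?_
    rw [norm_smul, norm_smul]
    have h2 := T.le_of_opNorm_le hT ξ
    have h0 : 0 ≤ M := (norm_nonneg _).trans hT
    calc ‖z‖ * (‖(2 : ℂ)‖ * ‖c‖) * ‖T ξ‖ ≤ ‖z‖ * (2 * ρ) * (M * ‖ξ‖) := by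
          have : ‖(2 : ℂ)‖ = 2 := by simp
          rw [this]
          have hρ : 0 ≤ ρ := (norm_nonneg _).trans hc
          gcongr
      _ = _ := by ring
  have h2 := (abs_le.1 (Complex.abs_re_le_norm (inner ℂ (z • ((2 : ℂ) • c)) (T ξ)))).1
  rw [inner_add_left, Complex.add_re]
  have h3 : 0 ≤ ν * (‖ξ‖ - M * ρ * ‖z‖ / ν) ^ 2 := by positivity
  have h4 : ν * (‖ξ‖ - M * ρ * ‖z‖ / ν) ^ 2 =
      ν * ‖ξ‖ ^ 2 - 2 * (M * ρ) * ‖z‖ * ‖ξ‖ + M ^ 2 / ν * ρ ^ 2 * ‖z‖ ^ 2 := by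
    field_simp
    ring
  linarith

/-- Since `∇(e^{2h}v) = e^{2h}(∇v + 2v∇h)`, the pointwise inequality is multiplied by `e^{2h}` and
integrated in space. -/
theorem isWeight_exp {M ν : ℝ} {A : ℝ → Rn n → Matrix (Fin n) (Fin n) ℂ}
    (hA : IsElliptic ω M ν A) (hM : 0 < M) (hν : 0 < ν) (hω : IsA2Weight ω) (hn : 1 ≤ n)
    (hh : IsExpWeight h ρ K) :
    IsWeight (energyJ hω) (energyD hω) (coeffLp hA hM hν hω hn) (expMul hh ω ℂ 1)
      (energyExpMul hω hh) (M ^ 2 / ν * ρ ^ 2) where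
  symm := fun v x => by
    rw [energyJ_energyExpMul, L2.inner_def, L2.inner_def]
    refine integral_congr_ae ?_
    filter_upwards [coeFn_expMul hh 2 (energyJ hω v), coeFn_expMul hh 1 (energyJ hω v),
      coeFn_expMul hh 1 x] with y h1 h2 h3
    rw [h1, h2, h3, inner_smul_left, inner_smul_left, inner_smul_right, Complex.conj_ofReal,
      Complex.conj_ofReal, ← mul_assoc, ← Complex.ofReal_mul, ← Real.exp_add]
    ring_nf
  nonneg := by positivity
  lower := fun t v => by
    set f := energyJ hω v
    set g := energyD hω v
    rw [energyD_energyExpMul, lp_norm_sq, L2.inner_def, ← integral_const_mul, ← integral_neg]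
    have h1 := L2.integrable_inner (𝕜 := ℂ) (expMul hh ω (Cn n) 2 g + gradExpMul hh ω f)
      (coeffLp hA hM hν hω hn t g)
    have h2 : (∫ a, inner ℂ ((expMul hh ω (Cn n) 2 g + gradExpMul hh ω f : L2wVec ω) a)
          (coeffLp hA hM hν hω hn t g a) ∂(wMeasure ω)).re =
        ∫ a, (inner ℂ ((expMul hh ω (Cn n) 2 g + gradExpMul hh ω f : L2wVec ω) a)
          (coeffLp hA hM hν hω hn t g a)).re ∂(wMeasure ω) :=
      (integral_re h1).symm
    rw [h2]
    refine integral_mono_ae ((integrable_norm_sq (expMul hh ω ℂ 1 f)).const_mul _).neg h1.re ?_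
    filter_upwards [coeFn_opLp (isMultiplier_coeffOp hA hM hν hω hn t) g,
      coeFn_expMul hh 1 f, coeFn_expMul hh 2 g, coeFn_gradExpMul hh f,
      Lp.coeFn_add (expMul hh ω (Cn n) 2 g) (gradExpMul hh ω f)] with x e1 e2 e3 e4 e5
    have e6 := re_inner_weighted_ge hν (norm_coeffOp_le hA hM hν hω hn t x)
      (re_inner_coeffOp hA hω t x (g x)) ((norm_cgrad_le h x).trans (hh.grad_le x)) (f x)
    have e7 : (expMul hh ω (Cn n) 2 g + gradExpMul hh ω f : L2wVec ω) x =
        ((Real.exp (2 * h x) : ℝ) : ℂ) • (g x + f x • ((2 : ℂ) • cgrad h x)) := by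
      rw [e5, Pi.add_apply, e3, e4, smul_add, smul_smul, smul_smul, smul_smul]
      congr 2
      push_cast
      ring
    rw [e7, coeffLp, e1, e2, inner_smul_left, Complex.conj_ofReal, Complex.re_ofReal_mul,
      norm_smul, Complex.norm_real, Real.norm_of_nonneg (Real.exp_pos _).le]
    have e8 : Real.exp (1 * h x) ^ 2 = Real.exp (2 * h x) := by
      rw [← Real.exp_nat_mul]; ring_nf
    rw [mul_pow, e8]
    have e9 := mul_le_mul_of_nonneg_left e6 (Real.exp_pos (2 * h x)).le
    refine le_trans (le_of_eq ?_) e9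
    ring

end ExpWeight

/-! ### Space-time test functions as `H¹_ω`-valued functions of time. -/

section SpaceTimeTest

theorem IsA2Weight.memLp_of_hasCompactSupport (hω : IsA2Weight ω) {F : Type*}
    [NormedAddCommGroup F] {ψ : Rn n → F} (hc : Continuous ψ) (hs : HasCompactSupport ψ) :
    MemLp ψ 2 (wMeasure ω) := by
  have := hω.isLocallyFiniteMeasure
  exact hc.memLp_of_hasCompactSupport hs

theorem IsA2Weight.norm_lp_le (hω : IsA2Weight ω) {F : Type*} [NormedAddCommGroup F]
    [InnerProductSpace ℂ F] [CompleteSpace F] {S : Set (Rn n)} (hS : IsCompact S) {C : ℝ}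
    (f : Lp F 2 (wMeasure ω)) (hC : ∀ᵐ x ∂(wMeasure ω), ‖f x‖ ≤ C)
    (hS0 : ∀ᵐ x ∂(wMeasure ω), x ∉ S → f x = 0) (hC0 : 0 ≤ C) :
    ‖f‖ ≤ C * Real.sqrt ((wMeasure ω).real S) := by
  have := hω.isLocallyFiniteMeasure
  refine le_of_sq_le_sq ?_ (by positivity)
  rw [lp_norm_sq, mul_pow, Real.sq_sqrt measureReal_nonneg]
  have h1 : ∫ x, ‖f x‖ ^ 2 ∂(wMeasure ω) ≤ ∫ x, S.indicator (fun _ => C ^ 2) x ∂(wMeasure ω) := by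
    refine integral_mono_ae (integrable_norm_sq f) ?_ ?_
    · exact (integrable_indicator_iff hS.measurableSet).2
        (integrableOn_const hS.measure_lt_top.ne)
    · filter_upwards [hC, hS0] with x h1 h2
      by_cases hx : x ∈ S
      · simp only [Set.indicator_of_mem hx]; gcongr
      · simp [h2 hx, hx]
  refine h1.trans (le_of_eq ?_)
  rw [integral_indicator hS.measurableSet, setIntegral_const, smul_eq_mul, mul_comm]

theorem aestronglyMeasurable_slice {F : Type*} [NormedAddCommGroup F]
    [InnerProductSpace ℂ F] [CompleteSpace F] [SecondCountableTopology F] {Ψ : ℝ × Rn n → F}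
    (hΨ : Continuous Ψ) {w : ℝ → Lp F 2 (wMeasure ω)}
    (hw : ∀ t, w t =ᵐ[wMeasure ω] fun x => Ψ (t, x)) : AEStronglyMeasurable w volume := by
  refine aestronglyMeasurable_of_inner fun v => ?_
  have h1 : AEStronglyMeasurable (fun p : ℝ × Rn n => inner ℂ (v p.2) (Ψ p))
      ((volume : Measure ℝ).prod (wMeasure ω)) :=
    (Lp.memLp v).1.comp_snd.inner hΨ.aestronglyMeasurable
  refine h1.integral_prod_right'.congr (Eventually.of_forall fun t => ?_)
  simp only [L2.inner_def]
  refine integral_congr_ae ?_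
  filter_upwards [hw t] with x hx
  rw [hx]

/-- The gradient of a complex function as a vector of `ℂⁿ`. -/
def gradVec (φ : Rn n → ℂ) (x : Rn n) : Cn n := WithLp.toLp 2 (grad φ x)

theorem IsTest.continuous_gradVec {φ : Rn n → ℂ} (hφ : IsTest φ) : Continuous (gradVec φ) :=
  (PiLp.continuous_toLp 2 _).comp (continuous_pi fun i => hφ.continuous_grad i)

theorem IsTest.hasCompactSupport_gradVec {φ : Rn n → ℂ} (hφ : IsTest φ) :
    HasCompactSupport (gradVec φ) :=
  (hφ.2.fderiv (𝕜 := ℝ)).comp_left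
    (g := fun L : Rn n →L[ℝ] ℂ =>
      (WithLp.toLp 2 fun i => L (EuclideanSpace.single i 1) : Cn n)) (by ext i; simp)

/-- The class of a test function in `L²_ω`. -/
def testClass (hω : IsA2Weight ω) {ψ : Rn n → ℂ} (hψ : IsTest ψ) : L2w ω :=
  (hω.memLp_of_hasCompactSupport hψ.continuous hψ.2).toLp ψ

/-- The class of the gradient of a test function. -/
def testGradClass (hω : IsA2Weight ω) {ψ : Rn n → ℂ} (hψ : IsTest ψ) : L2wVec ω :=
  (hω.memLp_of_hasCompactSupport hψ.continuous_gradVec hψ.hasCompactSupport_gradVec).toLp _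

theorem coeFn_testClass (hω : IsA2Weight ω) {ψ : Rn n → ℂ} (hψ : IsTest ψ) :
    testClass hω hψ =ᵐ[wMeasure ω] ψ := MemLp.coeFn_toLp _

theorem coeFn_testGradClass (hω : IsA2Weight ω) {ψ : Rn n → ℂ} (hψ : IsTest ψ) :
    testGradClass hω hψ =ᵐ[wMeasure ω] gradVec ψ := MemLp.coeFn_toLp _

theorem hasWeakGrad_testClass (hω : IsA2Weight ω) {ψ : Rn n → ℂ} (hψ : IsTest ψ) :
    HasWeakGrad ω (testClass hω hψ) (testGradClass hω hψ) := by
  intro φ hφ i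
  have h1 : ∫ x, testClass hω hψ x * grad φ x i = ∫ x, ψ x * grad φ x i := by
    refine integral_congr_ae ?_
    filter_upwards [hω.ac (coeFn_testClass hω hψ)] with x hx
    rw [hx]
  have h2 : ∫ x, testGradClass hω hψ x i * φ x = ∫ x, grad ψ x i * φ x := by
    refine integral_congr_ae ?_
    filter_upwards [hω.ac (coeFn_testGradClass hω hψ)] with x hx
    rw [hx, gradVec]
  rw [h1, h2]
  refine integral_mul_fderiv_eq_neg_fderiv_mul_of_integrable ?_ ?_ ?_
    (fun x _ => hψ.1.differentiable (by simp) x) (fun x _ => hφ.1.differentiable (by simp) x)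
  · exact ((hψ.continuous_grad i).mul hφ.continuous).integrable_of_hasCompactSupport hφ.2.mul_left
  · exact (hψ.continuous.mul (hφ.continuous_grad i)).integrable_of_hasCompactSupport hψ.2.mul_right
  · exact (hψ.continuous.mul hφ.continuous).integrable_of_hasCompactSupport hψ.2.mul_right

variable {Φ : ℝ × Rn n → ℂ}

theorem IsTest.slice (hΦ : IsTest Φ) (t : ℝ) : IsTest fun x => Φ (t, x) := by
  refine ⟨hΦ.1.comp (contDiff_const.prodMk contDiff_id), ?_⟩
  refine HasCompactSupport.intro (hΦ.2.isCompact.image continuous_snd) fun x hx => ?_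
  by_contra h
  exact hx ⟨(t, x), subset_tsupport _ h, rfl⟩

/-- The time derivative of a space-time function. -/
def timeDeriv (Φ : ℝ × Rn n → ℂ) (p : ℝ × Rn n) : ℂ := fderiv ℝ Φ p (1, 0)

theorem IsTest.timeDeriv (hΦ : IsTest Φ) : IsTest (timeDeriv Φ) := by
  refine ⟨(hΦ.1.fderiv_right (m := ((⊤ : ℕ∞) : WithTop ℕ∞)) (by simp)).clm_apply contDiff_const, ?_⟩
  exact (hΦ.2.fderiv (𝕜 := ℝ)).comp_left (g := fun L : (ℝ × Rn n) →L[ℝ] ℂ => L (1, 0)) rfl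

theorem IsTest.hasDerivAt_time (hΦ : IsTest Φ) (t : ℝ) (x : Rn n) :
    HasDerivAt (fun τ => Φ (τ, x)) (DegParabolic.timeDeriv Φ (t, x)) t := by
  have h1 : HasFDerivAt Φ (fderiv ℝ Φ (t, x)) (t, x) :=
    (hΦ.1.differentiable (by simp) (t, x)).hasFDerivAt
  have h2 : HasDerivAt (fun τ : ℝ => (τ, x)) ((1 : ℝ), (0 : Rn n)) t :=
    (hasDerivAt_id t).prodMk (hasDerivAt_const t x)
  exact h1.comp_hasDerivAt t h2

theorem IsTest.grad_slice (hΦ : IsTest Φ) (t : ℝ) (x : Rn n) (i : Fin n) :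
    grad (fun y => Φ (t, y)) x i = fderiv ℝ Φ (t, x) (0, EuclideanSpace.single i 1) := by
  have h1 : HasFDerivAt Φ (fderiv ℝ Φ (t, x)) (t, x) :=
    (hΦ.1.differentiable (by simp) (t, x)).hasFDerivAt
  have h2 : HasFDerivAt (fun y : Rn n => (t, y)) (ContinuousLinearMap.inr ℝ ℝ (Rn n)) x :=
    (hasFDerivAt_const t x).prodMk (hasFDerivAt_id x)
  have h3 := h1.comp x h2
  rw [grad]
  change fderiv ℝ (Φ ∘ fun y => (t, y)) x _ = _
  rw [h3.fderiv]
  simp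

theorem IsTest.continuous_gradVec_slice (hΦ : IsTest Φ) :
    Continuous fun p : ℝ × Rn n => gradVec (fun y => Φ (p.1, y)) p.2 := by
  refine (PiLp.continuous_toLp 2 _).comp (continuous_pi fun i => ?_)
  simp only [hΦ.grad_slice]
  exact (hΦ.1.continuous_fderiv (by simp)).clm_apply continuous_const

/-- The time derivative is smooth with compact support, hence globally Lipschitz; the mean value
inequality then gives a remainder uniform in `t` and `x`. -/
theorem IsTest.exists_taylor (hΦ : IsTest Φ) : ∃ L : ℝ, 0 ≤ L ∧ ∀ (t τ : ℝ) (x : Rn n), 0 < τ →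
    ‖Φ (t + τ, x) - Φ (t, x) - (τ : ℂ) * DegParabolic.timeDeriv Φ (t, x)‖ ≤ L * τ ^ 2 := by
  obtain ⟨L, hL⟩ := (hΦ.timeDeriv.1.of_le (m := 1) (by exact_mod_cast le_top)).lipschitzWith_of_hasCompactSupport
    hΦ.timeDeriv.2 (by simp)
  refine ⟨L, L.coe_nonneg, fun t τ x hτ => ?_⟩
  let f : ℝ → ℂ := fun s => Φ (s, x) - (s : ℂ) * DegParabolic.timeDeriv Φ (t, x)
  have hf : ∀ s ∈ Set.Icc t (t + τ), HasDerivWithinAt f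
      (DegParabolic.timeDeriv Φ (s, x) - DegParabolic.timeDeriv Φ (t, x)) (Set.Icc t (t + τ)) s := by
    intro s _
    have h1 : HasDerivAt (fun s : ℝ => (s : ℂ)) 1 s := Complex.ofRealCLM.hasDerivAt
    have h2 := (hΦ.hasDerivAt_time s x).sub (h1.mul_const (DegParabolic.timeDeriv Φ (t, x)))
    rw [one_mul] at h2
    exact h2.hasDerivWithinAt
  have h3 := norm_image_sub_le_of_norm_deriv_le_segment' (C := L * τ) hf (fun s hs => by
    refine (hL.norm_sub_le _ _).trans ?_
    refine mul_le_mul_of_nonneg_left ?_ L.coe_nonneg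
    simp only [Prod.mk_sub_mk, sub_self, Prod.norm_def, norm_zero, Real.norm_eq_abs]
    rw [max_eq_left (abs_nonneg _), abs_of_nonneg (by linarith [hs.1])]
    linarith [hs.2]) (t + τ) ⟨by linarith, le_rfl⟩
  have h4 : f (t + τ) - f t = Φ (t + τ, x) - Φ (t, x) - (τ : ℂ) * DegParabolic.timeDeriv Φ (t, x) := by
    simp only [f]; push_cast; ring
  rw [h4] at h3
  refine h3.trans (le_of_eq (by ring))

/-- A space-time test function as a function of time with values in `H¹_ω`. -/
def energyTest (hω : IsA2Weight ω) (hΦ : IsTest Φ) (t : ℝ) : energySpace hω :=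
  energyMk hω (hasWeakGrad_testClass hω (hΦ.slice t))

theorem energyJ_energyTest (hω : IsA2Weight ω) (hΦ : IsTest Φ) (t : ℝ) :
    energyJ hω (energyTest hω hΦ t) = testClass hω (hΦ.slice t) := rfl

theorem energyD_energyTest (hω : IsA2Weight ω) (hΦ : IsTest Φ) (t : ℝ) :
    energyD hω (energyTest hω hΦ t) = testGradClass hω (hΦ.slice t) := rfl

instance (hω : IsA2Weight ω) : TopologicalSpace.SeparableSpace (energySpace hω) := by
  have : SecondCountableTopology (WithLp 2 (L2w ω × L2wVec ω)) :=
    (WithLp.prodContinuousLinearEquiv 2 ℂ (L2w ω) (L2wVec ω)).toHomeomorph.secondCountableTopology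
  infer_instance

theorem IsTest.exists_norm_le {X : Type*} [NormedAddCommGroup X] [NormedSpace ℝ X] {φ : X → ℂ}
    (hφ : IsTest φ) : ∃ C, 0 ≤ C ∧ ∀ x, ‖φ x‖ ≤ C := by
  obtain ⟨C, hC⟩ := hφ.continuous.bounded_above_of_compact_support hφ.2
  exact ⟨C, (norm_nonneg _).trans (hC 0), hC⟩

/-- All slices live in the compact projection `S` of the support, which has finite `ω`-measure.
Uniform pointwise bounds thus become `L²_ω` bounds. -/
theorem exists_isTimeTest (hω : IsA2Weight ω) (hΦ : IsTest Φ) :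
    ∃ R K, IsTimeTest (energyJ hω) (energyTest hω hΦ)
      (fun t => testClass hω (hΦ.timeDeriv.slice t)) R K := by
  let S : Set (Rn n) := Prod.snd '' tsupport Φ
  have hS : IsCompact S := hΦ.2.isCompact.image continuous_snd
  obtain ⟨R, hR⟩ := (hΦ.2.isCompact.image continuous_fst).isBounded.subset_closedBall (0 : ℝ)
  have hRt : ∀ t x, t ∉ Set.Icc (-R) R → (t, x) ∉ tsupport Φ := fun t x ht hm => by
    refine ht ?_
    have := hR ⟨(t, x), hm, rfl⟩
    rw [Metric.mem_closedBall, dist_zero_right, Real.norm_eq_abs, abs_le] at this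
    exact this
  have hSx : ∀ t x, x ∉ S → (t, x) ∉ tsupport Φ := fun t x hx hm => hx ⟨(t, x), hm, rfl⟩
  have z0 : ∀ p, p ∉ tsupport Φ → Φ p = 0 := fun p hp => image_eq_zero_of_notMem_tsupport hp
  have zf : ∀ p, p ∉ tsupport Φ → fderiv ℝ Φ p = 0 := fun p hp => by
    by_contra h
    exact hp (support_fderiv_subset ℝ h)
  have z1 : ∀ p, p ∉ tsupport Φ → timeDeriv Φ p = 0 := fun p hp => by
    rw [timeDeriv, zf p hp]; rfl
  have z2 : ∀ t x, (t, x) ∉ tsupport Φ → gradVec (fun y => Φ (t, y)) x = 0 := fun t x hp => by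
    ext i
    rw [gradVec]
    change grad (fun y => Φ (t, y)) x i = 0
    rw [hΦ.grad_slice, zf _ hp]; rfl
  obtain ⟨C₀, hC₀, b0⟩ := hΦ.exists_norm_le
  obtain ⟨C₁, hC₁, b1⟩ := hΦ.timeDeriv.exists_norm_le
  obtain ⟨C₂, b2⟩ := hΦ.continuous_gradVec_slice.bounded_above_of_compact_support
    (HasCompactSupport.intro hΦ.2.isCompact fun p hp => z2 p.1 p.2 hp)
  have hC₂ : 0 ≤ C₂ := (norm_nonneg _).trans (b2 0)
  obtain ⟨L, hL0, hL⟩ := hΦ.exists_taylor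
  set μS := Real.sqrt ((wMeasure ω).real S)
  have hμS : 0 ≤ μS := Real.sqrt_nonneg _
  have n0 : ∀ t, ‖testClass hω (hΦ.slice t)‖ ≤ C₀ * μS := fun t => by
    refine hω.norm_lp_le hS _ ?_ ?_ hC₀
    · filter_upwards [coeFn_testClass hω (hΦ.slice t)] with x hx
      rw [hx]; exact b0 _
    · filter_upwards [coeFn_testClass hω (hΦ.slice t)] with x hx hxS
      rw [hx]; exact z0 _ (hSx t x hxS)
  have n1 : ∀ t, ‖testClass hω (hΦ.timeDeriv.slice t)‖ ≤ C₁ * μS := fun t => by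
    refine hω.norm_lp_le hS _ ?_ ?_ hC₁
    · filter_upwards [coeFn_testClass hω (hΦ.timeDeriv.slice t)] with x hx
      rw [hx]; exact b1 _
    · filter_upwards [coeFn_testClass hω (hΦ.timeDeriv.slice t)] with x hx hxS
      rw [hx]; exact z1 _ (hSx t x hxS)
  have n2 : ∀ t, ‖testGradClass hω (hΦ.slice t)‖ ≤ C₂ * μS := fun t => by
    refine hω.norm_lp_le hS _ ?_ ?_ hC₂
    · filter_upwards [coeFn_testGradClass hω (hΦ.slice t)] with x hx
      rw [hx]; exact b2 (t, x)
    · filter_upwards [coeFn_testGradClass hω (hΦ.slice t)] with x hx hxS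
      rw [hx]; exact z2 _ _ (hSx t x hxS)
  have mk0 : ∀ (f : L2w ω), f =ᵐ[wMeasure ω] (fun _ => (0 : ℂ)) → f = 0 := fun f hf =>
    (Lp.eq_zero_iff_ae_eq_zero).2 hf
  refine ⟨R, (C₀ + C₁ + C₂ + L) * μS, ?_, ?_, fun t => ?_, fun t => ?_, fun t ht => ?_,
    fun t ht => ?_, fun t τ hτ _ => ?_⟩
  · refine aestronglyMeasurable_of_inner fun v => ?_
    have e1 : AEStronglyMeasurable (fun t => testClass hω (hΦ.slice t)) volume :=
      aestronglyMeasurable_slice hΦ.continuous fun t => coeFn_testClass hω (hΦ.slice t)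
    have e2 : AEStronglyMeasurable (fun t => testGradClass hω (hΦ.slice t)) volume :=
      aestronglyMeasurable_slice hΦ.continuous_gradVec_slice
        fun t => coeFn_testGradClass hω (hΦ.slice t)
    have e3 := (e1.const_inner (𝕜 := ℂ) (c := energyJ hω v)).add
      (e2.const_inner (𝕜 := ℂ) (c := energyD hω v))
    exact e3
  · exact aestronglyMeasurable_slice hΦ.timeDeriv.continuous
      fun t => coeFn_testClass hω (hΦ.timeDeriv.slice t)
  · have e1 := energy_norm_sq hω (energyTest hω hΦ t)
    rw [energyJ_energyTest, energyD_energyTest] at e1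
    have e2 : ‖energyTest hω hΦ t‖ ≤ ‖testClass hω (hΦ.slice t)‖ + ‖testGradClass hω (hΦ.slice t)‖ := by
      refine le_of_sq_le_sq ?_ (by positivity)
      rw [e1]
      nlinarith [norm_nonneg (testClass hω (hΦ.slice t)), norm_nonneg (testGradClass hω (hΦ.slice t))]
    nlinarith [n0 t, n2 t, mul_nonneg hC₁ hμS, mul_nonneg hL0 hμS]
  · nlinarith [n1 t, mul_nonneg hC₀ hμS, mul_nonneg hC₂ hμS, mul_nonneg hL0 hμS]
  · have e1 := energy_norm_sq hω (energyTest hω hΦ t)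
    have e2 : energyJ hω (energyTest hω hΦ t) = 0 := mk0 _ (by
      filter_upwards [coeFn_testClass hω (hΦ.slice t)] with x hx
      rw [energyJ_energyTest, hx]; exact z0 _ (hRt t x ht))
    have e3 : energyD hω (energyTest hω hΦ t) = 0 := (Lp.eq_zero_iff_ae_eq_zero).2 (by
      filter_upwards [coeFn_testGradClass hω (hΦ.slice t)] with x hx
      rw [energyD_energyTest, hx]; exact z2 _ _ (hRt t x ht))
    rw [e2, e3] at e1
    simpa using e1
  · refine mk0 _ ?_
    filter_upwards [coeFn_testClass hω (hΦ.timeDeriv.slice t)] with x hx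
    rw [hx]; exact z1 _ (hRt t x ht)
  · have e1 : ∀ᵐ x ∂(wMeasure ω), (energyJ hω (energyTest hω hΦ (t + τ)) -
        energyJ hω (energyTest hω hΦ t) -
        (τ : ℂ) • testClass hω (hΦ.timeDeriv.slice t) : L2w ω) x =
        Φ (t + τ, x) - Φ (t, x) - (τ : ℂ) * timeDeriv Φ (t, x) := by
      filter_upwards [coeFn_testClass hω (hΦ.slice (t + τ)), coeFn_testClass hω (hΦ.slice t),
        coeFn_testClass hω (hΦ.timeDeriv.slice t),
        Lp.coeFn_sub (testClass hω (hΦ.slice (t + τ)) - testClass hω (hΦ.slice t))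
          ((τ : ℂ) • testClass hω (hΦ.timeDeriv.slice t)),
        Lp.coeFn_sub (testClass hω (hΦ.slice (t + τ))) (testClass hω (hΦ.slice t)),
        Lp.coeFn_smul (τ : ℂ) (testClass hω (hΦ.timeDeriv.slice t))] with x h1 h2 h3 h4 h5 h6
      rw [energyJ_energyTest, energyJ_energyTest, h4, Pi.sub_apply, h5, Pi.sub_apply, h6,
        Pi.smul_apply, h1, h2, h3, smul_eq_mul]
    refine (hω.norm_lp_le hS (C := L * τ ^ 2) _ ?_ ?_ (by positivity)).trans ?_
    · filter_upwards [e1] with x hx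
      rw [hx]; exact hL t τ x hτ
    · filter_upwards [e1] with x hx hxS
      rw [hx, z0 _ (hSx _ x hxS), z0 _ (hSx _ x hxS), z1 _ (hSx _ x hxS)]
      simp
    · have : 0 ≤ (C₀ + C₁ + C₂) * μS * τ ^ 2 := by positivity
      nlinarith

end SpaceTimeTest

/-! ### Energy solutions of the forward equation with weighted bounds. -/

section ForwardSolution

theorem IsTest.conj {X : Type*} [NormedAddCommGroup X] [NormedSpace ℝ X] {φ : X → ℂ}
    (hφ : IsTest φ) : IsTest fun x => starRingEnd ℂ (φ x) :=
  ⟨Complex.conjCLE.contDiff.comp hφ.1, hφ.2.comp_left (g := starRingEnd ℂ) (map_zero _)⟩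

theorem fderiv_conj_apply {X : Type*} [NormedAddCommGroup X] [NormedSpace ℝ X] {φ : X → ℂ}
    (hφ : IsTest φ) (x v : X) :
    fderiv ℝ (fun x => starRingEnd ℂ (φ x)) x v = starRingEnd ℂ (fderiv ℝ φ x v) := by
  have h1 := Complex.conjCLE.toContinuousLinearMap.hasFDerivAt.comp x
    (hφ.1.differentiable (by simp) x).hasFDerivAt
  have h2 : fderiv ℝ (fun x => starRingEnd ℂ (φ x)) x =
      Complex.conjCLE.toContinuousLinearMap ∘L fderiv ℝ φ x := h1.fderiv
  rw [h2]
  simp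

theorem inner_expMul_neg {h : Rn n → ℝ} {ρ K : ℝ} (hh : IsExpWeight h ρ K) (χ u : L2w ω) :
    inner ℂ (expMul hh ω ℂ (-1) χ) (expMul hh ω ℂ 1 u) = inner ℂ χ u := by
  rw [L2.inner_def, L2.inner_def]
  refine integral_congr_ae ?_
  filter_upwards [coeFn_expMul hh (-1) χ, coeFn_expMul hh 1 u] with x h1 h2
  rw [h1, h2, inner_smul_left, inner_smul_right, Complex.conj_ofReal, ← mul_assoc,
    ← Complex.ofReal_mul, ← Real.exp_add]
  simp

/-- The abstract existence theorem read in `H¹_ω`. As `represents` applies to every energy solution,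
this one may stand for the action of `Γ`. -/
theorem exists_forward_solution {M ν : ℝ} {A : ℝ → Rn n → Matrix (Fin n) (Fin n) ℂ}
    (hA : IsElliptic ω M ν A) (hM : 0 < M) (hν : 0 < ν) (hω : IsA2Weight ω) (hn : 1 ≤ n)
    {φ : ℝ → ℂ} (hφc : Continuous φ) {a b m : ℝ} (hab : a ≤ b) (hφ : ∀ t, ‖φ t‖ ≤ m)
    (hsupp : ∀ t, t ∉ Set.Icc a b → φ t = 0) (ψ : L2w ω) :
    ∃ (u : ℝ → L2w ω) (G : ℝ → L2wVec ω), IsEnergyClass ω u G ∧ SolvesForward ω A φ ψ u G ∧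
      ∀ (h : Rn n → ℝ) (ρ K : ℝ) (hh : IsExpWeight h ρ K) (χ : L2w ω), ∀ᵐ t, a < t →
        ‖inner ℂ χ (u t)‖ ≤ Real.exp (M ^ 2 / ν * ρ ^ 2 * (t - a)) *
          (m * ‖expMul hh ω ℂ 1 ψ‖) * (b - a) * ‖expMul hh ω ℂ (-1) χ‖ := by
  obtain ⟨U, G, hU, hDU, heq, hbd⟩ := (isEvolution_energy hA hM hν hω hn).exists_solution
    hφc hab hφ hsupp ψ
  refine ⟨fun t => energyJ hω (U t), fun t => G t, ⟨?_, Lp.memLp G, ?_⟩, ?_, ?_⟩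
  · intro t
    obtain ⟨s, hs, hsi⟩ := hU t
    exact ⟨s, hs, ((energyJ hω).integrable_comp hsi :)⟩
  · filter_upwards [hDU] with t ht
    have := energy_hasWeakGrad hω (U t)
    rwa [ht] at this
  · intro Φ hΦ
    -- The inner product is antilinear in the test function while the weak equation is bilinear,
    -- hence the conjugate of `Φ`.
    obtain ⟨R, K, hW⟩ := exists_isTimeTest hω hΦ.conj
    have h1 := heq _ _ R K hW
    have e1 : ∀ t, inner ℂ (energyJ hω (energyTest hω hΦ.conj t)) (φ t • ψ) =
        ∫ x, φ t * ψ x * Φ (t, x) ∂(wMeasure ω) := fun t => by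
      rw [energyJ_energyTest, L2.inner_def]
      refine integral_congr_ae ?_
      filter_upwards [coeFn_testClass hω (hΦ.conj.slice t), Lp.coeFn_smul (φ t) ψ] with x h2 h3
      rw [h2, h3]
      simp [mul_comm]
    simp only [e1] at h1
    rw [← h1]
    refine integral_congr_ae ?_
    filter_upwards [hA.ae_measurable_slice] with t ht
    have i1 : Integrable (fun x => -inner ℂ (testClass hω (hΦ.conj.timeDeriv.slice t) x)
        (energyJ hω (U t) x)) (wMeasure ω) := (L2.integrable_inner (𝕜 := ℂ) _ _).neg
    have i2 := L2.integrable_inner (𝕜 := ℂ) (testGradClass hω (hΦ.conj.slice t))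
      (coeffLp hA hM hν hω hn t (G t))
    rw [energyD_energyTest, L2.inner_def, L2.inner_def, ← integral_neg, ← integral_add i1 i2]
    refine integral_congr_ae ?_
    filter_upwards [coeFn_testClass hω (hΦ.conj.timeDeriv.slice t),
      coeFn_testGradClass hω (hΦ.conj.slice t),
      coeFn_opLp (isMultiplier_coeffOp hA hM hν hω hn t) (G t)] with x h2 h3 h4
    rw [coeffLp, h2, h3, h4]
    have e2 : coeffOp ω ν A t x = rescaledOp ω A t x := by simp only [coeffOp, if_pos ht]
    have e3 : timeDeriv (fun p => starRingEnd ℂ (Φ p)) (t, x) =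
        starRingEnd ℂ (deriv (fun τ => Φ (τ, x)) t) := by
      rw [(hΦ.hasDerivAt_time t x).deriv, timeDeriv, timeDeriv, fderiv_conj_apply hΦ]
    have e4 : star (gradVec (fun y => starRingEnd ℂ (Φ (t, y))) x).ofLp =
        grad (fun y => Φ (t, y)) x := by
      funext i
      have := fderiv_conj_apply (hΦ.slice t) x (EuclideanSpace.single i 1)
      simp only [gradVec, grad, Pi.star_apply]
      rw [this]
      simp
    rw [e2, inner_rescaledOp, e4, e3]
    simp
  · intro h ρ K hh χ
    -- Pairing `e^h u` with `e^{-h}χ` gives back `⟨u, χ⟩`.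
    filter_upwards [hbd _ _ _ (isWeight_exp hA hM hν hω hn hh) (expMul hh ω ℂ (-1) χ)] with t ht hat
    have := ht hat
    rwa [inner_expMul_neg] at this

end ForwardSolution

/-! ### Weighted bounds for the kernel of a fundamental solution. -/

section Transfer

variable {M ν : ℝ} {A : ℝ → Rn n → Matrix (Fin n) (Fin n) ℂ}
  {Γ : ℝ → ℝ → L2w ω →L[ℂ] L2w ω}

/-- Smooth approximations of the indicator function of `(a, b)`. -/
def smoothBox (a b : ℝ) (j : ℕ) (s : ℝ) : ℝ :=
  Real.smoothTransition (j * (s - a)) * Real.smoothTransition (j * (b - s))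

theorem smoothBox_eq_zero {a b : ℝ} (j : ℕ) {s : ℝ} (hs : s ∉ Set.Ioo a b) :
    smoothBox a b j s = 0 := by
  rw [Set.mem_Ioo, not_and_or, not_lt, not_lt] at hs
  rw [smoothBox]
  rcases hs with h | h
  · rw [Real.smoothTransition.zero_of_nonpos
      (mul_nonpos_of_nonneg_of_nonpos j.cast_nonneg (by linarith)), zero_mul]
  · rw [Real.smoothTransition.zero_of_nonpos (x := j * (b - s))
      (mul_nonpos_of_nonneg_of_nonpos j.cast_nonneg (by linarith)), mul_zero]

theorem norm_smoothBox_le (a b : ℝ) (j : ℕ) (s : ℝ) : ‖((smoothBox a b j s : ℝ) : ℂ)‖ ≤ 1 := by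
  rw [Complex.norm_real, smoothBox, norm_mul,
    Real.norm_of_nonneg (Real.smoothTransition.nonneg _),
    Real.norm_of_nonneg (Real.smoothTransition.nonneg _)]
  exact mul_le_one₀ (Real.smoothTransition.le_one _) (Real.smoothTransition.nonneg _)
    (Real.smoothTransition.le_one _)

theorem isTest_smoothBox (a b : ℝ) (j : ℕ) : IsTest fun s => ((smoothBox a b j s : ℝ) : ℂ) := by
  constructor
  · have h : ContDiff ℝ ((⊤ : ℕ∞) : WithTop ℕ∞) (smoothBox a b j) :=
      (Real.smoothTransition.contDiff.comp (by fun_prop)).mul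
        (Real.smoothTransition.contDiff.comp (by fun_prop))
    exact Complex.ofRealCLM.contDiff.comp h
  · refine HasCompactSupport.intro (isCompact_Icc (a := a) (b := b)) fun s hs => ?_
    rw [smoothBox_eq_zero j (fun h => hs ⟨h.1.le, h.2.le⟩), Complex.ofReal_zero]

theorem tendsto_smoothBox (a b s : ℝ) :
    Tendsto (fun j => ((smoothBox a b j s : ℝ) : ℂ)) atTop
      (𝓝 ((Set.Ioo a b).indicator (fun _ => 1) s)) := by
  by_cases hs : s ∈ Set.Ioo a b
  · rw [Set.indicator_of_mem hs]
    refine tendsto_const_nhds.congr' ?_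
    have h1 : Tendsto (fun j : ℕ => (j : ℝ) * (s - a)) atTop atTop :=
      tendsto_natCast_atTop_atTop.atTop_mul_const (by linarith [hs.1])
    have h2 : Tendsto (fun j : ℕ => (j : ℝ) * (b - s)) atTop atTop :=
      tendsto_natCast_atTop_atTop.atTop_mul_const (by linarith [hs.2])
    filter_upwards [h1.eventually_ge_atTop 1, h2.eventually_ge_atTop 1] with j h3 h4
    rw [smoothBox, Real.smoothTransition.one_of_one_le h3, Real.smoothTransition.one_of_one_le h4]
    simp
  · rw [Set.indicator_of_notMem hs]
    refine tendsto_const_nhds.congr fun j => ?_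
    rw [smoothBox_eq_zero j hs, Complex.ofReal_zero]

theorem IsFundSol.integrableOn_kernel (hΓ : IsFundSol ω A Γ) {ψ χ : L2w ω} (hψ : ψ ∈ testL2w ω)
    (hχ : χ ∈ testL2w ω) (t : ℝ) :
    Measurable (fun s => inner ℂ χ (Γ t s ψ)) ∧
      ∃ C, 0 ≤ C ∧ ∀ s, ‖inner ℂ χ (Γ t s ψ)‖ ≤ C := by
  obtain ⟨K, hK⟩ := hΓ.bounded
  have hK0 : 0 ≤ K := (norm_nonneg _).trans (hK 0 0)
  refine ⟨(hΓ.measurable ψ hψ χ hχ).comp measurable_prodMk_left, ‖χ‖ * (K * ‖ψ‖),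
    by positivity, fun s => ?_⟩
  exact (norm_inner_le_norm _ _).trans (mul_le_mul_of_nonneg_left
    ((Γ t s).le_of_opNorm_le (hK t s) ψ) (norm_nonneg _))

/-- The weighted bound for the fundamental solution, integrated in the initial time. -/
theorem IsFundSol.integral_bound (hΓ : IsFundSol ω A Γ) (hA : IsElliptic ω M ν A) (hM : 0 < M)
    (hν : 0 < ν) (hω : IsA2Weight ω) (hn : 1 ≤ n) {h : Rn n → ℝ} {ρ K : ℝ}
    (hh : IsExpWeight h ρ K) {ψ χ : L2w ω} (hψ : ψ ∈ testL2w ω) (hχ : χ ∈ testL2w ω)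
    {a b : ℝ} (hab : a ≤ b) :
    ∀ᵐ t, b ≤ t → a < t → ‖∫ s in a..b, inner ℂ χ (Γ t s ψ)‖ ≤
      Real.exp (M ^ 2 / ν * ρ ^ 2 * (t - a)) * ‖expMul hh ω ℂ 1 ψ‖ * (b - a) *
        ‖expMul hh ω ℂ (-1) χ‖ := by
  have h1 : ∀ᵐ t, ∀ j : ℕ, a < t →
      ‖∫ s in Set.Iic t, ((smoothBox a b j s : ℝ) : ℂ) * inner ℂ χ (Γ t s ψ)‖ ≤
      Real.exp (M ^ 2 / ν * ρ ^ 2 * (t - a)) * ‖expMul hh ω ℂ 1 ψ‖ * (b - a) *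
        ‖expMul hh ω ℂ (-1) χ‖ := by
    rw [ae_all_iff]
    intro j
    have ht := isTest_smoothBox a b j
    obtain ⟨u, G, hu, hsol, hbd⟩ := exists_forward_solution hA hM hν hω hn ht.continuous hab
      (norm_smoothBox_le a b j) (fun s hs => by
        rw [smoothBox_eq_zero j (fun h => hs ⟨h.1.le, h.2.le⟩), Complex.ofReal_zero]) ψ
    filter_upwards [hΓ.represents _ ht ψ hψ u G hu hsol χ hχ, hbd h ρ K hh χ] with t h2 h3 hat
    rw [← h2]
    have := h3 hat
    rwa [one_mul] at this
  filter_upwards [h1] with t ht hbt hat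
  obtain ⟨hmeas, C, hC0, hC⟩ := hΓ.integrableOn_kernel hψ hχ t
  -- The bound for the source `smoothBox a b j` is uniform in `j`, so dominated convergence carries
  -- it to the indicator of `(a, b)`.
  have h2 : Tendsto (fun j : ℕ => ∫ s in Set.Iic t,
      ((smoothBox a b j s : ℝ) : ℂ) * inner ℂ χ (Γ t s ψ)) atTop
      (𝓝 (∫ s in Set.Iic t, (Set.Ioo a b).indicator (fun _ => (1 : ℂ)) s *
        inner ℂ χ (Γ t s ψ))) := by
    refine tendsto_integral_of_dominated_convergence
      ((Set.Icc a b).indicator fun _ => C) (fun j => ?_) ?_ (fun j => ?_) ?_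
    · exact ((isTest_smoothBox a b j).continuous.aestronglyMeasurable.mul
        hmeas.aestronglyMeasurable).restrict
    · refine Integrable.restrict ?_
      exact (integrable_indicator_iff measurableSet_Icc).2
        (integrableOn_const isCompact_Icc.measure_lt_top.ne)
    · refine Eventually.of_forall fun s => ?_
      by_cases hs : s ∈ Set.Icc a b
      · rw [Set.indicator_of_mem hs, norm_mul]
        exact (mul_le_of_le_one_left (norm_nonneg _) (norm_smoothBox_le a b j s)).trans (hC s)
      · rw [smoothBox_eq_zero j (fun h => hs ⟨h.1.le, h.2.le⟩), Set.indicator_of_notMem hs]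
        simp
    · exact Eventually.of_forall fun s => (tendsto_smoothBox a b s).mul_const _
  have h3 : ∫ s in Set.Iic t, (Set.Ioo a b).indicator (fun _ => (1 : ℂ)) s *
        inner ℂ χ (Γ t s ψ) = ∫ s in a..b, inner ℂ χ (Γ t s ψ) := by
    rw [intervalIntegral.integral_of_le hab, integral_Ioc_eq_integral_Ioo]
    have : (fun s => (Set.Ioo a b).indicator (fun _ => (1 : ℂ)) s * inner ℂ χ (Γ t s ψ)) =
        (Set.Ioo a b).indicator (fun s => inner ℂ χ (Γ t s ψ)) := by
      funext s
      by_cases hs : s ∈ Set.Ioo a b <;> simp [hs]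
    rw [this, setIntegral_indicator measurableSet_Ioo, Set.inter_eq_right.2]
    exact fun s hs => hs.2.le.trans hbt
  rw [h3] at h2
  exact le_of_tendsto h2.norm (Eventually.of_forall fun j => ht j hat)

/-- The weighted (Davies) bound for an operator on `L²_ω`. -/
def DaviesBound (κ τ : ℝ) {h : Rn n → ℝ} {ρ K : ℝ} (hh : IsExpWeight h ρ K)
    (T : L2w ω →L[ℂ] L2w ω) (ψ χ : L2w ω) : Prop :=
  ‖inner ℂ χ (T ψ)‖ ≤
    Real.exp (κ * ρ ^ 2 * τ) * ‖expMul hh ω ℂ 1 ψ‖ * ‖expMul hh ω ℂ (-1) χ‖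

/-- The exceptional set of times `t` in the integrated bound depends on `a` and `b`. Rational
endpoints give one null set, continuity of the primitive extends the bound to real endpoints, and
differentiation in `s` localises it. -/
theorem IsFundSol.ae_ae_daviesBound (hΓ : IsFundSol ω A Γ) (hA : IsElliptic ω M ν A) (hM : 0 < M)
    (hν : 0 < ν) (hω : IsA2Weight ω) (hn : 1 ≤ n) {h : Rn n → ℝ} {ρ K : ℝ}
    (hh : IsExpWeight h ρ K) {ψ χ : L2w ω} (hψ : ψ ∈ testL2w ω) (hχ : χ ∈ testL2w ω) :
    ∀ᵐ t, ∀ᵐ s, s < t → DaviesBound (M ^ 2 / ν) (t - s) hh (Γ t s) ψ χ := by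
  have h1 : ∀ᵐ t, ∀ a b : ℚ, (a : ℝ) ≤ b → (b : ℝ) ≤ t → (a : ℝ) < t →
      ‖∫ s in (a : ℝ)..b, inner ℂ χ (Γ t s ψ)‖ ≤
      Real.exp (M ^ 2 / ν * ρ ^ 2 * (t - a)) * ‖expMul hh ω ℂ 1 ψ‖ * (b - a) *
        ‖expMul hh ω ℂ (-1) χ‖ := by
    rw [ae_all_iff]; intro a
    rw [ae_all_iff]; intro b
    by_cases hab : (a : ℝ) ≤ b
    · filter_upwards [hΓ.integral_bound hA hM hν hω hn hh hψ hχ hab] with t ht _ using ht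
    · exact Eventually.of_forall fun t h => absurd h hab
  filter_upwards [h1] with t ht
  obtain ⟨hmeas, C, hC0, hC⟩ := hΓ.integrableOn_kernel hψ hχ t
  have hloc : LocallyIntegrable (fun s => inner ℂ χ (Γ t s ψ)) volume := by
    refine (locallyIntegrable_const C).mono hmeas.aestronglyMeasurable
      (Eventually.of_forall fun s => ?_)
    rw [Real.norm_of_nonneg hC0]
    exact hC s
  have hii : ∀ c d : ℝ, IntervalIntegrable (fun s => inner ℂ χ (Γ t s ψ)) volume c d :=
    fun c d => intervalIntegrable_iff.2
      ((hloc.integrableOn_isCompact isCompact_uIcc).mono_set Set.uIoc_subset_uIcc)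
  have hcont : Continuous fun x => ∫ s in (0 : ℝ)..x, inner ℂ χ (Γ t s ψ) :=
    intervalIntegral.continuous_primitive hii 0
  refine ae_norm_le_of_norm_integral_le hloc (isOpen_Iio (a := t))
    (g := fun s _ => Real.exp (M ^ 2 / ν * ρ ^ 2 * (t - s)) * ‖expMul hh ω ℂ 1 ψ‖ *
      ‖expMul hh ω ℂ (-1) χ‖) (fun s _ => continuousAt_const) (fun a b hab hO => ?_)
  have hbt : b < t := hO ⟨hab.le, le_rfl⟩
  let F : ℝ × ℝ → ℝ := fun p => ‖(∫ s in (0 : ℝ)..p.2, inner ℂ χ (Γ t s ψ)) -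
    ∫ s in (0 : ℝ)..p.1, inner ℂ χ (Γ t s ψ)‖
  let g : ℝ × ℝ → ℝ := fun p => Real.exp (M ^ 2 / ν * ρ ^ 2 * (t - p.1)) * ‖expMul hh ω ℂ 1 ψ‖ *
    (p.2 - p.1) * ‖expMul hh ω ℂ (-1) χ‖
  have hF : Continuous F := ((hcont.comp continuous_snd).sub (hcont.comp continuous_fst)).norm
  have hg : Continuous g := by fun_prop
  have hopen : IsOpen {p : ℝ × ℝ | p.1 < p.2 ∧ p.2 < t} :=
    (isOpen_lt continuous_fst continuous_snd).inter (isOpen_lt continuous_snd continuous_const)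
  have hdense : Dense (Set.range fun q : ℚ × ℚ => ((q.1 : ℝ), (q.2 : ℝ))) := by
    have := (Rat.denseRange_cast (𝕜 := ℝ)).prodMap (Rat.denseRange_cast (𝕜 := ℝ))
    exact this
  have key : ((a, b) : ℝ × ℝ) ∈ {p : ℝ × ℝ | F p ≤ g p} := by
    have hcl : IsClosed {p : ℝ × ℝ | F p ≤ g p} := isClosed_le hF hg
    have hsub := hdense.open_subset_closure_inter hopen
    refine closure_minimal ?_ hcl (hsub (show (a, b) ∈ _ from ⟨hab, hbt⟩))
    rintro _ ⟨⟨h2, h3⟩, ⟨q, rfl⟩⟩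
    have h4 := ht q.1 q.2 (le_of_lt h2) (le_of_lt h3) (lt_trans h2 h3)
    change F _ ≤ g _
    simp only [F, g]
    rwa [intervalIntegral.integral_interval_sub_left (hii _ _) (hii _ _)]
  change F (a, b) ≤ g (a, b) at key
  simp only [F, g] at key
  rw [intervalIntegral.integral_interval_sub_left (hii _ _) (hii _ _)] at key
  refine key.trans (le_of_eq (by ring))

/-- Fubini turns "for almost every `t`, for almost every `s`" into a statement on pairs; the joint
Borel measurability of the kernel is what permits it. -/
theorem IsFundSol.ae_daviesBound (hΓ : IsFundSol ω A Γ) (hA : IsElliptic ω M ν A) (hM : 0 < M)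
    (hν : 0 < ν) (hω : IsA2Weight ω) (hn : 1 ≤ n) {h : Rn n → ℝ} {ρ K : ℝ}
    (hh : IsExpWeight h ρ K) {ψ χ : L2w ω} (hψ : ψ ∈ testL2w ω) (hχ : χ ∈ testL2w ω) :
    ∀ᵐ p : ℝ × ℝ, p.2 < p.1 → DaviesBound (M ^ 2 / ν) (p.1 - p.2) hh (Γ p.1 p.2) ψ χ := by
  have hmeas : MeasurableSet {p : ℝ × ℝ | p.2 < p.1 →
      DaviesBound (M ^ 2 / ν) (p.1 - p.2) hh (Γ p.1 p.2) ψ χ} := by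
    have h1 : MeasurableSet {p : ℝ × ℝ | p.2 < p.1} :=
      measurableSet_lt measurable_snd measurable_fst
    have h2 : MeasurableSet {p : ℝ × ℝ |
        DaviesBound (M ^ 2 / ν) (p.1 - p.2) hh (Γ p.1 p.2) ψ χ} :=
      measurableSet_le (hΓ.measurable ψ hψ χ hχ).norm (by fun_prop)
    exact h1.imp h2
  exact (Measure.ae_prod_mem_iff_ae_ae_mem hmeas).2
    (hΓ.ae_ae_daviesBound hA hM hν hω hn hh hψ hχ)

/-- A strict violation at one point would persist on a neighbourhood, which has positive measure. -/
theorem mem_of_ae_of_isClosed_Ioi {P : ℝ → Prop} {s : ℝ} (h : ∀ᵐ t, s < t → P t)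
    {f g : ℝ → ℝ} (hP : ∀ t, s < t → (P t ↔ f t ≤ g t)) (hf : ContinuousOn f (Set.Ioi s))
    (hg : ContinuousOn g (Set.Ioi s)) : ∀ t, s < t → P t := by
  intro t ht
  rw [hP t ht]
  by_contra! hlt
  have h1 : ∀ᶠ x in 𝓝 t, g x < f x :=
    (hg.continuousAt (Ioi_mem_nhds ht)).eventually_lt (hf.continuousAt (Ioi_mem_nhds ht)) hlt
  have h2 : ∀ᶠ x in 𝓝 t, ¬ (s < x → P x) := by
    filter_upwards [h1, Ioi_mem_nhds ht] with x hx hsx hc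
    exact absurd ((hP x hsx).1 (hc hsx)) (not_le.2 hx)
  have h3 : 0 < volume {x | ¬ (s < x → P x)} := Measure.measure_pos_of_mem_nhds volume h2
  exact h3.ne' (ae_iff.1 h)

theorem mem_of_ae_of_isClosed_Iio {P : ℝ → Prop} {t : ℝ} (h : ∀ᵐ s, s < t → P s)
    {f g : ℝ → ℝ} (hP : ∀ s, s < t → (P s ↔ f s ≤ g s)) (hf : ContinuousOn f (Set.Iio t))
    (hg : ContinuousOn g (Set.Iio t)) : ∀ s, s < t → P s := by
  intro s ht
  rw [hP s ht]
  by_contra! hlt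
  have h1 : ∀ᶠ x in 𝓝 s, g x < f x :=
    (hg.continuousAt (Iio_mem_nhds ht)).eventually_lt (hf.continuousAt (Iio_mem_nhds ht)) hlt
  have h2 : ∀ᶠ x in 𝓝 s, ¬ (x < t → P x) := by
    filter_upwards [h1, Iio_mem_nhds ht] with x hx hsx hc
    exact absurd ((hP x hsx).1 (hc hsx)) (not_le.2 hx)
  have h3 : 0 < volume {x | ¬ (x < t → P x)} := Measure.measure_pos_of_mem_nhds volume h2
  exact h3.ne' (ae_iff.1 h)

/-- Separate continuity suffices: for almost every `t`, continuity in `s` reaches all `s`; then for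
each fixed `s`, continuity in `t` reaches all `t`. -/
theorem IsFundSol.daviesBound_of_isContVersion (hΓ : IsFundSol ω A Γ)
    (hcv : IsContVersion ω Γ) (hA : IsElliptic ω M ν A) (hM : 0 < M)
    (hν : 0 < ν) (hω : IsA2Weight ω) (hn : 1 ≤ n) {h : Rn n → ℝ} {ρ K : ℝ}
    (hh : IsExpWeight h ρ K) {ψ χ : L2w ω} (hψ : ψ ∈ testL2w ω) (hχ : χ ∈ testL2w ω)
    (t s : ℝ) (hst : s < t) : DaviesBound (M ^ 2 / ν) (t - s) hh (Γ t s) ψ χ := by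
  obtain ⟨hct, hcs⟩ := hcv ψ hψ χ hχ
  have h1 : ∀ᵐ t, ∀ s, s < t → DaviesBound (M ^ 2 / ν) (t - s) hh (Γ t s) ψ χ := by
    filter_upwards [hΓ.ae_ae_daviesBound hA hM hν hω hn hh hψ hχ] with t ht
    exact mem_of_ae_of_isClosed_Iio ht (fun s _ => Iff.rfl) (hcs t).norm (by fun_prop)
  refine mem_of_ae_of_isClosed_Ioi (s := s)
    (P := fun t => DaviesBound (M ^ 2 / ν) (t - s) hh (Γ t s) ψ χ) ?_ (fun t _ => Iff.rfl)
    (hct s).norm (by fun_prop) t hst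
  filter_upwards [h1] with t ht hs using ht s hs

end Transfer

/-! ### Countably many smooth weights approximating distance functions. -/

section DistanceWeights

open scoped Convolution

/-- Smooth approximations of truncated distance functions. -/
theorem exists_distance_weight (S : Set (Rn n)) {δ k : ℝ} (hδ : 0 < δ) (hk : 0 ≤ k) :
    ∃ h : Rn n → ℝ, IsExpWeight h 1 (k + δ) ∧ ∀ x, |h x - min (Metric.infDist x S) k| ≤ δ := by
  let f : Rn n → ℝ := fun x => min (Metric.infDist x S) k
  have hf : LipschitzWith 1 f := (Metric.lipschitz_infDist_pt S).min_const k
  have hf0 : ∀ x, 0 ≤ f x := fun x => le_min Metric.infDist_nonneg hk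
  have hfk : ∀ x, f x ≤ k := fun x => min_le_right _ _
  -- Mollification at scale `δ` keeps the Lipschitz constant `1` and moves a `1`-Lipschitz function
  -- by at most `δ`.
  let η : ContDiffBump (0 : Rn n) := ⟨δ / 2, δ, by linarith, by linarith⟩
  let h : Rn n → ℝ := (η.normed volume ⋆[ContinuousLinearMap.lsmul ℝ ℝ, volume] f)
  have hd : ∀ x, |h x - f x| ≤ δ := fun x => by
    have := η.dist_normed_convolution_le (μ := volume) (g := f) (x₀ := x) (ε := δ)
      hf.continuous.aestronglyMeasurable (fun y hy => by
        refine (hf.dist_le_mul y x).trans ?_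
        rw [NNReal.coe_one, one_mul]
        exact (Metric.mem_ball.1 hy).le)
    rwa [Real.dist_eq] at this
  have hint : ∀ x, Integrable (fun t => η.normed volume t * f (x - t)) volume := fun x => by
    refine Continuous.integrable_of_hasCompactSupport ?_ η.hasCompactSupport_normed.mul_right
    exact η.continuous_normed.mul (hf.continuous.comp (continuous_const.sub continuous_id))
  have hlip : LipschitzWith 1 h := by
    refine LipschitzWith.of_dist_le_mul fun x y => ?_
    rw [NNReal.coe_one, one_mul, Real.dist_eq]
    have e1 : h x - h y = ∫ t, η.normed volume t * (f (x - t) - f (y - t)) := by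
      simp only [mul_sub]
      rw [integral_sub (hint x) (hint y)]
      rfl
    have hη : Integrable (η.normed volume) volume := η.integrable_normed
    rw [e1, ← Real.norm_eq_abs]
    refine (norm_integral_le_of_norm_le (hη.mul_const (dist x y))
      (Eventually.of_forall fun t => ?_)).trans ?_
    · rw [norm_mul, Real.norm_of_nonneg (η.nonneg_normed t)]
      refine mul_le_mul_of_nonneg_left ?_ (η.nonneg_normed t)
      have := hf.dist_le_mul (x - t) (y - t)
      rw [NNReal.coe_one, one_mul, dist_sub_right, Real.dist_eq] at this
      exact this
    · rw [integral_mul_const, η.integral_normed, one_mul]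
  refine ⟨h, ⟨?_, fun x => ?_, fun x => ?_⟩, hd⟩
  · exact η.hasCompactSupport_normed.contDiff_convolution_left _ η.contDiff_normed
      hf.continuous.locallyIntegrable
  · have h1 := abs_le.1 (hd x)
    have h2 := hf0 x
    have h3 := hfk x
    rw [abs_le]
    constructor <;> linarith [h1.1, h1.2]
  · simpa using norm_fderiv_le_of_lipschitz ℝ hlip (x₀ := x)

/-- A countable family of weights which separates sets at positive distance. -/
def distWeight (n : ℕ) (S : Finset ℕ) (j k : ℕ) : Rn n → ℝ :=
  (exists_distance_weight (n := n) ((TopologicalSpace.denseSeq (Rn n)) '' (S : Set ℕ))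
    (δ := 1 / ((j : ℝ) + 1)) (k := k) Nat.one_div_pos_of_nat k.cast_nonneg).choose

theorem isExpWeight_distWeight (S : Finset ℕ) (j k : ℕ) :
    IsExpWeight (distWeight n S j k) 1 (k + 1 / ((j : ℝ) + 1)) :=
  (exists_distance_weight (n := n) ((TopologicalSpace.denseSeq (Rn n)) '' (S : Set ℕ))
    (δ := 1 / ((j : ℝ) + 1)) (k := k) Nat.one_div_pos_of_nat k.cast_nonneg).choose_spec.1

theorem abs_distWeight_sub_le (S : Finset ℕ) (j k : ℕ) (x : Rn n) :
    |distWeight n S j k x -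
      min (Metric.infDist x ((TopologicalSpace.denseSeq (Rn n)) '' (S : Set ℕ))) k| ≤
      1 / ((j : ℝ) + 1) :=
  (exists_distance_weight (n := n) ((TopologicalSpace.denseSeq (Rn n)) '' (S : Set ℕ))
    (δ := 1 / ((j : ℝ) + 1)) (k := k) Nat.one_div_pos_of_nat k.cast_nonneg).choose_spec.2 x

theorem IsExpWeight.const_mul {h : Rn n → ℝ} {K : ℝ} (hh : IsExpWeight h 1 K) {ρ : ℝ}
    (hρ : 0 ≤ ρ) : IsExpWeight (fun x => ρ * h x) ρ (ρ * K) where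
  smooth := contDiff_const.mul hh.smooth
  bdd := fun x => by
    rw [abs_mul, abs_of_nonneg hρ]
    exact mul_le_mul_of_nonneg_left (hh.bdd x) hρ
  grad_le := fun x => by
    rw [((hh.smooth.differentiable (by simp) x).hasFDerivAt.const_mul ρ).fderiv, norm_smul,
      Real.norm_of_nonneg hρ]
    exact mul_le_of_le_one_right hρ (hh.grad_le x)

/-- A bounded set has a finite `ε/2`-net from the dense sequence. The distance to that net replaces
the distance to `E`, with `ε/2` left for the smoothing; truncation at `k ≥ d` loses nothing. -/
theorem exists_distWeight {E F : Set (Rn n)} (hE : Bornology.IsBounded E) (hne : E.Nonempty)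
    {d : ℝ} (hd : ∀ x ∈ E, ∀ y ∈ F, d ≤ dist x y) {ε : ℝ} (hε : 0 < ε) :
    ∃ S j k, (∀ x ∈ E, distWeight n S j k x ≤ ε) ∧ ∀ y ∈ F, d - ε ≤ distWeight n S j k y := by
  obtain ⟨j, hj⟩ := exists_nat_one_div_lt (half_pos hε)
  obtain ⟨k, hk⟩ := exists_nat_ge d
  set D := TopologicalSpace.denseSeq (Rn n)
  have hcpt : IsCompact (closure E) := hE.isCompact_closure
  obtain ⟨S₀, hS₀⟩ := hcpt.elim_finite_subcover (fun i => Metric.ball (D i) (ε / 2))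
    (fun i => Metric.isOpen_ball) (fun x _ => by
      obtain ⟨i, hi⟩ := (TopologicalSpace.denseRange_denseSeq (Rn n)).exists_dist_lt x
        (half_pos hε)
      exact Set.mem_iUnion.2 ⟨i, hi⟩)
  classical
  -- Centres far from `E` are discarded, as they might lie close to `F` and spoil the lower bound
  -- there.
  let S := S₀.filter fun i => ∃ x ∈ E, dist x (D i) < ε / 2
  have hcover : ∀ x ∈ E, ∃ i ∈ S, dist x (D i) < ε / 2 := fun x hx => by
    obtain ⟨i, hi, hxi⟩ := Set.mem_iUnion₂.1 (hS₀ (subset_closure hx))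
    exact ⟨i, Finset.mem_filter.2 ⟨hi, x, hx, hxi⟩, hxi⟩
  refine ⟨S, j, k, fun x hx => ?_, fun y hy => ?_⟩
  · obtain ⟨i, hi, hxi⟩ := hcover x hx
    have h1 : Metric.infDist x (D '' (S : Set ℕ)) ≤ dist x (D i) :=
      Metric.infDist_le_dist_of_mem ⟨i, hi, rfl⟩
    have h2 := (abs_le.1 (abs_distWeight_sub_le S j k x)).2
    have h3 := min_le_left (Metric.infDist x (D '' (S : Set ℕ))) k
    linarith
  · have hSne : (D '' (S : Set ℕ)).Nonempty := by
      obtain ⟨x, hx⟩ := hne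
      obtain ⟨i, hi, _⟩ := hcover x hx
      exact ⟨D i, i, hi, rfl⟩
    have h1 : d - ε / 2 ≤ Metric.infDist y (D '' (S : Set ℕ)) := by
      rw [Metric.le_infDist hSne]
      rintro _ ⟨i, hi, rfl⟩
      obtain ⟨x, hx, hxi⟩ := (Finset.mem_filter.1 hi).2
      have h2 := hd x hx y hy
      have h3 := dist_triangle x (D i) y
      rw [dist_comm y]
      linarith
    have h2 := (abs_le.1 (abs_distWeight_sub_le S j k y)).1
    have h3 : d - ε / 2 ≤ min (Metric.infDist y (D '' (S : Set ℕ))) k :=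
      le_min h1 (by linarith)
    linarith

end DistanceWeights

/-! ### From weighted bounds to Gaussian off-diagonal bounds. -/

section OffDiagonal

theorem isMultiplier_indicator {S : Set (Rn n)} (hS : NullMeasurableSet S volume) :
    IsMultiplier (wMeasure ω)
      (fun x => (((S.indicator (fun _ => (1 : ℝ)) x : ℝ) : ℂ) • ContinuousLinearMap.id ℂ ℂ)) 1 :=
  isMultiplier_smul (aestronglyMeasurable_const.indicator₀ (hS.mono_ac wMeasure_ac)) fun x => by
    by_cases hx : x ∈ S <;> simp [hx]

/-- Multiplication by an indicator function on `L²_ω`. -/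
def indMul (ω : Rn n → ℝ) {S : Set (Rn n)} (hS : NullMeasurableSet S volume) :
    L2w ω →L[ℂ] L2w ω := opLp (isMultiplier_indicator hS)

theorem coeFn_indMul {S : Set (Rn n)} (hS : NullMeasurableSet S volume) (f : L2w ω) :
    ∀ᵐ x ∂(wMeasure ω), indMul ω hS f x = S.indicator f x := by
  filter_upwards [coeFn_opLp (isMultiplier_indicator hS) f] with x hx
  rw [indMul, hx]
  by_cases h : x ∈ S <;> simp [h]

theorem normOn_eq {S : Set (Rn n)} (hS : NullMeasurableSet S volume) (f : L2w ω) :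
    normOn ω S f = ‖indMul ω hS f‖ := by
  rw [normOn, ← integral_indicator₀ (hS.mono_ac wMeasure_ac)]
  have : ∫ x, S.indicator (fun x => ‖f x‖ ^ 2) x ∂(wMeasure ω) =
      ∫ x, ‖indMul ω hS f x‖ ^ 2 ∂(wMeasure ω) := by
    refine integral_congr_ae ?_
    filter_upwards [coeFn_indMul hS f] with x hx
    rw [hx]
    by_cases h : x ∈ S <;> simp [h]
  rw [this, ← lp_norm_sq, Real.sqrt_sq (norm_nonneg _)]

theorem norm_expMul_le {h : Rn n → ℝ} {ρ K : ℝ} (hh : IsExpWeight h ρ K) (s : ℝ) {f : L2w ω}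
    {E : Set (Rn n)} (hf : ∀ᵐ x ∂(wMeasure ω), x ∉ E → f x = 0) {r : ℝ}
    (hr : ∀ x ∈ E, s * h x ≤ r) : ‖expMul hh ω ℂ s f‖ ≤ Real.exp r * ‖f‖ := by
  refine Lp.norm_le_mul_norm_of_ae_le_mul ?_
  filter_upwards [coeFn_expMul hh s f, hf] with x h1 h2
  rw [h1, norm_smul, Complex.norm_real, Real.norm_of_nonneg (Real.exp_pos _).le]
  by_cases hx : x ∈ E
  · exact mul_le_mul_of_nonneg_right (Real.exp_le_exp.2 (hr x hx)) (norm_nonneg _)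
  · rw [h2 hx]; simp

theorem daviesBound_of_dense {κ τ : ℝ} {h : Rn n → ℝ} {ρ K : ℝ} (hh : IsExpWeight h ρ K)
    {T : L2w ω →L[ℂ] L2w ω} {𝒟 : Set (L2w ω)} (h𝒟 : Dense 𝒟)
    (hb : ∀ ψ ∈ 𝒟, ∀ χ ∈ 𝒟, DaviesBound κ τ hh T ψ χ) (ψ χ : L2w ω) :
    DaviesBound κ τ hh T ψ χ := by
  have hcl : IsClosed {p : L2w ω × L2w ω | DaviesBound κ τ hh T p.1 p.2} := by
    refine isClosed_le ?_ ?_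
    · exact (continuous_snd.inner (T.continuous.comp continuous_fst)).norm
    · exact (continuous_const.mul ((expMul hh ω ℂ 1).continuous.comp continuous_fst).norm).mul
        ((expMul hh ω ℂ (-1)).continuous.comp continuous_snd).norm
  exact closure_minimal (s := 𝒟 ×ˢ 𝒟) (fun p hp => hb p.1 hp.1 p.2 hp.2) hcl
    ((h𝒟.prod h𝒟) (ψ, χ))

/-- The countably many weighted bounds from which the off-diagonal bounds follow. -/
def DaviesFamily (κ τ : ℝ) (𝒟 : Set (L2w ω)) (T : L2w ω →L[ℂ] L2w ω) : Prop :=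
  ∀ (q : ℚ) (hq : 0 < q) (S : Finset ℕ) (j k : ℕ), ∀ ψ ∈ 𝒟, ∀ χ ∈ 𝒟,
    DaviesBound κ τ ((isExpWeight_distWeight (n := n) S j k).const_mul
      (Rat.cast_nonneg.2 hq.le : (0 : ℝ) ≤ q)) T ψ χ

/-- The weight costs at most `e^{qε}` on `E` and gains at least `e^{-q(d-ε)}` on `F`. Letting `ε →
0` leaves the exponent `κq²τ - qd`, which is then minimised over `q`. -/
theorem DaviesFamily.norm_inner_le {κ τ : ℝ} (hκ : 0 < κ) (hτ : 0 < τ) {𝒟 : Set (L2w ω)}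
    (h𝒟 : Dense 𝒟) {T : L2w ω →L[ℂ] L2w ω} (hT : DaviesFamily κ τ 𝒟 T) {E F : Set (Rn n)}
    (hE : Bornology.IsBounded E) {d : ℝ} (hd0 : 0 ≤ d) (hd : ∀ x ∈ E, ∀ y ∈ F, d ≤ dist x y)
    {f g : L2w ω} (hf : ∀ᵐ x ∂(wMeasure ω), x ∉ E → f x = 0)
    (hg : ∀ᵐ x ∂(wMeasure ω), x ∉ F → g x = 0) :
    ‖inner ℂ g (T f)‖ ≤ Real.exp (-(1 / (4 * κ)) * (d ^ 2 / τ)) * ‖f‖ * ‖g‖ := by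
  rcases Set.eq_empty_or_nonempty E with rfl | hne
  · have : f = 0 := (Lp.eq_zero_iff_ae_eq_zero).2 (by
      filter_upwards [hf] with x hx using hx (Set.notMem_empty x))
    simp [this]
  have h1 : ∀ q : ℚ, 0 < q → ∀ ε : ℝ, 0 < ε → ‖inner ℂ g (T f)‖ ≤
      Real.exp (κ * (q : ℝ) ^ 2 * τ) * (Real.exp (q * ε) * ‖f‖) *
        (Real.exp (-(q * (d - ε))) * ‖g‖) := fun q hq ε hε => by
    obtain ⟨S, j, k, hSE, hSF⟩ := exists_distWeight hE hne hd hε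
    have hq' : (0 : ℝ) < q := Rat.cast_pos.2 hq
    have h2 := daviesBound_of_dense _ h𝒟 (hT q hq S j k) f g
    refine h2.trans ?_
    gcongr
    · refine norm_expMul_le _ _ hf fun x hx => ?_
      rw [one_mul]
      exact mul_le_mul_of_nonneg_left (hSE x hx) hq'.le
    · refine norm_expMul_le _ _ hg fun x hx => ?_
      have := mul_le_mul_of_nonneg_left (hSF x hx) hq'.le
      linarith
  have h2 : ∀ q : ℚ, 0 < q → ‖inner ℂ g (T f)‖ ≤
      Real.exp (κ * (q : ℝ) ^ 2 * τ - q * d) * ‖f‖ * ‖g‖ := fun q hq => by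
    have hlim : Tendsto (fun ε : ℝ => Real.exp (κ * (q : ℝ) ^ 2 * τ) * (Real.exp (q * ε) * ‖f‖) *
        (Real.exp (-(q * (d - ε))) * ‖g‖)) (𝓝[>] 0)
        (𝓝 (Real.exp (κ * (q : ℝ) ^ 2 * τ) * (Real.exp (q * 0) * ‖f‖) *
        (Real.exp (-(q * (d - 0))) * ‖g‖))) :=
      (Continuous.tendsto (by fun_prop) 0).mono_left nhdsWithin_le_nhds
    have h3 := ge_of_tendsto hlim (by
      filter_upwards [self_mem_nhdsWithin] with ε hε using h1 q hq ε hε)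
    refine h3.trans (le_of_eq ?_)
    have e : Real.exp (κ * (q : ℝ) ^ 2 * τ - q * d) =
        Real.exp (κ * (q : ℝ) ^ 2 * τ) * Real.exp (-(q * d)) := by
      rw [sub_eq_add_neg, Real.exp_add]
    rw [e]
    simp only [mul_zero, Real.exp_zero, sub_zero]
    ring
  have hcl : IsClosed {r : ℝ | ‖inner ℂ g (T f)‖ ≤
      Real.exp (κ * r ^ 2 * τ - r * d) * ‖f‖ * ‖g‖} :=
    isClosed_le continuous_const (by fun_prop)
  have h3 : Set.Ioi (0 : ℝ) ⊆ {r : ℝ | ‖inner ℂ g (T f)‖ ≤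
      Real.exp (κ * r ^ 2 * τ - r * d) * ‖f‖ * ‖g‖} := by
    refine ((Rat.denseRange_cast (𝕜 := ℝ)).open_subset_closure_inter isOpen_Ioi).trans
      (closure_minimal ?_ hcl)
    rintro _ ⟨hr, ⟨q, rfl⟩⟩
    exact h2 q (Rat.cast_pos.1 (Set.mem_Ioi.1 hr))
  -- The minimiser, with value `-d²/(4κτ)`. It is `0` when `d = 0`, hence the closure.
  have h4 : d / (2 * κ * τ) ∈ closure (Set.Ioi (0 : ℝ)) := by
    rw [closure_Ioi]
    exact div_nonneg hd0 (by positivity)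
  have h5 : ‖inner ℂ g (T f)‖ ≤ _ := closure_minimal h3 hcl h4
  refine h5.trans (le_of_eq ?_)
  congr 3
  field_simp
  ring

/-- The norm on `F` is obtained by pairing with the truncation `g` of `T f`. Unbounded `E` is
reached by density: for `ψ` with compact support, the truncation of `ψ` to `E` lives on a bounded
part of `E`. -/
theorem DaviesFamily.offDiagonalBound {κ τ : ℝ} (hκ : 0 < κ) (hτ : 0 < τ)
    {𝒟 : Set (L2w ω)} (h𝒟 : Dense 𝒟) (hsub : 𝒟 ⊆ testL2w ω) {T : L2w ω →L[ℂ] L2w ω}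
    (hT : DaviesFamily κ τ 𝒟 T) : OffDiagonalBound ω (1 / (4 * κ)) 1 τ T := by
  intro E F hE hF f hf
  set d := setDist E F with hdd
  have hbdd : BddBelow {r | ∃ x ∈ E, ∃ y ∈ F, r = dist x y} :=
    ⟨0, by rintro _ ⟨x, _, y, _, rfl⟩; exact dist_nonneg⟩
  have hd0 : 0 ≤ d := Real.sInf_nonneg (by rintro _ ⟨x, _, y, _, rfl⟩; exact dist_nonneg)
  have hd : ∀ x ∈ E, ∀ y ∈ F, d ≤ dist x y := fun x hx y hy => csInf_le hbdd ⟨x, hx, y, hy, rfl⟩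
  have hfE : indMul ω hE f = f := by
    refine Lp.ext ?_
    filter_upwards [coeFn_indMul hE f, hf] with x h1 h2
    rw [h1]
    by_cases hx : x ∈ E
    · simp [hx]
    · simp [hx, h2 hx]
  set g := indMul ω hF (T f) with hg
  have hg0 : ∀ᵐ x ∂(wMeasure ω), x ∉ F → g x = 0 := by
    filter_upwards [coeFn_indMul hF (T f)] with x h1 hx
    rw [hg, h1]; simp [hx]
  have key : ∀ ψ : L2w ω, ‖inner ℂ g (T (indMul ω hE ψ))‖ ≤
      Real.exp (-(1 / (4 * κ)) * (d ^ 2 / τ)) * ‖indMul ω hE ψ‖ * ‖g‖ := by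
    have hcl : IsClosed {ψ : L2w ω | ‖inner ℂ g (T (indMul ω hE ψ))‖ ≤
        Real.exp (-(1 / (4 * κ)) * (d ^ 2 / τ)) * ‖indMul ω hE ψ‖ * ‖g‖} := by
      refine isClosed_le ?_ ?_
      · exact (continuous_const.inner (T.continuous.comp (indMul ω hE).continuous)).norm
      · exact (continuous_const.mul (indMul ω hE).continuous.norm).mul continuous_const
    intro ψ
    refine closure_minimal (fun ψ hψ => ?_) hcl (h𝒟 ψ)
    obtain ⟨ψ₀, hψ₀, hψe⟩ := hsub hψ
    refine hT.norm_inner_le hκ hτ h𝒟 (E := E ∩ tsupport ψ₀) (F := F)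
      (hψ₀.2.isCompact.isBounded.subset Set.inter_subset_right) hd0
      (fun x hx y hy => hd x hx.1 y hy) ?_ hg0
    filter_upwards [coeFn_indMul hE ψ, hψe] with x h1 h2 hx
    rw [h1]
    by_cases hxE : x ∈ E
    · rw [Set.indicator_of_mem hxE, h2]
      exact image_eq_zero_of_notMem_tsupport fun hm => hx ⟨hxE, hm⟩
    · simp [hxE]
  have h1 := key f
  rw [hfE] at h1
  have h2 : inner ℂ g (T f) = ((‖g‖ ^ 2 : ℝ) : ℂ) := by
    have : inner ℂ g (T f) = inner ℂ g g := by
      rw [L2.inner_def, L2.inner_def]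
      refine integral_congr_ae ?_
      filter_upwards [coeFn_indMul hF (T f)] with x hx
      rw [hg, hx]
      by_cases hxF : x ∈ F <;> simp [hxF]
    rw [this, inner_self_eq_norm_sq_to_K]
    norm_cast
  rw [h2, Complex.norm_real, Real.norm_of_nonneg (by positivity)] at h1
  rw [normOn_eq hF, normOn_eq hE, hfE, one_mul, ← hg]
  rcases eq_or_lt_of_le (norm_nonneg g) with h0 | h0
  · rw [← h0]; positivity
  · rw [sq] at h1
    exact le_of_mul_le_mul_right h1 h0

theorem exists_countable_dense_test (hω : IsA2Weight ω) :
    ∃ 𝒟 : Set (L2w ω), 𝒟 ⊆ testL2w ω ∧ 𝒟.Countable ∧ Dense 𝒟 := by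
  have hd : Dense (testL2w ω) := by
    have := hω.isLocallyFiniteMeasure
    have h1 := Lp.dense_hasCompactSupport_contDiff (E := Rn n) (F := ℂ) (μ := wMeasure ω)
      (p := 2) (by simp)
    refine h1.mono ?_
    rintro f ⟨g, h2, h3, h4⟩
    exact ⟨g, ⟨h4, h3⟩, h2⟩
  exact hd.exists_countable_dense_subset

variable {M ν : ℝ} {A : ℝ → Rn n → Matrix (Fin n) (Fin n) ℂ}
  {Γ : ℝ → ℝ → L2w ω →L[ℂ] L2w ω}

/-- Slopes, net weights and test functions range over countable sets, so a single null set of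
`(t,s)` serves all `E`, `F` and `f` simultaneously. -/
theorem IsFundSol.offDiagonalBound (hΓ : IsFundSol ω A Γ) (hA : IsElliptic ω M ν A) (hM : 0 < M)
    (hν : 0 < ν) (hω : IsA2Weight ω) (hn : 1 ≤ n) :
    (∀ᵐ p : ℝ × ℝ, p.2 < p.1 →
      OffDiagonalBound ω (1 / (4 * (M ^ 2 / ν))) 1 (p.1 - p.2) (Γ p.1 p.2)) ∧
    (IsContVersion ω Γ → ∀ t s : ℝ, s < t →
      OffDiagonalBound ω (1 / (4 * (M ^ 2 / ν))) 1 (t - s) (Γ t s)) := by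
  obtain ⟨𝒟, hsub, hcount, hdense⟩ := exists_countable_dense_test hω
  have hκ : 0 < M ^ 2 / ν := by positivity
  constructor
  · have h1 : ∀ᵐ p : ℝ × ℝ, p.2 < p.1 → DaviesFamily (M ^ 2 / ν) (p.1 - p.2) 𝒟 (Γ p.1 p.2) := by
      have h2 : ∀ᵐ p : ℝ × ℝ, ∀ (q : ℚ) (S : Finset ℕ) (j k : ℕ), ∀ ψ ∈ 𝒟, ∀ χ ∈ 𝒟,
          ∀ hq : 0 < q, p.2 < p.1 → DaviesBound (M ^ 2 / ν) (p.1 - p.2)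
            ((isExpWeight_distWeight (n := n) S j k).const_mul
              (Rat.cast_nonneg.2 hq.le : (0 : ℝ) ≤ q)) (Γ p.1 p.2) ψ χ := by
        simp only [ae_all_iff, ae_ball_iff hcount]
        intro q S j k ψ hψ χ hχ hq
        exact hΓ.ae_daviesBound hA hM hν hω hn _ (hsub hψ) (hsub hχ)
      filter_upwards [h2] with p hp hlt q hq S j k ψ hψ χ hχ using hp q S j k ψ hψ χ hχ hq hlt
    filter_upwards [h1] with p hp hlt
    exact (hp hlt).offDiagonalBound hκ (by linarith) hdense hsub
  · intro hcv t s hst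
    refine DaviesFamily.offDiagonalBound hκ (by linarith) hdense hsub ?_
    intro q hq S j k ψ hψ χ hχ
    exact hΓ.daviesBound_of_isContVersion hcv hA hM hν hω hn _ (hsub hψ) (hsub hχ) t s hst

end OffDiagonal

/-! ### The backward equation by time reversal. -/

section Reversal

variable {M ν : ℝ} {A : ℝ → Rn n → Matrix (Fin n) (Fin n) ℂ}
  {Γ' : ℝ → ℝ → L2w ω →L[ℂ] L2w ω}

theorem conjTranspose_mulVec_dotProduct (B : Matrix (Fin n) (Fin n) ℂ) (ξ ζ : Fin n → ℂ) :
    (Bᴴ *ᵥ ξ) ⬝ᵥ ζ = star ((B *ᵥ star ζ) ⬝ᵥ star ξ) := by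
  rw [← Matrix.dotProduct_star, ← Matrix.vecMul_conjTranspose, dotProduct_comm,
    Matrix.dotProduct_mulVec, dotProduct_comm]

/-- The time-reversed adjoint coefficients. -/
def reverseAdjoint (A : ℝ → Rn n → Matrix (Fin n) (Fin n) ℂ) :
    ℝ → Rn n → Matrix (Fin n) (Fin n) ℂ :=
  fun t x => (A (-t) x)ᴴ

/-- The adjoint exchanges and conjugates `ξ` and `ζ`, leaving `M` unchanged, and conjugates the
quadratic form, leaving its real part unchanged. -/
theorem IsElliptic.reverseAdjoint (hA : IsElliptic ω M ν A) :
    IsElliptic ω M ν (reverseAdjoint A) where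
  measurable i j := by
    have hmp : MeasurePreserving (Prod.map Neg.neg id : ℝ × Rn n → ℝ × Rn n) volume volume :=
      (Measure.measurePreserving_neg (volume : Measure ℝ)).prod (MeasurePreserving.id volume)
    have h1 := (hA.measurable j i).comp_quasiMeasurePreserving hmp.quasiMeasurePreserving
    exact continuous_star.measurable.comp_aemeasurable h1
  upper t x ξ ζ := by
    have h1 := hA.upper (-t) x (WithLp.toLp 2 (star ζ.ofLp)) (WithLp.toLp 2 (star ξ.ofLp))
    have h2 : ∀ η : Cn n, ‖(WithLp.toLp 2 (star η.ofLp) : Cn n)‖ = ‖η‖ := fun η => by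
      simp [EuclideanSpace.norm_eq]
    rw [h2, h2] at h1
    rw [DegParabolic.reverseAdjoint, conjTranspose_mulVec_dotProduct, norm_star]
    refine h1.trans (le_of_eq (by ring))
  lower t x ξ := by
    have h1 := hA.lower (-t) x ξ
    rw [DegParabolic.reverseAdjoint, conjTranspose_mulVec_dotProduct, star_star]
    exact h1

theorem IsEnergyClass.comp_neg {u : ℝ → L2w ω} {G : ℝ → L2wVec ω} (h : IsEnergyClass ω u G) :
    IsEnergyClass ω (fun t => u (-t)) (fun t => G (-t)) where
  locInt := by
    have h1 := locallyIntegrable_map_homeomorph (Homeomorph.neg ℝ) (f := u) (μ := volume)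
    have h2 : Measure.map (Homeomorph.neg ℝ) volume = (volume : Measure ℝ) :=
      Measure.map_neg_eq_self volume
    rw [h2] at h1
    exact h1.1 h.locInt
  gradL2 := h.gradL2.comp_measurePreserving (Measure.measurePreserving_neg volume)
  isGrad := (Measure.measurePreserving_neg volume).quasiMeasurePreserving.ae h.isGrad

theorem IsTest.comp_neg {φ : ℝ → ℂ} (hφ : IsTest φ) : IsTest fun t => φ (-t) :=
  ⟨hφ.1.comp contDiff_neg, hφ.2.comp_homeomorph (Homeomorph.neg ℝ)⟩

theorem IsTest.comp_neg_fst {Φ : ℝ × Rn n → ℂ} (hΦ : IsTest Φ) :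
    IsTest fun p : ℝ × Rn n => Φ (-p.1, p.2) :=
  ⟨hΦ.1.comp (contDiff_fst.neg.prodMk contDiff_snd),
    hΦ.2.comp_homeomorph ((Homeomorph.neg ℝ).prodCongr (Homeomorph.refl (Rn n)))⟩

theorem SolvesForward.comp_neg {φ : ℝ → ℂ} {ψ : L2w ω} {u : ℝ → L2w ω} {G : ℝ → L2wVec ω}
    (h : SolvesForward ω (reverseAdjoint A) φ ψ u G) :
    SolvesBackward ω A (fun t => φ (-t)) ψ (fun t => u (-t)) (fun t => G (-t)) := by
  intro Φ hΦ
  have h1 := h _ hΦ.comp_neg_fst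
  rw [← integral_neg_eq_self (μ := (volume : Measure ℝ)),
    ← integral_neg_eq_self (μ := (volume : Measure ℝ)) (fun t => ∫ x, φ t * _ * _ ∂_)] at h1
  simp only [neg_neg, reverseAdjoint] at h1
  rw [← h1]
  refine integral_congr_ae (Eventually.of_forall fun s => integral_congr_ae
    (Eventually.of_forall fun x => ?_))
  have h2 : deriv (fun τ => Φ (-τ, x)) (-s) = -deriv (fun τ => Φ (τ, x)) s := by
    have := deriv_comp_neg (fun τ => Φ (τ, x)) (-s)
    simpa using this
  simp only [h2]
  ring

/-- Under `t ↦ -t` the time derivative changes sign and the future `[s, ∞)` becomes the past, so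
forward solutions for the reversed adjoint correspond to backward ones for `A`. -/
theorem IsBackwardFundSol.isFundSol_comp_neg (hΓ : IsBackwardFundSol ω A Γ') :
    IsFundSol ω (reverseAdjoint A) fun t s => Γ' (-t) (-s) where
  bounded := hΓ.bounded.imp fun _ hK t s => hK _ _
  causal t s hts := hΓ.causal _ _ (neg_lt_neg hts)
  measurable ψ hψ χ hχ := (hΓ.measurable ψ hψ χ hχ).comp
    (measurable_fst.neg.prodMk measurable_snd.neg)
  represents φ hφ ψ hψ u G huG hu χ hχ := by
    have h1 := hΓ.represents _ hφ.comp_neg ψ hψ _ _ huG.comp_neg hu.comp_neg χ hχ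
    have h2 := (Measure.measurePreserving_neg (volume : Measure ℝ)).quasiMeasurePreserving.ae h1
    filter_upwards [h2] with t ht
    rw [neg_neg] at ht
    rw [ht, integral_Ici_eq_integral_Ioi, ← integral_comp_neg_Iic]
    simp only [neg_neg]

theorem IsContVersion.comp_neg (h : IsContVersion ω fun t s => Γ' s t) :
    IsContVersion ω fun t s => Γ' (-t) (-s) := fun ψ hψ χ hχ =>
  ⟨fun s => ((h ψ hψ χ hχ).2 (-s)).comp continuous_neg.continuousOn fun _ ht => Set.mem_Iio.2 (neg_lt_neg ht),
    fun t => ((h ψ hψ χ hχ).1 (-t)).comp continuous_neg.continuousOn 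
      fun _ hs => Set.mem_Ioi.2 (neg_lt_neg hs)⟩

theorem IsBackwardFundSol.offDiagonalBound (hΓ : IsBackwardFundSol ω A Γ')
    (hA : IsElliptic ω M ν A) (hM : 0 < M) (hν : 0 < ν) (hω : IsA2Weight ω) (hn : 1 ≤ n) :
    (∀ᵐ p : ℝ × ℝ, p.1 < p.2 →
      OffDiagonalBound ω (1 / (4 * (M ^ 2 / ν))) 1 (p.2 - p.1) (Γ' p.1 p.2)) ∧
    (IsContVersion ω (fun t s => Γ' s t) → ∀ t s : ℝ, s < t →
      OffDiagonalBound ω (1 / (4 * (M ^ 2 / ν))) 1 (t - s) (Γ' s t)) := by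
  obtain ⟨h1, h2⟩ := hΓ.isFundSol_comp_neg.offDiagonalBound hA.reverseAdjoint hM hν hω hn
  have e : ∀ a b : ℝ, -a - -b = b - a := fun a b => by ring
  constructor
  · have hmp : MeasurePreserving (Prod.map Neg.neg Neg.neg : ℝ × ℝ → ℝ × ℝ) volume volume :=
      (Measure.measurePreserving_neg (volume : Measure ℝ)).prod
        (Measure.measurePreserving_neg (volume : Measure ℝ))
    filter_upwards [hmp.quasiMeasurePreserving.ae h1] with p hp hlt
    have h3 := hp (neg_lt_neg hlt)
    simp only [Prod.map_fst, Prod.map_snd, neg_neg, e] at h3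
    exact h3
  · intro hcv t s hst
    have h3 := h2 hcv.comp_neg (-s) (-t) (neg_lt_neg hst)
    simp only [neg_neg, e] at h3
    exact h3

end Reversal

end DegParabolic

end

theorem mainTheorem2 (n : ℕ) (hn : 1 ≤ n) (M ν : ℝ) (hM : 0 < M) (hν : 0 < ν) :
    ∃ c C : ℝ, 0 < c ∧ 0 < C ∧
      ∀ ω : DegParabolic.Rn n → ℝ, DegParabolic.IsA2Weight ω →
      ∀ A : ℝ → DegParabolic.Rn n → Matrix (Fin n) (Fin n) ℂ, DegParabolic.IsElliptic ω M ν A →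
        (∀ Γ : ℝ → ℝ → DegParabolic.L2w ω →L[ℂ] DegParabolic.L2w ω,
          DegParabolic.IsFundSol ω A Γ →
            (∀ᵐ p : ℝ × ℝ, p.2 < p.1 →
              DegParabolic.OffDiagonalBound ω c C (p.1 - p.2) (Γ p.1 p.2)) ∧
            (DegParabolic.IsContVersion ω Γ →
              ∀ t s : ℝ, s < t → DegParabolic.OffDiagonalBound ω c C (t - s) (Γ t s))) ∧
        (∀ Γ' : ℝ → ℝ → DegParabolic.L2w ω →L[ℂ] DegParabolic.L2w ω,
          DegParabolic.IsBackwardFundSol ω A Γ' →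
            (∀ᵐ p : ℝ × ℝ, p.1 < p.2 →
              DegParabolic.OffDiagonalBound ω c C (p.2 - p.1) (Γ' p.1 p.2)) ∧
            (DegParabolic.IsContVersion ω (fun t s => Γ' s t) →
              ∀ t s : ℝ, s < t → DegParabolic.OffDiagonalBound ω c C (t - s) (Γ' s t))) := by
  exact ⟨1 / (4 * (M ^ 2 / ν)), 1, by positivity, one_pos, fun ω hω A hA =>
    ⟨fun Γ hΓ => hΓ.offDiagonalBound hA hM hν hω hn,
      fun Γ' hΓ' => hΓ'.offDiagonalBound hA hM hν hω hn⟩⟩
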